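/- For real $\alpha,\beta\ge 1$ (the only parameters needed below) and an integer $\ell\ge 0$ let $p_\ell^{(\alpha,\beta)}$ be the orthonormalized Jacobi polynomial, i.e. the polynomial of degree $\ell$ with $$(1-x)^\alpha(1+x)^\beta p_\ell^{(\alpha,\beta)}(x)=\left\{\frac{2\ell+\alpha+\beta+1}{2^{\alpha+\beta+1}}\frac{\Gamma(\ell+1)\Gamma(\ell+\alpha+\beta+1)}{\Gamma(\ell+\alpha+1)\Gamma(\ell+\beta+1)}\right\}^{1/2}\frac{(-1)^\ell}{2^\ell \ell!}\frac{d^\ell}{dx^\ell}\left((1-x)^{\ell+\alpha}(1+x)^{\ell+\beta}\right),\qquad x\in(-1,1),$$ and let $K_m^{(\alpha,\beta)}(x)=\sum_{\ell=0}^{m-1}p_\ell^{(\alpha,\beta)}(1)\,p_\ell^{(\alpha,\beta)}(x)$. There exist absolute constants $c_0,C>0$ (independent of all of $a,b,A,B,p,\alpha,\beta,r,s,m,n$) such that the following hold, where $n,m$ are non-negative integers and all other parameters are real. (a) Let $a\ge b\ge 0$, $A\ge B\ge 1$, $0<p<\infty$, $2b\ge pB+p/2$, $2a+2<pA+p/2$,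 and $$n\ge c_0\,A\left\{\frac{2a+2}{p(A+1/2)-2a-2}\right\}^{1/p}.$$ Then $$\int_{-1}^1\left|\frac{p_n^{(A,B)}(x)}{p_n^{(A,B)}(1)}\right|^p(1-x)^a(1+x)^b\,dx\le C\,\frac{2^{a+b}}{2a+2}\left\{\frac{A^{1/6}}{2^{(A+B-1)/2}\,p_n^{(A,B)}(1)}\right\}^{\frac{2a+2}{A+1/2}}\left\{\frac{2a+2}{p(A+1/2)-2a-2}\right\}^{\frac{2a+2}{p(A+1/2)}}.$$ (b) If $\alpha\ge\beta\ge 2$, $r\ge s>-1$ and $n\ge(2\alpha+r+1)^2$, then $$\int_{-1}^1\left|\frac{p_n^{(\alpha+r+1,\beta-1)}(x)}{p_n^{(\alpha+r+1,\beta-1)}(1)}\right|^2(1-x)^{s+\alpha}(1+x)^\beta\,dx\le C\,2^{\alpha+\beta+s}(\alpha+r+1)^{1/3}\,\Gamma(\alpha+r+2)^{\frac{4\alpha+4s+4}{2\alpha+2r+3}}\,n^{-2\alpha-2s-2}.$$ (c) If $\alpha\ge\beta\ge 2$, $r\ge s>-1$, $n\ge(2\alpha+r+1)^2$ and $m\ge(\alpha+\beta)^2$,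 then $$K_m^{(\alpha,\beta)}(1)\int_{-1}^1\left|\frac{p_n^{(\alpha+r+1,\beta-1)}(x)}{p_n^{(\alpha+r+1,\beta-1)}(1)}\right|^2(1-x)^{s+\alpha}(1+x)^\beta\,dx\le C\,e^{2r-2s}\,2^s\left(\frac mn\right)^{2\alpha+2s+2}m^{-2s}\,\frac{\Gamma(\alpha+r+2)^2}{\Gamma(\alpha+1)\Gamma(\alpha+2)}\,(\alpha+r+2)^{2s-2r-2/3}.$$ -/

import Mathlib

open Polynomial in
/-- The orthonormalized Jacobi polynomial `p_ℓ^{(α,β)}` (for `α, β > -1`), as a polynomial.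

It is the polynomial given by Rodrigues' formula (see `jacobiP_rodrigues`), namely the
normalizing factor
`{(2ℓ+α+β+1) / 2^{α+β+1} * Γ(ℓ+1) Γ(ℓ+α+β+1) / (Γ(ℓ+α+1) Γ(ℓ+β+1))}^{1/2}`
times the classical Jacobi polynomial
`∑_{k ≤ ℓ} binom(ℓ+α, k) binom(ℓ+β, ℓ-k) ((x-1)/2)^{ℓ-k} ((x+1)/2)^k`,
where `binom(y, k) = y (y-1) ⋯ (y-k+1) / k!`. (If `ℓ = 0` and `α + β = -1` the normalizing factor
has the form `0 * ∞` and has to be read as a limit, which this definition does not do; below,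
always `α + β ≥ 2`.) -/
noncomputable def jacobiP (α β : ℝ) (ℓ : ℕ) : ℝ[X] :=
  C (Real.sqrt ((2 * ℓ + α + β + 1) / (2 : ℝ) ^ (α + β + 1) *
      (Real.Gamma (ℓ + 1) * Real.Gamma (ℓ + α + β + 1) /
        (Real.Gamma (ℓ + α + 1) * Real.Gamma (ℓ + β + 1))))) *
    ∑ k ∈ Finset.range (ℓ + 1),
      C ((descPochhammer ℝ k).eval (ℓ + α) / (k.factorial : ℝ) *
          ((descPochhammer ℝ (ℓ - k)).eval (ℓ + β) / ((ℓ - k).factorial : ℝ))) *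
        (C (1 / 2) * (X - 1)) ^ (ℓ - k) * (C (1 / 2) * (X + 1)) ^ k

/-- Rodrigues' formula for the orthonormalized Jacobi polynomials on `(-1, 1)`. Since a
polynomial is determined by its values on `(-1, 1)`, this characterizes `jacobiP α β ℓ`. -/
theorem jacobiP_rodrigues (α β : ℝ) (ℓ : ℕ) {x : ℝ} (hx : x ∈ Set.Ioo (-1 : ℝ) 1) :
    (1 - x) ^ α * (1 + x) ^ β * (jacobiP α β ℓ).eval x =
      Real.sqrt ((2 * ℓ + α + β + 1) / (2 : ℝ) ^ (α + β + 1) *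
        (Real.Gamma (ℓ + 1) * Real.Gamma (ℓ + α + β + 1) /
          (Real.Gamma (ℓ + α + 1) * Real.Gamma (ℓ + β + 1)))) *
      ((-1) ^ ℓ / (2 ^ ℓ * (ℓ.factorial : ℝ))) *
      iteratedDeriv ℓ (fun t : ℝ => (1 - t) ^ (ℓ + α) * (1 + t) ^ (ℓ + β)) x := by
  obtain ⟨h1, h2⟩ := hx
  have hm : 0 < 1 - x := by linarith
  have hp : 0 < 1 + x := by linarith
  have hf : ∀ i : ℕ, iteratedDeriv i (fun t : ℝ => (1 - t) ^ (ℓ + α)) x =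
      (-1) ^ i * ((descPochhammer ℝ i).eval (ℓ + α) * (1 - x) ^ (ℓ + α - i)) := by
    intro i
    have h := congrFun (iteratedDeriv_comp_const_sub i (fun t : ℝ => t ^ ((ℓ : ℝ) + α)) (1 : ℝ)) x
    rw [h]
    simp only [smul_eq_mul]
    rw [iteratedDeriv_eq_iterate, Real.iter_deriv_rpow_const]
  have hg : ∀ i : ℕ, iteratedDeriv i (fun t : ℝ => (1 + t) ^ (ℓ + β)) x =
      (descPochhammer ℝ i).eval (ℓ + β) * (1 + x) ^ (ℓ + β - i) := by
    intro i
    have h := congrFun (iteratedDeriv_comp_const_add i (fun t : ℝ => t ^ ((ℓ : ℝ) + β)) (1 : ℝ)) x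
    rw [h, iteratedDeriv_eq_iterate, Real.iter_deriv_rpow_const]
  have hfc : ContDiffAt ℝ ℓ (fun t : ℝ => (1 - t) ^ (ℓ + α)) x :=
    (contDiffAt_const.sub contDiffAt_id).rpow_const_of_ne hm.ne'
  have hgc : ContDiffAt ℝ ℓ (fun t : ℝ => (1 + t) ^ (ℓ + β)) x :=
    (contDiffAt_const.add contDiffAt_id).rpow_const_of_ne hp.ne'
  rw [iteratedDeriv_fun_mul hfc hgc]
  simp only [hf, hg, jacobiP, Polynomial.eval_mul, Polynomial.eval_C, Polynomial.eval_finsetSum,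
    Polynomial.eval_pow, Polynomial.eval_sub, Polynomial.eval_add, Polynomial.eval_X,
    Polynomial.eval_one]
  generalize Real.sqrt _ = N
  rw [mul_left_comm, mul_assoc N]
  congr 1
  rw [Finset.mul_sum, Finset.mul_sum]
  refine Finset.sum_congr rfl fun k hk => ?_
  obtain ⟨j, rfl⟩ := Nat.exists_eq_add_of_le (Nat.lt_succ_iff.mp (Finset.mem_range.mp hk))
  have e1 : (1 - x) ^ (((k + j : ℕ) : ℝ) + α - k) = (1 - x) ^ α * (1 - x) ^ j := by
    rw [← Real.rpow_natCast, ← Real.rpow_add hm]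
    congr 1
    push_cast
    ring
  have e2 : (1 + x) ^ (((k + j : ℕ) : ℝ) + β - j) = (1 + x) ^ β * (1 + x) ^ k := by
    rw [← Real.rpow_natCast, ← Real.rpow_add hp]
    congr 1
    push_cast
    ring
  have e3 : ((k + j).choose k : ℝ) = ((k + j).factorial : ℝ) / (k.factorial * j.factorial) := by
    rw [Nat.cast_add_choose]
  have e4 : (x - 1) = (-1) * (1 - x) := by ring
  have hk0 : (k.factorial : ℝ) ≠ 0 := by positivity
  have hj0 : (j.factorial : ℝ) ≠ 0 := by positivity
  have hkj0 : ((k + j).factorial : ℝ) ≠ 0 := by positivity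
  rw [Nat.add_sub_cancel_left, e1, e2, e3, e4]
  simp only [mul_pow, pow_add, one_div, inv_pow, add_comm x 1]
  generalize (descPochhammer ℝ k).eval _ = u
  generalize (descPochhammer ℝ j).eval _ = v
  generalize (1 - x) ^ α = w
  generalize (1 + x) ^ β = z
  have e6 : ((-1 : ℝ)) ^ k * (-1) ^ k = 1 := by rw [← pow_add, ← two_mul, pow_mul]; norm_num
  field_simp
  linear_combination (-(w * z * u * v)) * e6

/-- The kernel `K_n^{(α,β)}(x) = ∑_{ℓ=0}^{n-1} p_ℓ^{(α,β)}(1) p_ℓ^{(α,β)}(x)`. -/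
noncomputable def jacobiK (α β : ℝ) (n : ℕ) (x : ℝ) : ℝ :=
  ∑ ℓ ∈ Finset.range n, (jacobiP α β ℓ).eval 1 * (jacobiP α β ℓ).eval x

/-!
All three bounds come from one pointwise estimate for orthonormal Jacobi polynomials `p_n` with
parameters `A ≥ B ≥ 1`: on `[-1, 1]`,
`(1 - x)^{A+1/2} (1 + x)^{B+1/2} p_n(x)² ≤ 4 A^{1/3}` once `n ≥ 15 A` (`jacobiP_sq_le_of_large`), and
`≤ 256 √(A/n) A^{1/3}` for smaller `n ≥ 1` (`jacobiP_sq_le_of_small`).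

**The pointwise estimate.** With `x = cos 2t`, the function
`u(t) = (sin t)^{A+1/2} (cos t)^{B+1/2} P_n(x)` solves `u'' + F u = 0` on `(0, π/2)`, where
`F = L² - a²/sin² t - b²/cos² t`, `L = 2n + A + B + 1`, `a² = A² - 1/4` and `b² = B² - 1/4`
(`isTrigSolution_jacobiWave`). The coefficient can be written `F = F_max - D²` with
`D = a cot t - b tan t` decreasing. The energy `E = u'² + F u²` has `E' = F' u²`, so it vanishes at
both ends, increases up to the maximum point of `F` and decreases from there. Two facts relate it to
`∫ u²`, which the normalization determines: integrating `(u u')' = 2 u'² - E` gives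
`∫ E ≤ 2 F_max ∫ u²`, and Sonin's monotonicity of `E / F` gives `E_max F ≤ F_max E`. Hence `E_max` is
bounded by `∫ u²` as soon as `F` is comparable to `F_max` on an interval (`E_le_integral`).

It remains to bound `M = max u²` by `E_max / F_max`, at the price of a factor `A^{1/3}`. By reflection
one may suppose that `M` is attained at a point `m` where `F` increases. There `u²` lies above a
parabola to the left of `m`; since `E(m) = F(m) M` also collects `∫ F' u²` along the way, this gives
`F(m)³ ≥ (25/144) F'(m)²` (`trigCoeffDeriv_sq_le`), and therefore `F_max ≤ (11/5) A^{2/3} F(m)`. To the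
right of `m`, `F` is compared with the parabola `H` with the same value and slope at `m` and the largest
curvature possible. A corrected adiabatic invariant `E/√H + H' u u' / (2 H^{3/2}) + …` is then
nondecreasing up to the vertex of `H` (`hasDerivAt_invariant`), where `H` is at least `F_max / 6`. This
gives `M² F(m) F_max ≤ 6 E_max²` (`sq_mul_le_of_isMax`).

**The integrals.** Sonin's function for the Jacobi equation shows `|p_n(x)| ≤ p_n(1)`
(`abs_jacobiP_div_le_one`). The integrand is thus at most a multiple of `(1 - x)^a`, and by the
pointwise estimate at most a multiple of `(1 - x)^{a - p(A + 1/2)/2}`; the integral is split where both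
bounds agree (`integral_le_of_le_rpow`). This yields the `L^p` bound for any admissible constant in the
pointwise estimate (`integral_jacobiP_rpow_le`). For `p = 2` and large `n`, the closed form of `p_n(1)`
turns it into a bound in `n`. The kernel at `1` also has a closed form (`jacobiK_one`), and a lower
bound of Stirling type for `Γ` (`le_Gamma_add_one`) gives the final form of the product.
-/

/-! ### The unnormalized Jacobi polynomial -/

/-- The coefficient `binom(n+α, k) binom(n+β, n-k)` of the Jacobi polynomial of degree `n` in the
homogeneous basis `((x-1)/2)^(n-k) ((x+1)/2)^k`. -/
noncomputable def jacobiCoeff (α β : ℝ) (n k : ℕ) : ℝ :=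
  (descPochhammer ℝ k).eval (n + α) / (k.factorial : ℝ) *
    ((descPochhammer ℝ (n - k)).eval (n + β) / ((n - k).factorial : ℝ))

open Polynomial in
/-- The basis polynomial `((x-1)/2)^j ((x+1)/2)^k`. -/
noncomputable def endpointMonomial (j k : ℕ) : ℝ[X] :=
  (C (1 / 2) * (X - 1)) ^ j * (C (1 / 2) * (X + 1)) ^ k

open Polynomial in
/-- The classical (not normalized) Jacobi polynomial `P_n^{(α,β)}`. -/
noncomputable def jacobiPoly (α β : ℝ) (n : ℕ) : ℝ[X] :=
  ∑ k ∈ Finset.range (n + 1), C (jacobiCoeff α β n k) * endpointMonomial (n - k) k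

/-- The square of the factor that normalizes `jacobiPoly`. -/
noncomputable def jacobiNormSq (α β : ℝ) (n : ℕ) : ℝ :=
  (2 * n + α + β + 1) / (2 : ℝ) ^ (α + β + 1) *
      (Real.Gamma (n + 1) * Real.Gamma (n + α + β + 1) /
        (Real.Gamma (n + α + 1) * Real.Gamma (n + β + 1)))

open Polynomial in
theorem jacobiP_eq (α β : ℝ) (n : ℕ) :
    jacobiP α β n = C (Real.sqrt (jacobiNormSq α β n)) * jacobiPoly α β n := by
  simp only [jacobiP, jacobiPoly, jacobiNormSq, jacobiCoeff, endpointMonomial, mul_assoc]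

theorem descPochhammer_eval_div_factorial_succ (y : ℝ) (k : ℕ) :
    (k + 1) * ((descPochhammer ℝ (k + 1)).eval y / ((k + 1).factorial : ℝ)) =
      (y - k) * ((descPochhammer ℝ k).eval y / (k.factorial : ℝ)) := by
  have h : (k.factorial : ℝ) ≠ 0 := by positivity
  have h' : (k : ℝ) + 1 ≠ 0 := by positivity
  rw [descPochhammer_succ_eval, Nat.factorial_succ]
  push_cast
  field_simp

theorem jacobiCoeff_succ (α β : ℝ) (j k : ℕ) :
    (k + 1) * (k + 1 + β) * jacobiCoeff α β (j + k + 1) (k + 1) =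
      (j + 1) * (j + 1 + α) * jacobiCoeff α β (j + k + 1) k := by
  have e1 : j + k + 1 - (k + 1) = j := by omega
  have e2 : j + k + 1 - k = j + 1 := by omega
  rw [jacobiCoeff, jacobiCoeff, e1, e2]
  have h1 := descPochhammer_eval_div_factorial_succ (((j + k + 1 : ℕ) : ℝ) + α) k
  have h2 := descPochhammer_eval_div_factorial_succ (((j + k + 1 : ℕ) : ℝ) + β) j
  generalize (descPochhammer ℝ (k + 1)).eval _ / _ = u at *
  generalize (descPochhammer ℝ k).eval _ / _ = u' at *
  generalize (descPochhammer ℝ (j + 1)).eval _ / _ = v at *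
  generalize (descPochhammer ℝ j).eval _ / _ = v' at *
  push_cast at h1 h2
  linear_combination (k + 1 + β) * v' * h1 - (j + 1 + α) * u' * h2

open Polynomial in
theorem endpointMonomial_derivative (j k : ℕ) :
    derivative (endpointMonomial j k) =
      C (1 / 2) * (C (j : ℝ) * endpointMonomial (j - 1) k +
        C (k : ℝ) * endpointMonomial j (k - 1)) := by
  simp only [endpointMonomial, derivative_mul, derivative_pow, derivative_C, derivative_sub,
    derivative_add, derivative_X, derivative_one]
  ring

/-- The Jacobi differential operator on a basis polynomial, in the form which telescopes when
summed against the coefficients of the Jacobi polynomial. -/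
theorem endpointMonomial_operator (α β : ℝ) (j k : ℕ) (x : ℝ) :
    (1 - x ^ 2) * (Polynomial.derivative (Polynomial.derivative (endpointMonomial j k))).eval x +
      (β - α - (α + β + 2) * x) * (Polynomial.derivative (endpointMonomial j k)).eval x +
      (j + k) * (j + k + α + β + 1) * (endpointMonomial j k).eval x =
    k * (k + β) * ((endpointMonomial j k).eval x - (endpointMonomial (j + 1) (k - 1)).eval x) -
      j * (j + α) * ((endpointMonomial (j - 1) (k + 1)).eval x -
        (endpointMonomial j k).eval x) := by
  simp only [endpointMonomial_derivative, Polynomial.derivative_mul, Polynomial.derivative_C,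
    Polynomial.derivative_add, Polynomial.eval_mul, Polynomial.eval_add, Polynomial.eval_C,
    zero_mul, zero_add]
  rcases j with _ | _ | j <;> rcases k with _ | _ | k <;>
    simp [endpointMonomial] <;> ring

/-- The Jacobi differential equation: `endpointMonomial_operator` and the recursion
`jacobiCoeff_succ` make the sum telescope. -/
theorem jacobiPoly_ode (α β : ℝ) (n : ℕ) (x : ℝ) :
    (1 - x ^ 2) * (Polynomial.derivative (Polynomial.derivative (jacobiPoly α β n))).eval x +
      (β - α - (α + β + 2) * x) * (Polynomial.derivative (jacobiPoly α β n)).eval x +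
      n * (n + α + β + 1) * (jacobiPoly α β n).eval x = 0 := by
  have key : ∀ k ∈ Finset.range (n + 1),
      (1 - x ^ 2) * (jacobiCoeff α β n k *
          (Polynomial.derivative (Polynomial.derivative (endpointMonomial (n - k) k))).eval x) +
        (β - α - (α + β + 2) * x) * (jacobiCoeff α β n k *
          (Polynomial.derivative (endpointMonomial (n - k) k)).eval x) +
        n * (n + α + β + 1) * (jacobiCoeff α β n k * (endpointMonomial (n - k) k).eval x) =
      jacobiCoeff α β n k * (k * (k + β)) * ((endpointMonomial (n - k) k).eval x -
          (endpointMonomial (n - k + 1) (k - 1)).eval x) -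
        jacobiCoeff α β n k * ((n - k : ℕ) * ((n - k : ℕ) + α)) *
          ((endpointMonomial (n - k - 1) (k + 1)).eval x -
          (endpointMonomial (n - k) k).eval x) := by
    intro k hk
    have h := endpointMonomial_operator α β (n - k) k x
    have hn : (n : ℝ) = (n - k : ℕ) + k := by
      rw [← Nat.cast_add, Nat.sub_add_cancel (Nat.lt_succ_iff.mp (Finset.mem_range.mp hk))]
    rw [hn]
    linear_combination (jacobiCoeff α β n k) * h
  simp only [jacobiPoly, Polynomial.derivative_sum, Polynomial.derivative_C_mul,
    Polynomial.eval_finsetSum, Polynomial.eval_C_mul]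
  rw [Finset.mul_sum, Finset.mul_sum, Finset.mul_sum, ← Finset.sum_add_distrib,
    ← Finset.sum_add_distrib, Finset.sum_congr rfl key, Finset.sum_sub_distrib,
    Finset.sum_range_succ' (n := n), Finset.sum_range_succ (n := n)]
  have : ∀ k ∈ Finset.range n,
      jacobiCoeff α β n (k + 1) * ((k + 1 : ℕ) * ((k + 1 : ℕ) + β)) *
        ((endpointMonomial (n - (k + 1)) (k + 1)).eval x -
          (endpointMonomial (n - (k + 1) + 1) (k + 1 - 1)).eval x) =
      jacobiCoeff α β n k * ((n - k : ℕ) * ((n - k : ℕ) + α)) *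
          ((endpointMonomial (n - k - 1) (k + 1)).eval x -
          (endpointMonomial (n - k) k).eval x) := by
    intro k hk
    obtain ⟨j, rfl⟩ := Nat.exists_eq_add_of_lt (Finset.mem_range.mp hk)
    have h := jacobiCoeff_succ α β j k
    rw [show j + k + 1 = k + j + 1 by ring] at h
    have e1 : k + j + 1 - (k + 1) = j := by omega
    have e2 : k + j + 1 - k = j + 1 := by omega
    rw [e1, e2]
    simp only [Nat.add_sub_cancel]
    push_cast
    linear_combination ((endpointMonomial j (k + 1)).eval x -
      (endpointMonomial (j + 1) k).eval x) * h
  rw [Finset.sum_congr rfl this]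
  simp

open Polynomial in
/-- The derivative of a Jacobi polynomial is a multiple of a Jacobi polynomial with both
parameters raised by one. -/
theorem jacobiPoly_derivative (α β : ℝ) (n : ℕ) :
    derivative (jacobiPoly α β (n + 1)) =
      C ((n + α + β + 2) / 2) * jacobiPoly (α + 1) (β + 1) n := by
  have e : ∀ k ∈ Finset.range (n + 1), C ((n + α + β + 2) / 2) *
      (C (jacobiCoeff (α + 1) (β + 1) n k) * endpointMonomial (n - k) k) =
      C (1 / 2) * (C ((n + 1 - k : ℕ) * jacobiCoeff α β (n + 1) k) * endpointMonomial (n - k) k) +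
      C (1 / 2) * (C ((k + 1) * jacobiCoeff α β (n + 1) (k + 1)) * endpointMonomial (n - k) k) := by
    intro k hk
    obtain ⟨j, rfl⟩ := Nat.exists_eq_add_of_le (Nat.lt_succ_iff.mp (Finset.mem_range.mp hk))
    have h : ((k + j : ℕ) + α + β + 2) / 2 * jacobiCoeff (α + 1) (β + 1) (k + j) k =
        1 / 2 * ((k + j + 1 - k : ℕ) * jacobiCoeff α β (k + j + 1) k) +
        1 / 2 * ((k + 1) * jacobiCoeff α β (k + j + 1) (k + 1)) := by
      have e1 : k + j + 1 - (k + 1) = j := by omega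
      have e2 : k + j + 1 - k = j + 1 := by omega
      have e3 : k + j - k = j := by omega
      have e4 : ((k + j : ℕ) : ℝ) + (α + 1) = ((k + j + 1 : ℕ) : ℝ) + α := by push_cast; ring
      have e5 : ((k + j : ℕ) : ℝ) + (β + 1) = ((k + j + 1 : ℕ) : ℝ) + β := by push_cast; ring
      rw [jacobiCoeff, jacobiCoeff, jacobiCoeff, e1, e2, e3, e4, e5]
      have h1 := descPochhammer_eval_div_factorial_succ (((k + j + 1 : ℕ) : ℝ) + α) k
      have h2 := descPochhammer_eval_div_factorial_succ (((k + j + 1 : ℕ) : ℝ) + β) j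
      generalize (descPochhammer ℝ (k + 1)).eval _ / _ = u at *
      generalize (descPochhammer ℝ k).eval _ / _ = u' at *
      generalize (descPochhammer ℝ (j + 1)).eval _ / _ = v at *
      generalize (descPochhammer ℝ j).eval _ / _ = v' at *
      push_cast at h1 h2 ⊢
      linear_combination (-1 / 2 * u') * h2 - 1 / 2 * v' * h1
    simp only [← mul_assoc, ← C_mul]
    rw [← add_mul, ← C_add]
    congr 2
    linear_combination h
  rw [jacobiPoly, jacobiPoly, Finset.mul_sum, Finset.sum_congr rfl e, Finset.sum_add_distrib,
    derivative_sum]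
  simp only [derivative_C_mul, endpointMonomial_derivative]
  have e' : ∀ k, C (jacobiCoeff α β (n + 1) k) * (C (1 / 2) *
      (C ((n + 1 - k : ℕ) : ℝ) * endpointMonomial (n + 1 - k - 1) k +
        C (k : ℝ) * endpointMonomial (n + 1 - k) (k - 1))) =
      C (1 / 2) * (C ((n + 1 - k : ℕ) * jacobiCoeff α β (n + 1) k) *
        endpointMonomial (n + 1 - k - 1) k) +
      C (1 / 2) * (C (k * jacobiCoeff α β (n + 1) k) * endpointMonomial (n + 1 - k) (k - 1)) := by
    intro k
    simp only [C_mul]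
    ring
  simp only [e', Finset.sum_add_distrib]
  rw [Finset.sum_range_succ (n := n + 1)]
  conv_lhs => rw [Finset.sum_range_succ' _ (n + 1)]
  have e1 : ∀ k, n + 1 - k - 1 = n - k := fun k => by omega
  have e2 : ∀ k, n + 1 - (k + 1) = n - k := fun k => by omega
  simp only [e1, e2, Nat.add_sub_cancel, Nat.sub_self, Nat.cast_zero, zero_mul, C_0, mul_zero,
    add_zero, Nat.cast_succ]

theorem jacobiPoly_eval_one (α β : ℝ) (n : ℕ) :
    (jacobiPoly α β n).eval 1 = (descPochhammer ℝ n).eval (n + α) / (n.factorial : ℝ) := by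
  rw [jacobiPoly, Polynomial.eval_finsetSum, Finset.sum_eq_single n]
  · simp [endpointMonomial, jacobiCoeff]; norm_num
  · intro k hk hkn
    have : n - k ≠ 0 := by
      have := Finset.mem_range.mp hk
      omega
    simp [endpointMonomial, this]
  · simp

theorem jacobiPoly_eval_neg_one (α β : ℝ) (n : ℕ) :
    (jacobiPoly α β n).eval (-1) =
      (-1) ^ n * ((descPochhammer ℝ n).eval (n + β) / (n.factorial : ℝ)) := by
  rw [jacobiPoly, Polynomial.eval_finsetSum, Finset.sum_eq_single 0]
  · simp [endpointMonomial, jacobiCoeff]; norm_num [mul_comm]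
  · intro k hk hkn
    simp [endpointMonomial, hkn]
  · simp

/-! ### Normalization -/

theorem integral_rpow_mul_one_sub_rpow {a b : ℝ} (ha : 0 ≤ a) (hb : 0 ≤ b) :
    ∫ t in (0 : ℝ)..1, t ^ a * (1 - t) ^ b =
      Real.Gamma (a + 1) * Real.Gamma (b + 1) / Real.Gamma (a + b + 2) := by
  have h := ProbabilityTheory.beta_eq_betaIntegralReal (a + 1) (b + 1) (by linarith) (by linarith)
  have h2 : Complex.betaIntegral ((a + 1 : ℝ) : ℂ) ((b + 1 : ℝ) : ℂ) =
      ((∫ t in (0 : ℝ)..1, t ^ a * (1 - t) ^ b : ℝ) : ℂ) := by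
    rw [Complex.betaIntegral, ← intervalIntegral.integral_ofReal]
    refine intervalIntegral.integral_congr fun t ht => ?_
    rw [Set.uIcc_of_le zero_le_one] at ht
    obtain ⟨h0, h1⟩ := ht
    have e1 : ((a + 1 : ℝ) : ℂ) - 1 = (a : ℂ) := by push_cast; ring
    have e2 : ((b + 1 : ℝ) : ℂ) - 1 = (b : ℂ) := by push_cast; ring
    simp only [e1, e2]
    rw [Complex.ofReal_mul, Complex.ofReal_cpow h0, Complex.ofReal_cpow (by linarith)]
    push_cast
    rfl
  rw [h2, Complex.ofReal_re, ProbabilityTheory.beta] at h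
  rw [← h, show a + 1 + (b + 1) = a + b + 2 by ring]

theorem sin_pos_of_mem {t : ℝ} (ht : t ∈ Set.Ioo 0 (Real.pi / 2)) : 0 < Real.sin t :=
  Real.sin_pos_of_pos_of_lt_pi ht.1 (by linarith [ht.2, Real.pi_pos])

theorem cos_pos_of_mem {t : ℝ} (ht : t ∈ Set.Ioo 0 (Real.pi / 2)) : 0 < Real.cos t :=
  Real.cos_pos_of_mem_Ioo ⟨by linarith [ht.1, Real.pi_pos], ht.2⟩

/-- The trigonometric form of the Beta integral. -/
theorem integral_sin_rpow_mul_cos_rpow {a b : ℝ} (ha : 0 ≤ a) (hb : 0 ≤ b) :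
    ∫ t in (0 : ℝ)..(Real.pi / 2), Real.sin t ^ (2 * a + 1) * Real.cos t ^ (2 * b + 1) =
      Real.Gamma (a + 1) * Real.Gamma (b + 1) / Real.Gamma (a + b + 2) / 2 := by
  have hpi := Real.pi_pos
  have h := intervalIntegral.integral_comp_mul_deriv'' (a := 0) (b := Real.pi / 2)
    (f := fun t => Real.sin t ^ 2) (f' := fun t => 2 * Real.sin t * Real.cos t)
    (g := fun t => t ^ a * (1 - t) ^ b) (by fun_prop)
    (fun t _ => by
      have := ((Real.hasDerivAt_sin t).pow 2)
      simp only [Nat.cast_ofNat, Nat.add_one_sub_one, pow_one] at this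
      exact this.hasDerivWithinAt)
    (by fun_prop)
    (((Real.continuous_rpow_const ha).mul
      ((Real.continuous_rpow_const hb).comp (by fun_prop))).continuousOn)
  simp only [Real.sin_zero, Real.sin_pi_div_two, one_pow, ne_eq, OfNat.ofNat_ne_zero,
    not_false_eq_true, zero_pow] at h
  rw [integral_rpow_mul_one_sub_rpow ha hb] at h
  rw [← h, ← intervalIntegral.integral_div]
  refine intervalIntegral.integral_congr fun t ht => ?_
  rw [Set.uIcc_of_le (by positivity)] at ht
  have hs : 0 ≤ Real.sin t := Real.sin_nonneg_of_nonneg_of_le_pi ht.1 (by linarith [ht.2])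
  have hc : 0 ≤ Real.cos t := Real.cos_nonneg_of_mem_Icc ⟨by linarith [ht.1], ht.2⟩
  have e : 1 - Real.sin t ^ 2 = Real.cos t ^ 2 := by rw [← Real.cos_sq']
  simp only [Function.comp_apply, e]
  rw [Real.rpow_add_one' hs (by linarith), Real.rpow_add_one' hc (by linarith), Real.rpow_mul hs,
    Real.rpow_mul hc, Real.rpow_two, Real.rpow_two]
  ring

theorem hasDerivAt_one_sub_two_mul_sin_sq (t : ℝ) :
    HasDerivAt (fun t => 1 - 2 * Real.sin t ^ 2) (-(4 * Real.sin t * Real.cos t)) t := by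
  have := (((Real.hasDerivAt_sin t).pow 2).const_mul 2).const_sub 1
  refine this.congr_deriv ?_
  norm_num
  ring

theorem hasDerivAt_eval_one_sub_two_mul_sin_sq (p : Polynomial ℝ) (t : ℝ) :
    HasDerivAt (fun t => p.eval (1 - 2 * Real.sin t ^ 2))
      (-(4 * Real.sin t * Real.cos t) * p.derivative.eval (1 - 2 * Real.sin t ^ 2)) t := by
  have := (p.hasDerivAt (1 - 2 * Real.sin t ^ 2)).comp t (hasDerivAt_one_sub_two_mul_sin_sq t)
  refine this.congr_deriv ?_
  ring

theorem hasDerivAt_sin_rpow_mul_cos_rpow (a b : ℝ) {t : ℝ} (ht : t ∈ Set.Ioo 0 (Real.pi / 2)) :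
    HasDerivAt (fun t => Real.sin t ^ (a + 1) * Real.cos t ^ (b + 1))
      (Real.sin t ^ a * Real.cos t ^ b *
        ((a + 1) * Real.cos t ^ 2 - (b + 1) * Real.sin t ^ 2)) t := by
  have hs := sin_pos_of_mem ht
  have hc := cos_pos_of_mem ht
  have h1 := (Real.hasDerivAt_sin t).rpow_const (p := a + 1) (Or.inl hs.ne')
  have h2 := (Real.hasDerivAt_cos t).rpow_const (p := b + 1) (Or.inl hc.ne')
  refine (h1.mul h2).congr_deriv ?_
  simp only [add_sub_cancel_right]
  rw [Real.rpow_add_one hs.ne', Real.rpow_add_one hc.ne']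
  ring

/-- The squared norm of the Jacobi polynomial, in the variable `t` with `x = cos (2 t)`. -/
noncomputable def jacobiSqIntegral (a b : ℝ) (n : ℕ) : ℝ :=
  ∫ t in (0 : ℝ)..(Real.pi / 2), Real.sin t ^ (2 * a + 1) * Real.cos t ^ (2 * b + 1) *
    (jacobiPoly a b n).eval (1 - 2 * Real.sin t ^ 2) ^ 2

theorem continuous_sin_rpow_mul_cos_rpow {a b : ℝ} (ha : 0 ≤ a) (hb : 0 ≤ b) :
    Continuous fun t => Real.sin t ^ a * Real.cos t ^ b :=
  (Real.continuous_sin.rpow_const fun _ => Or.inr ha).mul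
    (Real.continuous_cos.rpow_const fun _ => Or.inr hb)

theorem continuous_eval_one_sub_two_mul_sin_sq (p : Polynomial ℝ) :
    Continuous fun t => p.eval (1 - 2 * Real.sin t ^ 2) :=
  p.continuous.comp (by fun_prop)

/-- Integration by parts against the Jacobi equation. -/
theorem jacobiSqIntegral_succ {a b : ℝ} (ha : 0 ≤ a) (hb : 0 ≤ b) (n : ℕ) :
    (n + 1) * jacobiSqIntegral a b (n + 1) =
      (n + a + b + 2) * jacobiSqIntegral (a + 1) (b + 1) n := by
  have hpi := Real.pi_pos
  set P := jacobiPoly a b (n + 1) with hP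
  have hd := jacobiPoly_derivative a b n
  rw [← hP] at hd
  set w : ℝ → ℝ := fun t => Real.sin t ^ (2 * a + 1) * Real.cos t ^ (2 * b + 1) with hw
  set W : ℝ → ℝ := fun t => Real.sin t ^ (2 * a + 1 + 1) * Real.cos t ^ (2 * b + 1 + 1) with hW
  set e : Polynomial ℝ → ℝ → ℝ := fun p t => p.eval (1 - 2 * Real.sin t ^ 2) with he
  have hwc : Continuous w := continuous_sin_rpow_mul_cos_rpow (by linarith) (by linarith)
  have hWc : Continuous W := continuous_sin_rpow_mul_cos_rpow (by linarith) (by linarith)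
  have hec : ∀ p, Continuous (e p) := continuous_eval_one_sub_two_mul_sin_sq
  set g : ℝ → ℝ := fun t => (n + 1) * (n + a + b + 2) * (w t * e P t ^ 2) -
    w t * (4 * Real.sin t ^ 2 * Real.cos t ^ 2) * e P.derivative t ^ 2 with hg
  have hgc : Continuous g := by
    have := hec P
    have := hec P.derivative
    fun_prop
  have hderiv : ∀ t ∈ Set.Ioo 0 (Real.pi / 2),
      HasDerivAt (fun t => W t * (e P t * e P.derivative t)) (g t) t := by
    intro t ht
    have h1 := hasDerivAt_sin_rpow_mul_cos_rpow (2 * a + 1) (2 * b + 1) ht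
    have h2 := hasDerivAt_eval_one_sub_two_mul_sin_sq P t
    have h3 := hasDerivAt_eval_one_sub_two_mul_sin_sq P.derivative t
    refine (h1.mul (h2.mul h3)).congr_deriv ?_
    have hW' : Real.sin t ^ (2 * a + 1 + 1) * Real.cos t ^ (2 * b + 1 + 1) =
        w t * (Real.sin t * Real.cos t) := by
      simp only [hw]
      rw [Real.rpow_add_one (sin_pos_of_mem ht).ne', Real.rpow_add_one (cos_pos_of_mem ht).ne']
      ring
    have hode := jacobiPoly_ode a b (n + 1) (1 - 2 * Real.sin t ^ 2)
    rw [← hP] at hode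
    simp only [hg, he, Pi.mul_apply, hW']
    rw [show Real.sin t ^ (2 * a + 1) * Real.cos t ^ (2 * b + 1) = w t from rfl]
    have hcs : Real.cos t ^ 2 = 1 - Real.sin t ^ 2 := Real.cos_sq' t
    have hcs2 : Real.cos t * Real.cos t = 1 - Real.sin t ^ 2 := by rw [← hcs]; ring
    generalize Polynomial.eval _ P = y at *
    generalize Polynomial.eval _ (Polynomial.derivative P) = y' at *
    generalize Polynomial.eval _ (Polynomial.derivative (Polynomial.derivative P)) = y'' at *
    push_cast at hode
    linear_combination (-w t * y) * hode +
      w t * (y * y' * (2 * a + 1 + 1) - 4 * Real.sin t ^ 2 * y * y'') * hcs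
  have hFTC := intervalIntegral.integral_eq_sub_of_hasDerivAt_of_le (by positivity)
    (by
      have := hec P
      have := hec P.derivative
      fun_prop : ContinuousOn (fun t => W t * (e P t * e P.derivative t)) _) hderiv
    (hgc.intervalIntegrable _ _)
  have hW0 : W 0 = 0 := by
    simp only [hW, Real.sin_zero]
    rw [Real.zero_rpow (by linarith), zero_mul]
  have hW1 : W (Real.pi / 2) = 0 := by
    simp only [hW, Real.cos_pi_div_two]
    rw [Real.zero_rpow (by linarith), mul_zero]
  rw [hW0, hW1] at hFTC
  simp only [hg] at hFTC
  rw [intervalIntegral.integral_sub, intervalIntegral.integral_const_mul] at hFTC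
  · have hJ : ∫ t in (0 : ℝ)..(Real.pi / 2),
        w t * (4 * Real.sin t ^ 2 * Real.cos t ^ 2) * e P.derivative t ^ 2 =
        (n + a + b + 2) ^ 2 * jacobiSqIntegral (a + 1) (b + 1) n := by
      rw [jacobiSqIntegral, ← intervalIntegral.integral_const_mul]
      refine intervalIntegral.integral_congr fun t ht => ?_
      rw [Set.uIcc_of_le (by positivity)] at ht
      have hs : 0 ≤ Real.sin t := Real.sin_nonneg_of_nonneg_of_le_pi ht.1 (by linarith [ht.2])
      have hc : 0 ≤ Real.cos t := Real.cos_nonneg_of_mem_Icc ⟨by linarith [ht.1], ht.2⟩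
      simp only [he, hd, hw, Polynomial.eval_mul, Polynomial.eval_C]
      have e1 : ∀ {x y : ℝ}, 0 ≤ x → 0 ≤ y →
          x ^ (2 * (y + 1) + 1) = x ^ (2 * y + 1) * x ^ 2 := by
        intro x y hx hy
        rw [show 2 * (y + 1) + 1 = 2 * y + 1 + (2 : ℕ) by push_cast; ring,
          Real.rpow_add_natCast' hx (by push_cast; linarith)]
      rw [e1 hs ha, e1 hc hb]
      ring
    have hI : ∫ t in (0 : ℝ)..(Real.pi / 2), w t * e P t ^ 2 = jacobiSqIntegral a b (n + 1) := rfl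
    rw [hJ, hI] at hFTC
    have : (n : ℝ) + a + b + 2 ≠ 0 := by positivity
    apply mul_left_cancel₀ this
    linear_combination hFTC
  · have := hec P
    exact (by fun_prop : Continuous _).intervalIntegrable _ _
  · have := hec P.derivative
    exact (by fun_prop : Continuous _).intervalIntegrable _ _

theorem jacobiNormSq_pos {a b : ℝ} (ha : 0 ≤ a) (hb : 0 ≤ b) (n : ℕ) : 0 < jacobiNormSq a b n := by
  have h1 := Real.Gamma_pos_of_pos (show (0 : ℝ) < n + 1 by positivity)
  have h2 := Real.Gamma_pos_of_pos (show (0 : ℝ) < n + a + b + 1 by positivity)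
  have h3 := Real.Gamma_pos_of_pos (show (0 : ℝ) < n + a + 1 by positivity)
  have h4 := Real.Gamma_pos_of_pos (show (0 : ℝ) < n + b + 1 by positivity)
  rw [jacobiNormSq]
  positivity

theorem jacobiNormSq_succ {a b : ℝ} (ha : 0 ≤ a) (hb : 0 ≤ b) (n : ℕ) :
    (n + a + b + 2) * jacobiNormSq a b (n + 1) = 4 * (n + 1) * jacobiNormSq (a + 1) (b + 1) n := by
  have h3 := Real.Gamma_pos_of_pos (show (0 : ℝ) < n + a + 2 by positivity)
  have h4 := Real.Gamma_pos_of_pos (show (0 : ℝ) < n + b + 2 by positivity)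
  have g1 := Real.Gamma_add_one (show (n : ℝ) + 1 ≠ 0 by positivity)
  have g2 := Real.Gamma_add_one (show (n : ℝ) + a + b + 2 ≠ 0 by positivity)
  have e : (2 : ℝ) ^ (a + 1 + (b + 1) + 1) = 4 * 2 ^ (a + b + 1) := by
    rw [show a + 1 + (b + 1) + 1 = a + b + 1 + 2 by ring, Real.rpow_add two_pos]
    norm_num
    ring
  simp only [jacobiNormSq, e]
  push_cast
  rw [g1, show (n : ℝ) + 1 + a + b + 1 = n + a + b + 2 by ring,
    show (n : ℝ) + 1 + a + 1 = n + a + 2 by ring,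
    show (n : ℝ) + 1 + b + 1 = n + b + 2 by ring,
    show (n : ℝ) + (a + 1) + 1 = n + a + 2 by ring,
    show (n : ℝ) + (b + 1) + 1 = n + b + 2 by ring,
    show (n : ℝ) + (a + 1) + (b + 1) + 1 = n + a + b + 2 + 1 by ring, g2]
  have : (2 : ℝ) ^ (a + b + 1) ≠ 0 := by positivity
  field_simp
  ring

/-- The normalizing factor makes the Jacobi polynomials orthonormal. -/
theorem jacobiNormSq_mul_jacobiSqIntegral {a b : ℝ} (ha : 0 ≤ a) (hb : 0 ≤ b) (n : ℕ) :
    2 ^ (a + b + 2) * (jacobiNormSq a b n * jacobiSqIntegral a b n) = 1 := by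
  induction n generalizing a b with
  | zero =>
    have h2 := Real.Gamma_pos_of_pos (show (0 : ℝ) < a + b + 1 by positivity)
    have h3 := Real.Gamma_pos_of_pos (show (0 : ℝ) < a + 1 by positivity)
    have h4 := Real.Gamma_pos_of_pos (show (0 : ℝ) < b + 1 by positivity)
    have hI : jacobiSqIntegral a b 0 =
        Real.Gamma (a + 1) * Real.Gamma (b + 1) / Real.Gamma (a + b + 2) / 2 := by
      rw [← integral_sin_rpow_mul_cos_rpow ha hb]
      simp [jacobiSqIntegral, jacobiPoly, jacobiCoeff, endpointMonomial]
    have e : (2 : ℝ) ^ (a + b + 2) = 2 * 2 ^ (a + b + 1) := by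
      rw [show a + b + 2 = a + b + 1 + 1 by ring, Real.rpow_add_one two_ne_zero]
      ring
    have g2 := Real.Gamma_add_one (show a + b + 1 ≠ 0 by positivity)
    rw [show a + b + 1 + 1 = a + b + 2 by ring] at g2
    rw [hI, jacobiNormSq, e, g2]
    have : (2 : ℝ) ^ (a + b + 1) ≠ 0 := by positivity
    have : a + b + 1 ≠ 0 := by positivity
    simp only [Nat.cast_zero, zero_add, mul_zero, Real.Gamma_one]
    field_simp
  | succ n ih =>
    have h := ih (a := a + 1) (b := b + 1) (by linarith) (by linarith)
    have h1 := jacobiSqIntegral_succ ha hb n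
    have h2 := jacobiNormSq_succ ha hb n
    have e : (2 : ℝ) ^ (a + 1 + (b + 1) + 2) = 4 * 2 ^ (a + b + 2) := by
      rw [show a + 1 + (b + 1) + 2 = a + b + 2 + 2 by ring, Real.rpow_add two_pos]
      norm_num
      ring
    rw [e] at h
    have p1 : (n : ℝ) + 1 ≠ 0 := by positivity
    have p2 : (n : ℝ) + a + b + 2 ≠ 0 := by positivity
    apply mul_left_cancel₀ (mul_ne_zero p1 p2)
    linear_combination (2 : ℝ) ^ (a + b + 2) * ((n + a + b + 2) * jacobiNormSq a b (n + 1)) * h1 +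
      (2 : ℝ) ^ (a + b + 2) * (n + a + b + 2) * jacobiSqIntegral (a + 1) (b + 1) n * h2 +
      (n + 1) * (n + a + b + 2) * h

/-! ### Oscillation theory for a trigonometric Schrödinger equation -/

/-- The coefficient `Λ² - a²/sin² t - b²/cos² t` of the equation `u'' + F u = 0`. -/
noncomputable def trigCoeff (a b L t : ℝ) : ℝ :=
  L ^ 2 - a ^ 2 / Real.sin t ^ 2 - b ^ 2 / Real.cos t ^ 2

/-- The derivative of `trigCoeff`. -/
noncomputable def trigCoeffDeriv (a b t : ℝ) : ℝ :=
  2 * a ^ 2 * Real.cos t / Real.sin t ^ 3 - 2 * b ^ 2 * Real.sin t / Real.cos t ^ 3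

/-- The second derivative of `trigCoeff`. -/
noncomputable def trigCoeffDeriv2 (a b t : ℝ) : ℝ :=
  -(a ^ 2 * (6 / Real.sin t ^ 4 - 4 / Real.sin t ^ 2) +
    b ^ 2 * (6 / Real.cos t ^ 4 - 4 / Real.cos t ^ 2))

/-- The function whose square is the defect of `trigCoeff` from its maximum. -/
noncomputable def trigDefect (a b t : ℝ) : ℝ :=
  a * Real.cos t / Real.sin t - b * Real.sin t / Real.cos t

section Coefficient

variable {a b L t : ℝ}

theorem trigCoeff_eq (ht : t ∈ Set.Ioo 0 (Real.pi / 2)) :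
    trigCoeff a b L t = L ^ 2 - (a + b) ^ 2 - trigDefect a b t ^ 2 := by
  have hs := sin_pos_of_mem ht
  have hc := cos_pos_of_mem ht
  have h := Real.sin_sq_add_cos_sq t
  rw [trigCoeff, trigDefect]
  generalize Real.sin t = s at *
  generalize Real.cos t = c at *
  field_simp
  linear_combination (a ^ 2 * c ^ 2 + b ^ 2 * s ^ 2) * h

theorem trigCoeffDeriv_eq (ht : t ∈ Set.Ioo 0 (Real.pi / 2)) :
    trigCoeffDeriv a b t =
      2 * trigDefect a b t * (a / Real.sin t ^ 2 + b / Real.cos t ^ 2) := by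
  have hs := sin_pos_of_mem ht
  have hc := cos_pos_of_mem ht
  rw [trigCoeffDeriv, trigDefect]
  field_simp
  ring

theorem hasDerivAt_trigCoeff (ht : t ∈ Set.Ioo 0 (Real.pi / 2)) :
    HasDerivAt (trigCoeff a b L) (trigCoeffDeriv a b t) t := by
  have hs := (sin_pos_of_mem ht).ne'
  have hc := (cos_pos_of_mem ht).ne'
  have h1 := ((Real.hasDerivAt_sin t).pow 2).inv (pow_ne_zero 2 hs)
  have h2 := ((Real.hasDerivAt_cos t).pow 2).inv (pow_ne_zero 2 hc)
  have := ((h1.const_mul (a ^ 2)).const_sub (L ^ 2)).sub (h2.const_mul (b ^ 2))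
  refine (this.congr_deriv ?_)
  rw [trigCoeffDeriv]
  simp only [Pi.pow_apply]
  field_simp
  norm_num
  ring

theorem hasDerivAt_trigCoeffDeriv (ht : t ∈ Set.Ioo 0 (Real.pi / 2)) :
    HasDerivAt (trigCoeffDeriv a b) (trigCoeffDeriv2 a b t) t := by
  have hs := (sin_pos_of_mem ht).ne'
  have hc := (cos_pos_of_mem ht).ne'
  have h1 := ((Real.hasDerivAt_cos t).const_mul (2 * a ^ 2)).div
    ((Real.hasDerivAt_sin t).pow 3) (pow_ne_zero 3 hs)
  have h2 := ((Real.hasDerivAt_sin t).const_mul (2 * b ^ 2)).div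
    ((Real.hasDerivAt_cos t).pow 3) (pow_ne_zero 3 hc)
  refine ((h1.sub h2).congr_deriv ?_)
  rw [trigCoeffDeriv2]
  simp only [Pi.pow_apply]
  have h := Real.sin_sq_add_cos_sq t
  generalize Real.sin t = s at *
  generalize Real.cos t = c at *
  have hh : c ^ 2 = 1 - s ^ 2 := by linarith
  norm_num
  field_simp
  linear_combination (-6 * a ^ 2 * c ^ 4 - 6 * b ^ 2 * s ^ 4) * h

theorem hasDerivAt_trigDefect (ht : t ∈ Set.Ioo 0 (Real.pi / 2)) :
    HasDerivAt (trigDefect a b) (-(a / Real.sin t ^ 2 + b / Real.cos t ^ 2)) t := by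
  have hs := (sin_pos_of_mem ht).ne'
  have hc := (cos_pos_of_mem ht).ne'
  have h1 := ((Real.hasDerivAt_cos t).const_mul a).div (Real.hasDerivAt_sin t) hs
  have h2 := ((Real.hasDerivAt_sin t).const_mul b).div (Real.hasDerivAt_cos t) hc
  refine ((h1.sub h2).congr_deriv ?_)
  have h := Real.sin_sq_add_cos_sq t
  generalize Real.sin t = s at *
  generalize Real.cos t = c at *
  field_simp
  linear_combination (-a * c ^ 2 - b * s ^ 2) * h

theorem trigDefect_antitoneOn (ha : 0 ≤ a) (hb : 0 ≤ b) :
    AntitoneOn (trigDefect a b) (Set.Ioo 0 (Real.pi / 2)) := by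
  refine antitoneOn_of_hasDerivWithinAt_nonpos (convex_Ioo _ _)
    (f' := fun t => -(a / Real.sin t ^ 2 + b / Real.cos t ^ 2))
    (fun t ht => (hasDerivAt_trigDefect ht).continuousAt.continuousWithinAt) ?_ ?_
  · intro t ht
    rw [interior_Ioo] at ht
    exact (hasDerivAt_trigDefect ht).hasDerivWithinAt
  · intro t ht
    have : 0 ≤ a / Real.sin t ^ 2 + b / Real.cos t ^ 2 := by positivity
    linarith

theorem trigDefect_strictAntiOn (ha : 0 < a) (hb : 0 ≤ b) :
    StrictAntiOn (trigDefect a b) (Set.Ioo 0 (Real.pi / 2)) := by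
  refine strictAntiOn_of_hasDerivWithinAt_neg (convex_Ioo _ _)
    (f' := fun t => -(a / Real.sin t ^ 2 + b / Real.cos t ^ 2))
    (fun t ht => (hasDerivAt_trigDefect ht).continuousAt.continuousWithinAt) ?_ ?_
  · intro t ht
    rw [interior_Ioo] at ht
    exact (hasDerivAt_trigDefect ht).hasDerivWithinAt
  · intro t ht
    rw [interior_Ioo] at ht
    have := sin_pos_of_mem ht
    have : 0 < a / Real.sin t ^ 2 + b / Real.cos t ^ 2 := by positivity
    linarith

theorem trigCoeffDeriv2_nonpos (ht : t ∈ Set.Ioo 0 (Real.pi / 2)) :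
    trigCoeffDeriv2 a b t ≤ 0 := by
  have key : ∀ x : ℝ, 0 < x → x ≤ 1 → 0 ≤ 6 / x ^ 4 - 4 / x ^ 2 := by
    intro x hx hx1
    have : 6 / x ^ 4 - 4 / x ^ 2 = (6 - 4 * x ^ 2) / x ^ 4 := by field_simp
    rw [this]
    have : x ^ 2 ≤ 1 := by nlinarith
    apply div_nonneg <;> [linarith; positivity]
  have h1 := key _ (sin_pos_of_mem ht) (Real.sin_le_one t)
  have h2 := key _ (cos_pos_of_mem ht) (Real.cos_le_one t)
  rw [trigCoeffDeriv2]
  have := mul_nonneg (sq_nonneg a) h1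
  have := mul_nonneg (sq_nonneg b) h2
  linarith

theorem trigCoeffDeriv_antitoneOn :
    AntitoneOn (trigCoeffDeriv a b) (Set.Ioo 0 (Real.pi / 2)) := by
  refine antitoneOn_of_hasDerivWithinAt_nonpos (convex_Ioo _ _)
    (f' := trigCoeffDeriv2 a b)
    (fun t ht => (hasDerivAt_trigCoeffDeriv ht).continuousAt.continuousWithinAt) ?_ ?_
  · intro t ht
    rw [interior_Ioo] at ht
    exact (hasDerivAt_trigCoeffDeriv ht).hasDerivWithinAt
  · intro t ht
    rw [interior_Ioo] at ht
    exact trigCoeffDeriv2_nonpos ht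

/-- Where the coefficient is increasing, its curvature is controlled by the left pole alone. -/
theorem neg_trigCoeffDeriv2_le (hb : 0 ≤ b) (ht : t ∈ Set.Ioo 0 (Real.pi / 2))
    (hD : 0 ≤ trigDefect a b t) :
    -trigCoeffDeriv2 a b t ≤ 12 * a ^ 2 / Real.sin t ^ 4 := by
  have hs := sin_pos_of_mem ht
  have hc := cos_pos_of_mem ht
  have h1 : b / Real.cos t ^ 2 ≤ a / Real.sin t ^ 2 := by
    rw [trigDefect, sub_nonneg, div_le_div_iff₀ hc hs] at hD
    rw [div_le_div_iff₀ (by positivity) (by positivity)]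
    linarith
  have h2 : b ^ 2 / Real.cos t ^ 4 ≤ a ^ 2 / Real.sin t ^ 4 := by
    have := pow_le_pow_left₀ (by positivity) h1 2
    rw [div_pow, div_pow, ← pow_mul, ← pow_mul] at this
    exact this
  have h3 : 0 ≤ a ^ 2 * (4 / Real.sin t ^ 2) := by positivity
  have h4 : 0 ≤ b ^ 2 * (4 / Real.cos t ^ 2) := by positivity
  rw [trigCoeffDeriv2]
  calc _ ≤ 6 * (a ^ 2 / Real.sin t ^ 4) + 6 * (b ^ 2 / Real.cos t ^ 4) := by
        have e1 : a ^ 2 * (6 / Real.sin t ^ 4) = 6 * (a ^ 2 / Real.sin t ^ 4) := by ring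
        have e2 : b ^ 2 * (6 / Real.cos t ^ 4) = 6 * (b ^ 2 / Real.cos t ^ 4) := by ring
        linarith
    _ ≤ 12 * (a ^ 2 / Real.sin t ^ 4) := by linarith
    _ = _ := by ring

theorem trigCoeffDeriv_nonneg (ha : 0 ≤ a) (hb : 0 ≤ b) (ht : t ∈ Set.Ioo 0 (Real.pi / 2))
    (hD : 0 ≤ trigDefect a b t) : 0 ≤ trigCoeffDeriv a b t := by
  rw [trigCoeffDeriv_eq ht]
  positivity

theorem trigDefect_reflect (t : ℝ) :
    trigDefect b a (Real.pi / 2 - t) = -trigDefect a b t := by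
  simp only [trigDefect, Real.sin_pi_div_two_sub, Real.cos_pi_div_two_sub]
  ring

theorem trigCoeff_reflect (t : ℝ) :
    trigCoeff b a L (Real.pi / 2 - t) = trigCoeff a b L t := by
  simp only [trigCoeff, Real.sin_pi_div_two_sub, Real.cos_pi_div_two_sub]
  ring

theorem exists_trigDefect_eq_zero (ha : 0 < a) (hb : 0 < b) :
    ∃ t ∈ Set.Ioo 0 (Real.pi / 2), trigDefect a b t = 0 := by
  have hx : 0 < Real.sqrt (a / b) := Real.sqrt_pos.mpr (by positivity)
  have ht : Real.arctan (Real.sqrt (a / b)) ∈ Set.Ioo 0 (Real.pi / 2) :=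
    ⟨Real.arctan_pos.mpr hx, Real.arctan_lt_pi_div_two _⟩
  refine ⟨_, ht, ?_⟩
  have hs := sin_pos_of_mem ht
  have hc := cos_pos_of_mem ht
  have h := Real.tan_arctan (Real.sqrt (a / b))
  rw [Real.tan_eq_sin_div_cos] at h
  have h2 : (Real.sin (Real.arctan (Real.sqrt (a / b))) /
      Real.cos (Real.arctan (Real.sqrt (a / b)))) ^ 2 = a / b := by
    rw [h, Real.sq_sqrt (by positivity)]
  rw [div_pow, div_eq_div_iff (by positivity) (by positivity)] at h2
  rw [trigDefect, sub_eq_zero, div_eq_div_iff hs.ne' hc.ne']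
  linarith

/-- Where the coefficient is increasing it is monotone. -/
theorem trigCoeff_le_trigCoeff (ha : 0 ≤ a) (hb : 0 ≤ b) {t' : ℝ}
    (ht : t ∈ Set.Ioo 0 (Real.pi / 2)) (ht' : t' ∈ Set.Ioo 0 (Real.pi / 2)) (h : t ≤ t')
    (hD : 0 ≤ trigDefect a b t') : trigCoeff a b L t ≤ trigCoeff a b L t' := by
  have := trigDefect_antitoneOn ha hb ht ht' h
  rw [trigCoeff_eq ht, trigCoeff_eq ht']
  nlinarith

end Coefficient

/-- A solution `u` of `u'' + (L² - a²/sin² t - b²/cos² t) u = 0` on `(0, π/2)` that vanishes at both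
ends together with its energy `E = u'² + F u²`. The derivative `du` and the energy are carried
along as functions which are continuous up to the ends of the interval. -/
structure IsTrigSolution (a b L : ℝ) (u du E : ℝ → ℝ) : Prop where
  continuous_u : Continuous u
  continuous_du : Continuous du
  continuous_E : Continuous E
  u_zero : u 0 = 0
  u_pi_div_two : u (Real.pi / 2) = 0
  E_zero : E 0 = 0
  E_pi_div_two : E (Real.pi / 2) = 0
  hasDerivAt_u : ∀ t ∈ Set.Ioo 0 (Real.pi / 2), HasDerivAt u (du t) t
  hasDerivAt_du : ∀ t ∈ Set.Ioo 0 (Real.pi / 2), HasDerivAt du (-trigCoeff a b L t * u t) t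
  E_eq : ∀ t ∈ Set.Ioo 0 (Real.pi / 2), E t = du t ^ 2 + trigCoeff a b L t * u t ^ 2

namespace IsTrigSolution

variable {a b L : ℝ} {u du E : ℝ → ℝ}

theorem reflect (h : IsTrigSolution a b L u du E) :
    IsTrigSolution b a L (fun t => u (Real.pi / 2 - t)) (fun t => -du (Real.pi / 2 - t))
      (fun t => E (Real.pi / 2 - t)) := by
  have hmem : ∀ t ∈ Set.Ioo 0 (Real.pi / 2), Real.pi / 2 - t ∈ Set.Ioo 0 (Real.pi / 2) := by
    rintro t ⟨h0, h1⟩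
    constructor <;> linarith
  refine ⟨?_, ?_, ?_, ?_, ?_, ?_, ?_, ?_, ?_, ?_⟩
  · exact h.continuous_u.comp (by fun_prop)
  · exact (h.continuous_du.comp (by fun_prop)).neg
  · exact h.continuous_E.comp (by fun_prop)
  · simpa using h.u_pi_div_two
  · simpa using h.u_zero
  · simpa using h.E_pi_div_two
  · simpa using h.E_zero
  · intro t ht
    have := (h.hasDerivAt_u _ (hmem t ht)).comp_const_sub (Real.pi / 2) t
    exact this
  · intro t ht
    have := ((h.hasDerivAt_du _ (hmem t ht)).comp_const_sub (Real.pi / 2) t).neg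
    refine this.congr_deriv ?_
    rw [← trigCoeff_reflect (a := a) (b := b), sub_sub_cancel, neg_neg]
  · intro t ht
    rw [h.E_eq _ (hmem t ht), trigCoeff_reflect, neg_sq]

theorem hasDerivAt_E (h : IsTrigSolution a b L u du E) {t : ℝ}
    (ht : t ∈ Set.Ioo 0 (Real.pi / 2)) :
    HasDerivAt E (trigCoeffDeriv a b t * u t ^ 2) t := by
  have h1 := (((h.hasDerivAt_du t ht).pow 2).add
    ((hasDerivAt_trigCoeff (a := a) (b := b) (L := L) ht).mul ((h.hasDerivAt_u t ht).pow 2)))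
  have h2 : E =ᶠ[nhds t] fun t => du t ^ 2 + trigCoeff a b L t * u t ^ 2 := by
    filter_upwards [isOpen_Ioo.mem_nhds ht] with x hx using h.E_eq x hx
  refine (HasDerivAt.congr_of_eventuallyEq (h1.congr_deriv ?_) h2)
  simp only [Pi.pow_apply]
  norm_num
  ring

theorem monotoneOn_E (h : IsTrigSolution a b L u du E) (ha : 0 ≤ a) (hb : 0 ≤ b) {t : ℝ}
    (ht : t ∈ Set.Ioo 0 (Real.pi / 2)) (hD : 0 ≤ trigDefect a b t) :
    MonotoneOn E (Set.Icc 0 t) := by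
  have hmem : ∀ x ∈ interior (Set.Icc 0 t), x ∈ Set.Ioo 0 (Real.pi / 2) ∧
      0 ≤ trigDefect a b x := by
    intro x hx
    rw [interior_Icc] at hx
    have hx' : x ∈ Set.Ioo 0 (Real.pi / 2) := ⟨hx.1, hx.2.trans ht.2⟩
    exact ⟨hx', hD.trans (trigDefect_antitoneOn ha hb hx' ht hx.2.le)⟩
  refine monotoneOn_of_hasDerivWithinAt_nonneg (convex_Icc _ _)
    (f' := fun t => trigCoeffDeriv a b t * u t ^ 2) h.continuous_E.continuousOn ?_ ?_
  · intro x hx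
    exact (h.hasDerivAt_E (hmem x hx).1).hasDerivWithinAt
  · intro x hx
    exact mul_nonneg (trigCoeffDeriv_nonneg ha hb (hmem x hx).1 (hmem x hx).2) (sq_nonneg _)

theorem E_nonneg_left (h : IsTrigSolution a b L u du E) (ha : 0 ≤ a) (hb : 0 ≤ b) {t : ℝ}
    (ht : t ∈ Set.Ioo 0 (Real.pi / 2)) (hD : 0 ≤ trigDefect a b t) : 0 ≤ E t := by
  have := h.monotoneOn_E ha hb ht hD ⟨le_rfl, ht.1.le⟩ ⟨ht.1.le, le_rfl⟩ ht.1.le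
  rwa [h.E_zero] at this

theorem E_nonneg (h : IsTrigSolution a b L u du E) (ha : 0 ≤ a) (hb : 0 ≤ b) {t : ℝ}
    (ht : t ∈ Set.Icc 0 (Real.pi / 2)) : 0 ≤ E t := by
  rcases ht.1.eq_or_lt with h0 | h0
  · rw [← h0, h.E_zero]
  rcases ht.2.eq_or_lt with h1 | h1
  · rw [h1, h.E_pi_div_two]
  rcases le_total 0 (trigDefect a b t) with hD | hD
  · exact h.E_nonneg_left ha hb ⟨h0, h1⟩ hD
  · have := h.reflect.E_nonneg_left hb ha (t := Real.pi / 2 - t) ⟨by linarith, by linarith⟩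
      (by rw [trigDefect_reflect]; linarith)
    simpa using this

/-- Sonin's argument: `E / F` is decreasing where `F` is positive and increasing. -/
theorem sonin_left (h : IsTrigSolution a b L u du E) (ha : 0 ≤ a) (hb : 0 ≤ b)
    (hab : a + b < L) {t m : ℝ}
    (hm : m ∈ Set.Ioo 0 (Real.pi / 2)) (hDm : trigDefect a b m = 0)
    (ht : t ∈ Set.Ioo 0 (Real.pi / 2)) (htm : t ≤ m) :
    E m * trigCoeff a b L t ≤ (L ^ 2 - (a + b) ^ 2) * E t := by
  have hFm : trigCoeff a b L m = L ^ 2 - (a + b) ^ 2 := by rw [trigCoeff_eq hm, hDm]; ring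
  have hFm0 : 0 < L ^ 2 - (a + b) ^ 2 := by nlinarith
  have hEm := h.E_nonneg ha hb (Set.Ioo_subset_Icc_self hm)
  have hEt := h.E_nonneg ha hb (Set.Ioo_subset_Icc_self ht)
  rcases le_or_gt (trigCoeff a b L t) 0 with hF | hF
  · exact (mul_nonpos_of_nonneg_of_nonpos hEm hF).trans (mul_nonneg hFm0.le hEt)
  have hmem : ∀ x ∈ Set.Icc t m, x ∈ Set.Ioo 0 (Real.pi / 2) :=
    fun x hx => ⟨ht.1.trans_le hx.1, hx.2.trans_lt hm.2⟩
  have hD : ∀ x ∈ Set.Icc t m, 0 ≤ trigDefect a b x := fun x hx => by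
    rw [← hDm]
    exact trigDefect_antitoneOn ha hb (hmem x hx) hm hx.2
  have hpos : ∀ x ∈ Set.Icc t m, 0 < trigCoeff a b L x := fun x hx =>
    hF.trans_le (trigCoeff_le_trigCoeff ha hb ht (hmem x hx) hx.1 (hD x hx))
  have hder : ∀ x ∈ Set.Icc t m, HasDerivAt (fun x => E x / trigCoeff a b L x)
      (-(trigCoeffDeriv a b x * du x ^ 2 / trigCoeff a b L x ^ 2)) x := by
    intro x hx
    refine ((h.hasDerivAt_E (hmem x hx)).div (hasDerivAt_trigCoeff (hmem x hx))
      (hpos x hx).ne').congr_deriv ?_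
    rw [h.E_eq x (hmem x hx)]
    ring
  have hanti : AntitoneOn (fun x => E x / trigCoeff a b L x) (Set.Icc t m) := by
    refine antitoneOn_of_hasDerivWithinAt_nonpos (convex_Icc _ _)
      (fun x hx => (hder x hx).continuousAt.continuousWithinAt)
      (fun x hx => (hder x (interior_subset hx)).hasDerivWithinAt) ?_
    intro x hx
    have hx := interior_subset hx
    have := trigCoeffDeriv_nonneg ha hb (hmem x hx) (hD x hx)
    rw [neg_nonpos]
    positivity
  have := hanti ⟨le_rfl, htm⟩ ⟨htm, le_rfl⟩ htm
  simp only at this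
  rw [div_le_div_iff₀ (hpos m ⟨htm, le_rfl⟩) hF, hFm] at this
  linarith

theorem sonin (h : IsTrigSolution a b L u du E) (ha : 0 ≤ a) (hb : 0 ≤ b)
    (hab : a + b < L) {t m : ℝ}
    (hm : m ∈ Set.Ioo 0 (Real.pi / 2)) (hDm : trigDefect a b m = 0)
    (ht : t ∈ Set.Ioo 0 (Real.pi / 2)) :
    E m * trigCoeff a b L t ≤ (L ^ 2 - (a + b) ^ 2) * E t := by
  rcases le_total t m with htm | htm
  · exact h.sonin_left ha hb hab hm hDm ht htm
  · have := h.reflect.sonin_left hb ha (by linarith) (t := Real.pi / 2 - t) (m := Real.pi / 2 - m)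
      ⟨by linarith [hm.2], by linarith [hm.1]⟩ (by rw [trigDefect_reflect, hDm, neg_zero])
      ⟨by linarith [ht.2], by linarith [ht.1]⟩ (by linarith)
    simpa [trigCoeff_reflect, add_comm a b] using this

/-- The virial bound: the energy integrates to at most twice the maximum of the coefficient. -/
theorem integral_E_le (h : IsTrigSolution a b L u du E) :
    ∫ t in (0 : ℝ)..(Real.pi / 2), E t ≤
      2 * (L ^ 2 - (a + b) ^ 2) * ∫ t in (0 : ℝ)..(Real.pi / 2), u t ^ 2 := by
  have hpi := Real.pi_pos
  have hu := h.continuous_u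
  have hdu := h.continuous_du
  have hE := h.continuous_E
  have hFTC := intervalIntegral.integral_eq_sub_of_hasDerivAt_of_le (a := 0) (b := Real.pi / 2)
    (f := fun t => u t * du t) (f' := fun t => 2 * du t ^ 2 - E t) (by positivity)
    (by fun_prop)
    (fun t ht => by
      refine ((h.hasDerivAt_u t ht).mul (h.hasDerivAt_du t ht)).congr_deriv ?_
      rw [h.E_eq t ht]
      ring)
    ((by fun_prop : Continuous _).intervalIntegrable _ _)
  rw [h.u_zero, h.u_pi_div_two, zero_mul, zero_mul, sub_zero] at hFTC
  have hle : ∫ t in (0 : ℝ)..(Real.pi / 2), (E t - 2 * (L ^ 2 - (a + b) ^ 2) * u t ^ 2) ≤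
      ∫ t in (0 : ℝ)..(Real.pi / 2), (2 * du t ^ 2 - E t) := by
    refine intervalIntegral.integral_mono_on_of_le_Ioo (by positivity)
      ((by fun_prop : Continuous _).intervalIntegrable _ _)
      ((by fun_prop : Continuous _).intervalIntegrable _ _) ?_
    intro t ht
    rw [h.E_eq t ht, trigCoeff_eq ht]
    nlinarith [mul_nonneg (sq_nonneg (trigDefect a b t)) (sq_nonneg (u t))]
  rw [hFTC, intervalIntegral.integral_sub (hE.intervalIntegrable _ _)
    ((by fun_prop : Continuous _).intervalIntegrable _ _),
    intervalIntegral.integral_const_mul] at hle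
  linarith

/-- The maximal energy is bounded by the mass of `u`, given an interval on which the coefficient is
comparable to its maximum. -/
theorem E_le_integral (h : IsTrigSolution a b L u du E) (ha : 0 ≤ a) (hb : 0 ≤ b)
    (hab : a + b < L) {m : ℝ} (hm : m ∈ Set.Ioo 0 (Real.pi / 2)) (hDm : trigDefect a b m = 0)
    {t₁ t₂ η : ℝ} (h₁ : 0 < t₁) (h₁₂ : t₁ ≤ t₂) (h₂ : t₂ < Real.pi / 2)
    (hη : ∀ t ∈ Set.Icc t₁ t₂, η * (L ^ 2 - (a + b) ^ 2) ≤ trigCoeff a b L t) :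
    η * (t₂ - t₁) * E m ≤
      2 * (L ^ 2 - (a + b) ^ 2) * ∫ t in (0 : ℝ)..(Real.pi / 2), u t ^ 2 := by
  have hFm0 : 0 < L ^ 2 - (a + b) ^ 2 := by nlinarith
  have hEm := h.E_nonneg ha hb (Set.Ioo_subset_Icc_self hm)
  have hE := h.continuous_E
  have h1 : ∫ t in t₁..t₂, η * E m ≤ ∫ t in t₁..t₂, E t := by
    refine intervalIntegral.integral_mono_on h₁₂
      ((by fun_prop : Continuous _).intervalIntegrable _ _) (hE.intervalIntegrable _ _) ?_
    intro t ht
    have h2 := h.sonin ha hb hab hm hDm (t := t) ⟨h₁.trans_le ht.1, ht.2.trans_lt h₂⟩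
    have h3 := mul_le_mul_of_nonneg_left (hη t ht) hEm
    have h4 : (L ^ 2 - (a + b) ^ 2) * (η * E m) ≤ (L ^ 2 - (a + b) ^ 2) * E t := by linarith
    exact le_of_mul_le_mul_left h4 hFm0
  rw [intervalIntegral.integral_const, smul_eq_mul] at h1
  have h2 : ∫ t in t₁..t₂, E t ≤ ∫ t in (0 : ℝ)..(Real.pi / 2), E t := by
    refine intervalIntegral.integral_mono_interval h₁.le h₁₂ h₂.le ?_
      (hE.intervalIntegrable _ _)
    filter_upwards [MeasureTheory.ae_restrict_mem measurableSet_Ioc] with t ht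
    exact h.E_nonneg ha hb (Set.Ioc_subset_Icc_self ht)
  have h3 := h.integral_E_le
  linarith

end IsTrigSolution

/-! ### The size of the largest maximum -/

namespace IsTrigSolution

variable {a b L : ℝ} {u du E : ℝ → ℝ}

/-- Just left of the largest maximum `M` of `u²`, located where the coefficient `F` increases, `u²`
stays above a parabola. -/
theorem le_sq_of_isMax (h : IsTrigSolution a b L u du E) (ha : 0 ≤ a) (hb : 0 ≤ b) {m M : ℝ}
    (hm : m ∈ Set.Ioo 0 (Real.pi / 2)) (hD : 0 ≤ trigDefect a b m) (hM0 : 0 < M)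
    (hM : u m ^ 2 = M) (hdu : du m = 0) (hmax : ∀ t ∈ Set.Icc 0 (Real.pi / 2), u t ^ 2 ≤ M)
    {t : ℝ} (ht : t ∈ Set.Icc 0 m) :
    M - 2 * trigCoeff a b L m * M * (m - t) ^ 2 ≤ u t ^ 2 := by
  have huc := h.continuous_u
  have hduc := h.continuous_du
  set f := trigCoeff a b L m with hf
  have hf0 : 0 ≤ f := by
    have h1 := h.E_nonneg ha hb (Set.Ioo_subset_Icc_self hm)
    rw [h.E_eq m hm, hdu, hM, ← hf] at h1
    nlinarith
  have hmem : ∀ x ∈ interior (Set.Icc 0 m), x ∈ Set.Ioo 0 (Real.pi / 2) := by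
    intro x hx
    rw [interior_Icc] at hx
    exact ⟨hx.1, hx.2.trans hm.2⟩
  -- `(u²)'' = 2 E - 4 F u² ≥ -4 F(m) M`, integrated twice from `m`
  have hmono : MonotoneOn (fun t => 2 * u t * du t + 4 * f * M * (t - m)) (Set.Icc 0 m) := by
    refine monotoneOn_of_hasDerivWithinAt_nonneg (convex_Icc _ _)
      (f' := fun t => 2 * E t - 4 * trigCoeff a b L t * u t ^ 2 + 4 * f * M) (by fun_prop) ?_ ?_
    · intro x hx
      have hx' := hmem x hx
      have h1 := ((h.hasDerivAt_u x hx').const_mul 2).mul (h.hasDerivAt_du x hx')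
      have h2 := ((hasDerivAt_id x).sub_const m).const_mul (4 * f * M)
      refine ((h1.add h2).congr_deriv ?_).hasDerivWithinAt
      rw [h.E_eq x hx']
      ring
    · intro x hx
      have hx' := hmem x hx
      have h1 := h.E_nonneg ha hb (Set.Ioo_subset_Icc_self hx')
      have h2 := trigCoeff_le_trigCoeff (L := L) ha hb hx' hm (interior_subset hx).2 hD
      have h3 := hmax x (Set.Ioo_subset_Icc_self hx')
      have h4 : trigCoeff a b L x * u x ^ 2 ≤ f * M :=
        (mul_le_mul_of_nonneg_right h2 (sq_nonneg _)).trans (mul_le_mul_of_nonneg_left h3 hf0)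
      linarith
  have hanti : AntitoneOn (fun t => u t ^ 2 + 2 * f * M * (m - t) ^ 2) (Set.Icc 0 m) := by
    refine antitoneOn_of_hasDerivWithinAt_nonpos (convex_Icc _ _)
      (f' := fun t => 2 * u t * du t + 4 * f * M * (t - m)) (by fun_prop) ?_ ?_
    · intro x hx
      have h1 := (h.hasDerivAt_u x (hmem x hx)).pow 2
      have h2 := (((hasDerivAt_id x).const_sub m).pow 2).const_mul (2 * f * M)
      refine ((h1.add h2).congr_deriv ?_).hasDerivWithinAt
      simp only [id_eq, Nat.cast_ofNat, Nat.add_one_sub_one, pow_one]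
      ring
    · intro x hx
      have h1 := hmono (interior_subset hx) ⟨hm.1.le, le_rfl⟩ (interior_subset hx).2
      simp only [hdu] at h1
      linarith
  have h1 := hanti ht ⟨hm.1.le, le_rfl⟩ ht.2
  simp only [hM] at h1
  linarith

/-- At the largest maximum of `u²` the coefficient `F` cannot be small compared with its slope:
`F³ ≥ (25/144) F'²`. -/
theorem trigCoeffDeriv_sq_le (h : IsTrigSolution a b L u du E) (ha : 0 ≤ a) (hb : 0 ≤ b) {m M : ℝ}
    (hm : m ∈ Set.Ioo 0 (Real.pi / 2)) (hD : 0 ≤ trigDefect a b m) (hM0 : 0 < M)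
    (hM : u m ^ 2 = M) (hdu : du m = 0) (hmax : ∀ t ∈ Set.Icc 0 (Real.pi / 2), u t ^ 2 ≤ M) :
    0 < trigCoeff a b L m ∧
      25 * trigCoeffDeriv a b m ^ 2 ≤ 144 * trigCoeff a b L m ^ 3 := by
  have hpar := fun {t} => h.le_sq_of_isMax ha hb hm hD hM0 hM hdu hmax (t := t)
  have hE := h.continuous_E
  set f := trigCoeff a b L m with hf
  have hm0 := hm.1
  have h0 := hpar (t := 0) ⟨le_rfl, hm0.le⟩
  rw [h.u_zero, sub_zero, show M - 2 * f * M * m ^ 2 = M * (1 - 2 * f * m ^ 2) by ring] at h0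
  have h0' : 1 ≤ 2 * f * m ^ 2 := by
    by_contra hlt
    have := mul_pos hM0 (show 0 < 1 - 2 * f * m ^ 2 by linarith)
    norm_num at h0
    linarith
  have hf0 : 0 < f := by
    by_contra hlt
    nlinarith [sq_nonneg m]
  refine ⟨hf0, ?_⟩
  set y := Real.sqrt f with hy
  have hy0 : 0 < y := Real.sqrt_pos.mpr hf0
  have hyy : y ^ 2 = f := Real.sq_sqrt hf0.le
  -- the parabola is integrated over a window in which it is at least `M / 2`
  set w := 1 / (2 * y) with hw
  have hw0 : 0 < w := by positivity
  have hyw : y * w = 1 / 2 := by rw [hw]; field_simp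
  have hwm : w < m := by
    by_contra hlt
    have : y * m ≤ 1 / 2 := by
      rw [← hyw]
      exact mul_le_mul_of_nonneg_left (not_lt.mp hlt) hy0.le
    have h2 : (y * m) ^ 2 ≤ (1 / 2) ^ 2 := pow_le_pow_left₀ (by positivity) this 2
    rw [mul_pow, hyy] at h2
    linarith
  set d := trigCoeffDeriv a b m with hd
  have hd0 : 0 ≤ d := trigCoeffDeriv_nonneg ha hb hm hD
  have hmono : MonotoneOn (fun t => E t - d * M * (-(m - t) + 2 / 3 * f * (m - t) ^ 3))
      (Set.Icc (m - w) m) := by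
    have hmem : ∀ x ∈ interior (Set.Icc (m - w) m), x ∈ Set.Ioo 0 (Real.pi / 2) := by
      intro x hx
      rw [interior_Icc] at hx
      exact ⟨by linarith [hx.1], hx.2.trans hm.2⟩
    refine monotoneOn_of_hasDerivWithinAt_nonneg (convex_Icc _ _)
      (f' := fun t => trigCoeffDeriv a b t * u t ^ 2 - d * M * (1 - 2 * f * (m - t) ^ 2))
      (by fun_prop) ?_ ?_
    · intro x hx
      have h1 := h.hasDerivAt_E (hmem x hx)
      have h2 := (hasDerivAt_id x).const_sub m
      have h3 := (h2.neg.add ((h2.pow 3).const_mul (2 / 3 * f))).const_mul (d * M)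
      refine ((h1.sub h3).congr_deriv ?_).hasDerivWithinAt
      simp only [id_eq, Nat.reduceSub, Nat.cast_ofNat]
      ring
    · intro x hx
      have hx' := interior_subset hx
      have h1 := hpar (t := x) ⟨(hmem x hx).1.le, hx'.2⟩
      have h2 : d ≤ trigCoeffDeriv a b x := trigCoeffDeriv_antitoneOn (hmem x hx) hm hx'.2
      have h3 := mul_le_mul_of_nonneg_left h1 hd0
      have h4 := mul_le_mul_of_nonneg_right h2 (sq_nonneg (u x))
      linarith
  have h1 := hmono ⟨le_rfl, by linarith⟩ ⟨by linarith, le_rfl⟩ (by linarith)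
  have h2 := h.E_nonneg ha hb (t := m - w) ⟨by linarith, by linarith [hm.2]⟩
  simp only [h.E_eq m hm, hdu, hM, sub_self, sub_sub_cancel] at h1
  rw [← hf] at h1
  have h3 : d * (w - 2 / 3 * f * w ^ 3) ≤ f := by
    have : d * (w - 2 / 3 * f * w ^ 3) * M ≤ f * M := by linarith
    exact le_of_mul_le_mul_right this hM0
  have h4 : 5 * d ≤ 12 * y ^ 3 := by
    have e : y * (d * (w - 2 / 3 * f * w ^ 3)) = 5 / 12 * d := by
      rw [← hyy]
      linear_combination (d * (1 - 2 / 3 * (y ^ 2 * w ^ 2 + y * w / 2 + 1 / 4))) * hyw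
    have := mul_le_mul_of_nonneg_left h3 hy0.le
    rw [e, ← hyy] at this
    linarith
  have h5 := pow_le_pow_left₀ (by positivity) h4 2
  calc 25 * d ^ 2 = (5 * d) ^ 2 := by ring
    _ ≤ (12 * y ^ 3) ^ 2 := h5
    _ = 144 * (y ^ 2) ^ 3 := by ring
    _ = _ := by rw [hyy]

end IsTrigSolution

/-- The parabola with the value and slope of the coefficient at a point where it increases, and the
curvature allowed there, climbs to at least a sixth of the maximum of the coefficient. -/
theorem trigCoeff_max_le {a b L m : ℝ} (ha : 0 < a) (hb : 0 ≤ b)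
    (hm : m ∈ Set.Ioo 0 (Real.pi / 2)) (hD : 0 ≤ trigDefect a b m)
    (hF : 0 ≤ trigCoeff a b L m) :
    L ^ 2 - (a + b) ^ 2 ≤ 6 * (trigCoeff a b L m +
      trigCoeffDeriv a b m ^ 2 / (2 * (12 * a ^ 2 / Real.sin m ^ 4))) := by
  have hs := sin_pos_of_mem hm
  have e1 : L ^ 2 - (a + b) ^ 2 = trigCoeff a b L m + trigDefect a b m ^ 2 := by
    rw [trigCoeff_eq hm]
    ring
  have e3 : trigDefect a b m ^ 2 / 6 ≤
      trigCoeffDeriv a b m ^ 2 / (2 * (12 * a ^ 2 / Real.sin m ^ 4)) := by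
    have e4 : 2 * trigDefect a b m * (a / Real.sin m ^ 2) ≤ trigCoeffDeriv a b m := by
      rw [trigCoeffDeriv_eq hm]
      have : 0 ≤ b / Real.cos m ^ 2 := by positivity
      gcongr
      linarith
    have e5 := pow_le_pow_left₀ (by positivity) e4 2
    rw [le_div_iff₀ (by positivity)]
    calc _ = (2 * trigDefect a b m * (a / Real.sin m ^ 2)) ^ 2 := by
          field_simp
          ring
      _ ≤ _ := e5
  linarith

namespace IsTrigSolution

variable {a b L : ℝ} {u du E : ℝ → ℝ}

/-- The derivative of the adiabatic invariant `E/√H + (H'/(2 H^{3/2})) u u'` (for a comparison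
parabola `H = r²` with `H' = h` and `H'' = -k`), corrected by a multiple of `u² - M` which makes
the derivative a sum of terms of constant sign. -/
theorem hasDerivAt_invariant (hsol : IsTrigSolution a b L u du E) {t : ℝ}
    (ht : t ∈ Set.Ioo 0 (Real.pi / 2)) {H h : ℝ → ℝ} {k : ℝ} (M : ℝ)
    (hH : HasDerivAt H (h t) t) (hh : HasDerivAt h (-k) t) (hpos : 0 < H t) :
    HasDerivAt (fun t => E t / Real.sqrt (H t) + h t * (u t * du t) / (2 * Real.sqrt (H t) ^ 3) +
        (k / (4 * Real.sqrt (H t) ^ 3) + 3 * h t ^ 2 / (8 * Real.sqrt (H t) ^ 5)) *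
          (u t ^ 2 - M))
      ((trigCoeffDeriv a b t * H t - h t * trigCoeff a b L t) * u t ^ 2 / Real.sqrt (H t) ^ 3 +
        (9 * k * h t / (8 * Real.sqrt (H t) ^ 5) + 15 * h t ^ 3 / (16 * Real.sqrt (H t) ^ 7)) *
          (M - u t ^ 2)) t := by
  have hr := hH.sqrt hpos.ne'
  have hr0 : Real.sqrt (H t) ≠ 0 := (Real.sqrt_pos.mpr hpos).ne'
  have hrr : H t = Real.sqrt (H t) ^ 2 := (Real.sq_sqrt hpos.le).symm
  have hu := hsol.hasDerivAt_u t ht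
  have hdu := hsol.hasDerivAt_du t ht
  have h1 := (hsol.hasDerivAt_E ht).div hr hr0
  have h2 := (hh.mul (hu.mul hdu)).div ((hr.pow 3).const_mul 2)
    (mul_ne_zero two_ne_zero (pow_ne_zero 3 hr0))
  have h3 := ((hasDerivAt_const t k).div ((hr.pow 3).const_mul 4)
    (mul_ne_zero four_ne_zero (pow_ne_zero 3 hr0))).add
    (((hh.pow 2).const_mul 3).div ((hr.pow 5).const_mul 8)
      (mul_ne_zero (by norm_num) (pow_ne_zero 5 hr0)))
  refine ((h1.add h2).add (h3.mul ((hu.pow 2).sub_const M))).congr_deriv ?_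
  have hE := hsol.E_eq t ht
  simp only [Pi.pow_apply, Pi.mul_apply, Pi.add_apply, Pi.div_apply, Nat.reduceSub,
    Nat.cast_ofNat]
  rw [hE]
  generalize trigCoeffDeriv a b t = d at *
  generalize trigCoeff a b L t = f at *
  generalize Real.sqrt (H t) = r at *
  rw [hrr]
  generalize u t = x at *
  generalize du t = y at *
  generalize h t = g at *
  field_simp
  ring

set_option maxHeartbeats 1000000 in
/-- The adiabatic invariant bounds the largest maximum `M` of `u²` by the maximal energy: there,
`M √F ≤ E_max / √H` where `H` is at least a sixth of the maximum of the coefficient. -/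
theorem sq_mul_le_of_isMax (hsol : IsTrigSolution a b L u du E) (ha : 0 < a) (hb : 0 < b)
    {m M c : ℝ} (hm : m ∈ Set.Ioo 0 (Real.pi / 2)) (hD : 0 ≤ trigDefect a b m)
    (hM : u m ^ 2 = M) (hdu : du m = 0) (hmax : ∀ t ∈ Set.Icc 0 (Real.pi / 2), u t ^ 2 ≤ M)
    (hF : 0 < trigCoeff a b L m)
    (hc : c ∈ Set.Ioo 0 (Real.pi / 2)) (hDc : trigDefect a b c = 0) (hmc : m ≤ c) :
    M ^ 2 * trigCoeff a b L m * (L ^ 2 - (a + b) ^ 2) ≤ 6 * E c ^ 2 := by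
  have hs := sin_pos_of_mem hm
  set f := trigCoeff a b L m with hf
  set d := trigCoeffDeriv a b m with hd
  have hd0 : 0 ≤ d := trigCoeffDeriv_nonneg ha.le hb.le hm hD
  set k := 12 * a ^ 2 / Real.sin m ^ 4 with hk
  have hk0 : 0 < k := by positivity
  have hmem : ∀ x ∈ Set.Icc m c, x ∈ Set.Ioo 0 (Real.pi / 2) :=
    fun x hx => ⟨hm.1.trans_le hx.1, hx.2.trans_lt hc.2⟩
  have hDx : ∀ x ∈ Set.Icc m c, 0 ≤ trigDefect a b x := fun x hx => by
    rw [← hDc]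
    exact trigDefect_antitoneOn ha.le hb.le (hmem x hx) hc hx.2
  have hcurv : ∀ x ∈ Set.Icc m c, 0 ≤ trigCoeffDeriv2 a b x + k := by
    intro x hx
    have h1 := neg_trigCoeffDeriv2_le hb.le (hmem x hx) (hDx x hx)
    have h2 : Real.sin m ≤ Real.sin x := Real.sin_le_sin_of_le_of_le_pi_div_two
      (by linarith [hm.1, Real.pi_pos]) (hmem x hx).2.le hx.1
    have h3 : 12 * a ^ 2 / Real.sin x ^ 4 ≤ k := by
      rw [hk]
      gcongr
    linarith
  -- `F' - H'` is nondecreasing, where `H` is the comparison parabola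
  have hmono1 : MonotoneOn (fun x => trigCoeffDeriv a b x - (d - k * (x - m))) (Set.Icc m c) := by
    refine monotoneOn_of_hasDerivWithinAt_nonneg (convex_Icc _ _)
      (f' := fun x => trigCoeffDeriv2 a b x + k) ?_ ?_ (fun x hx => hcurv x (interior_subset hx))
    · intro x hx
      have := (hasDerivAt_trigCoeffDeriv (a := a) (b := b) (hmem x hx)).continuousAt
      exact (this.sub (by fun_prop)).continuousWithinAt
    · intro x hx
      have h1 := hasDerivAt_trigCoeffDeriv (a := a) (b := b) (hmem x (interior_subset hx))
      have h2 := (((hasDerivAt_id x).sub_const m).const_mul k).const_sub d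
      refine ((h1.sub h2).congr_deriv ?_).hasDerivWithinAt
      ring
  set T := m + d / k with hT
  have hkT : k * (T - m) = d := by rw [hT]; field_simp; ring
  have hTm : m ≤ T := by
    have : 0 ≤ d / k := by positivity
    linarith
  have hTc : T ≤ c := by
    have h1 := hmono1 ⟨le_rfl, hmc⟩ ⟨hmc, le_rfl⟩ hmc
    have h2 : trigCoeffDeriv a b c = 0 := by rw [trigCoeffDeriv_eq hc, hDc]; ring
    simp only [h2, sub_self, mul_zero, sub_zero, ← hd] at h1
    have : k * (T - m) ≤ k * (c - m) := by rw [hkT]; linarith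
    linarith [le_of_mul_le_mul_left this hk0]
  set H : ℝ → ℝ := fun x => f + d * (x - m) - k / 2 * (x - m) ^ 2 with hH
  set h : ℝ → ℝ := fun x => d - k * (x - m) with hh
  have hHd : ∀ x, HasDerivAt H (h x) x := by
    intro x
    have h1 := (hasDerivAt_id x).sub_const m
    refine (((h1.const_mul d).const_add f).sub ((h1.pow 2).const_mul (k / 2))).congr_deriv ?_
    simp only [hh, id_eq, Nat.reduceSub, Nat.cast_ofNat]
    ring
  have hhd : ∀ x, HasDerivAt h (-k) x := by
    intro x
    have h1 := (hasDerivAt_id x).sub_const m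
    refine ((h1.const_mul k).const_sub d).congr_deriv ?_
    ring
  have hsub : ∀ x ∈ Set.Icc m T, x ∈ Set.Icc m c := fun x hx => ⟨hx.1, hx.2.trans hTc⟩
  have hh0 : ∀ x ∈ Set.Icc m T, 0 ≤ h x := by
    intro x hx
    have : k * (x - m) ≤ k * (T - m) := mul_le_mul_of_nonneg_left (by linarith [hx.2]) hk0.le
    simp only [hh]
    linarith
  have hHpos : ∀ x ∈ Set.Icc m T, 0 < H x := by
    intro x hx
    have h1 := hh0 x hx
    have h2 : 0 ≤ x - m := by linarith [hx.1]
    have h3 := mul_nonneg h1 h2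
    have h4 := mul_nonneg hk0.le (sq_nonneg (x - m))
    simp only [hh] at h3
    simp only [hH]
    nlinarith
  -- convexity of `F - H`, which vanishes to second order at `m`
  have hconv : ∀ x ∈ Set.Icc m c,
      trigCoeff a b L x - H x ≤ (x - m) * (trigCoeffDeriv a b x - h x) := by
    intro x hx
    have hmono2 : MonotoneOn (fun y => (y - m) * (trigCoeffDeriv a b y - h y) -
        (trigCoeff a b L y - H y)) (Set.Icc m c) := by
      refine monotoneOn_of_hasDerivWithinAt_nonneg (convex_Icc _ _)
        (f' := fun y => (y - m) * (trigCoeffDeriv2 a b y + k)) ?_ ?_ ?_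
      · intro y hy
        have h1 := (hasDerivAt_trigCoeffDeriv (a := a) (b := b) (hmem y hy)).continuousAt
        have h2 := (hasDerivAt_trigCoeff (a := a) (b := b) (L := L) (hmem y hy)).continuousAt
        have h3 := (hHd y).continuousAt
        have h4 := (hhd y).continuousAt
        exact ContinuousAt.continuousWithinAt (by fun_prop)
      · intro y hy
        have hy' := hmem y (interior_subset hy)
        have h1 := hasDerivAt_trigCoeffDeriv (a := a) (b := b) hy'
        have h2 := hasDerivAt_trigCoeff (a := a) (b := b) (L := L) hy'
        have h3 := (((hasDerivAt_id y).sub_const m).mul (h1.sub (hhd y))).sub (h2.sub (hHd y))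
        refine (h3.congr_deriv ?_).hasDerivWithinAt
        simp only [id_eq, Pi.sub_apply]
        ring
      · intro y hy
        exact mul_nonneg (by linarith [(interior_subset hy).1]) (hcurv y (interior_subset hy))
    have h1 := hmono2 ⟨le_rfl, hmc⟩ hx hx.1
    have h2 : H m = f := by simp [hH]
    simp only [sub_self, h2, ← hf] at h1
    linarith
  -- The correction vanishes at `m`, and at the vertex `T` of the parabola it has a favourable sign.
  set Θ : ℝ → ℝ := fun t => E t / Real.sqrt (H t) +
    h t * (u t * du t) / (2 * Real.sqrt (H t) ^ 3) +
    (k / (4 * Real.sqrt (H t) ^ 3) + 3 * h t ^ 2 / (8 * Real.sqrt (H t) ^ 5)) * (u t ^ 2 - M)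
    with hΘ
  have hder := fun x (hx : x ∈ Set.Icc m T) => hsol.hasDerivAt_invariant (hmem x (hsub x hx)) M
    (hHd x) (hhd x) (hHpos x hx)
  have hmono : MonotoneOn Θ (Set.Icc m T) := by
    refine monotoneOn_of_hasDerivWithinAt_nonneg (convex_Icc _ _)
      (fun x hx => (hder x hx).continuousAt.continuousWithinAt)
      (fun x hx => (hder x (interior_subset hx)).hasDerivWithinAt) ?_
    intro x hx
    have hx := interior_subset hx
    have hx0 := hh0 x hx
    have hr := Real.sqrt_pos.mpr (hHpos x hx)
    have h1 := hconv x (hsub x hx)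
    have h2 : 0 ≤ trigCoeffDeriv a b x - h x := by
      have := hmono1 ⟨le_rfl, hmc⟩ (hsub x hx) hx.1
      simp only [sub_self, mul_zero, sub_zero, ← hd] at this
      exact this
    have h3 : h x * (x - m) ≤ H x := by
      have h4 := mul_nonneg hk0.le (sq_nonneg (x - m))
      simp only [hh, hH]
      nlinarith
    have h5 : 0 ≤ trigCoeffDeriv a b x * H x - h x * trigCoeff a b L x := by
      have e1 := mul_le_mul_of_nonneg_left h1 hx0
      have e2 := mul_le_mul_of_nonneg_right h3 h2
      nlinarith
    have h6 : 0 ≤ M - u x ^ 2 := by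
      linarith [hmax x (Set.Ioo_subset_Icc_self (hmem x (hsub x hx)))]
    positivity
  have hfin := hmono ⟨le_rfl, hTm⟩ ⟨hTm, le_rfl⟩ hTm
  have hHm : H m = f := by simp [hH]
  have hhT : h T = 0 := by simp only [hh, hkT, sub_self]
  have hTT : T ∈ Set.Icc m T := ⟨hTm, le_rfl⟩
  set r := Real.sqrt f with hr
  set R := Real.sqrt (H T) with hR
  have hr0 : 0 < r := Real.sqrt_pos.mpr hF
  have hR0 : 0 < R := Real.sqrt_pos.mpr (hHpos T hTT)
  have hrr : r ^ 2 = f := Real.sq_sqrt hF.le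
  have hRR : R ^ 2 = H T := Real.sq_sqrt (hHpos T hTT).le
  have hM0 : 0 ≤ M := hM ▸ sq_nonneg _
  have hET : E T ≤ E c :=
    hsol.monotoneOn_E ha.le hb.le hc hDc.ge ⟨hm.1.le.trans hTm, hTc⟩ ⟨hc.1.le, le_rfl⟩ hTc
  have hEc : 0 ≤ E c := hsol.E_nonneg ha.le hb.le (Set.Ioo_subset_Icc_self hc)
  have h1 : M * r * R ≤ E c := by
    simp only [hΘ, hHm, hhT, hdu, hM, hsol.E_eq m hm, ← hf, ← hr, ← hR] at hfin
    have e1 : (0 ^ 2 + f * M) / r + h m * (u m * 0) / (2 * r ^ 3) +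
        (k / (4 * r ^ 3) + 3 * h m ^ 2 / (8 * r ^ 5)) * (M - M) = M * r := by
      rw [← hrr]
      field_simp
      ring
    have e2 : (k / (4 * R ^ 3) + 3 * 0 ^ 2 / (8 * R ^ 5)) * (u T ^ 2 - M) ≤ 0 := by
      have := hmax T (Set.Ioo_subset_Icc_self (hmem T (hsub T hTT)))
      refine mul_nonpos_of_nonneg_of_nonpos (by positivity) (by linarith)
    rw [e1, zero_mul, zero_div, add_zero] at hfin
    have e3 : M * r ≤ E T / R := by linarith
    rw [le_div_iff₀ hR0] at e3
    linarith
  have h2 : M ^ 2 * f * H T ≤ E c ^ 2 := by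
    have := pow_le_pow_left₀ (by positivity) h1 2
    rw [← hrr, ← hRR]
    linarith
  have h3 : L ^ 2 - (a + b) ^ 2 ≤ 6 * H T := by
    have e1 : T - m = d / k := by rw [hT]; ring
    have e2 : H T = f + d ^ 2 / (2 * k) := by
      simp only [hH, e1]
      field_simp
      ring
    rw [e2]
    exact trigCoeff_max_le ha hb.le hm hD hF.le
  have h4 := mul_le_mul_of_nonneg_left h3 (show 0 ≤ M ^ 2 * f by positivity)
  linarith

end IsTrigSolution

namespace IsTrigSolution

variable {a b L : ℝ} {u du E : ℝ → ℝ}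

/-- The bound of `sq_mul_le` when the largest maximum of `u²` lies where the coefficient increases.
By `trigCoeffDeriv_sq_le` the coefficient at that maximum is at least of the order `z⁻²` times its
own maximum, which is inserted into `sq_mul_le_of_isMax`. -/
theorem sq_mul_le_left (hsol : IsTrigSolution a b L u du E) (ha : 0 < a) (hb : 0 < b)
    {z m M c : ℝ} (hz : 1 ≤ z) (haz : a ≤ z ^ 3)
    (hm : m ∈ Set.Ioo 0 (Real.pi / 2)) (hD : 0 ≤ trigDefect a b m) (hM0 : 0 < M)
    (hM : u m ^ 2 = M) (hdu : du m = 0) (hmax : ∀ t ∈ Set.Icc 0 (Real.pi / 2), u t ^ 2 ≤ M)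
    (hc : c ∈ Set.Ioo 0 (Real.pi / 2)) (hDc : trigDefect a b c = 0) :
    M * (L ^ 2 - (a + b) ^ 2) ≤ 91 / 25 * z * E c := by
  have hs := sin_pos_of_mem hm
  have hco := cos_pos_of_mem hm
  obtain ⟨hF, hd⟩ := hsol.trigCoeffDeriv_sq_le ha.le hb.le hm hD hM0 hM hdu hmax
  have hEc := hsol.E_nonneg ha.le hb.le (Set.Ioo_subset_Icc_self hc)
  have hFm : L ^ 2 - (a + b) ^ 2 = trigCoeff a b L m + trigDefect a b m ^ 2 := by
    rw [trigCoeff_eq hm]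
    ring
  have hmc : m ≤ c := by
    by_contra hcm
    have := trigDefect_strictAntiOn ha hb.le hc hm (not_le.mp hcm)
    linarith
  have h1 := hsol.sq_mul_le_of_isMax ha hb hm hD hM hdu hmax hF hc hDc hmc
  set f := trigCoeff a b L m with hf
  set d := trigCoeffDeriv a b m with hd'
  set D := trigDefect a b m with hD'
  have hDa : D ≤ a / Real.sin m := by
    have e1 : D ≤ a * Real.cos m / Real.sin m := by
      rw [hD', trigDefect, sub_le_self_iff]
      positivity
    refine e1.trans ?_
    rw [div_le_div_iff_of_pos_right hs]
    exact mul_le_of_le_one_right ha.le (Real.cos_le_one _)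
  have h2 : 2 * D ^ 3 ≤ d * a := by
    have e1 : 2 * D * (a / Real.sin m ^ 2) ≤ d := by
      rw [hd', trigCoeffDeriv_eq hm]
      have : 0 ≤ b / Real.cos m ^ 2 := by positivity
      gcongr
      linarith
    have e2 : D ^ 2 ≤ (a / Real.sin m) ^ 2 := pow_le_pow_left₀ hD hDa 2
    calc 2 * D ^ 3 = 2 * D * D ^ 2 := by ring
      _ ≤ 2 * D * (a / Real.sin m) ^ 2 := by gcongr
      _ = 2 * D * (a / Real.sin m ^ 2) * a := by field_simp
      _ ≤ d * a := by gcongr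
  have h3 : (D ^ 2) ^ 3 ≤ (6 / 5 * z ^ 2 * f) ^ 3 := by
    have e1 := pow_le_pow_left₀ (by positivity) h2 2
    have e2 : a ^ 2 ≤ (z ^ 3) ^ 2 := pow_le_pow_left₀ ha.le haz 2
    have e3 : d ^ 2 * a ^ 2 ≤ 144 / 25 * f ^ 3 * (z ^ 3) ^ 2 := by
      gcongr
      linarith
    have e4 : 0 ≤ f ^ 3 * z ^ 6 := by positivity
    nlinarith
  have h4 : D ^ 2 ≤ 6 / 5 * z ^ 2 * f :=
    (pow_le_pow_iff_left₀ (by positivity) (by positivity) (by norm_num)).mp h3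
  have h5 : L ^ 2 - (a + b) ^ 2 ≤ 11 / 5 * z ^ 2 * f := by
    rw [hFm]
    have : f * 1 ≤ f * z ^ 2 := by gcongr; nlinarith
    linarith
  have hFm0 : 0 ≤ L ^ 2 - (a + b) ^ 2 := by rw [hFm]; positivity
  have h6 : (M * (L ^ 2 - (a + b) ^ 2)) ^ 2 ≤ (91 / 25 * z * E c) ^ 2 := by
    generalize L ^ 2 - (a + b) ^ 2 = G at *
    calc (M * G) ^ 2 = M ^ 2 * G * G := by ring
      _ ≤ M ^ 2 * G * (11 / 5 * z ^ 2 * f) := by gcongr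
      _ = 11 / 5 * z ^ 2 * (M ^ 2 * f * G) := by ring
      _ ≤ 11 / 5 * z ^ 2 * (6 * E c ^ 2) := by gcongr
      _ ≤ (91 / 25 * z * E c) ^ 2 := by
        have : 0 ≤ z ^ 2 * E c ^ 2 := by positivity
        nlinarith
  exact (pow_le_pow_iff_left₀ (by positivity) (by positivity) (by norm_num)).mp h6

/-- The square of the solution is bounded by the maximal energy divided by the maximum of the
coefficient, at the price of a factor of the order of the cube root of `max a b`. -/
theorem sq_mul_le (hsol : IsTrigSolution a b L u du E) (ha : 0 < a) (hb : 0 < b)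
    {z c : ℝ} (hz : 1 ≤ z) (haz : a ≤ z ^ 3) (hbz : b ≤ z ^ 3)
    (hc : c ∈ Set.Ioo 0 (Real.pi / 2)) (hDc : trigDefect a b c = 0) {t : ℝ}
    (ht : t ∈ Set.Icc 0 (Real.pi / 2)) :
    u t ^ 2 * (L ^ 2 - (a + b) ^ 2) ≤ 91 / 25 * z * E c := by
  have hEc := hsol.E_nonneg ha.le hb.le (Set.Ioo_subset_Icc_self hc)
  rcases lt_or_ge (L ^ 2 - (a + b) ^ 2) 0 with hneg | hFm
  · exact (mul_nonpos_of_nonneg_of_nonpos (sq_nonneg _) hneg.le).trans (by positivity)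
  have hu := hsol.continuous_u
  obtain ⟨m, hm, hmax⟩ := isCompact_Icc.exists_isMaxOn ⟨t, ht⟩
    (by fun_prop : ContinuousOn (fun t => u t ^ 2) (Set.Icc 0 (Real.pi / 2)))
  have hmax' : ∀ t ∈ Set.Icc 0 (Real.pi / 2), u t ^ 2 ≤ u m ^ 2 := fun t ht => hmax ht
  suffices h : u m ^ 2 * (L ^ 2 - (a + b) ^ 2) ≤ 91 / 25 * z * E c from
    (mul_le_mul_of_nonneg_right (hmax' t ht) hFm).trans h
  rcases (sq_nonneg (u m)).eq_or_lt with h0 | hM0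
  · rw [← h0, zero_mul]
    positivity
  have hum : u m ≠ 0 := by
    rintro h
    rw [h] at hM0
    norm_num at hM0
  have hm' : m ∈ Set.Ioo 0 (Real.pi / 2) := by
    refine ⟨hm.1.lt_of_ne ?_, hm.2.lt_of_ne ?_⟩
    · rintro rfl
      exact hum hsol.u_zero
    · rintro rfl
      exact hum hsol.u_pi_div_two
  have hdu : du m = 0 := by
    have h1 : IsLocalMax (fun t => u t ^ 2) m := by
      filter_upwards [isOpen_Ioo.mem_nhds hm'] with x hx using
        hmax' x (Set.Ioo_subset_Icc_self hx)
    have h2 := h1.hasDerivAt_eq_zero ((hsol.hasDerivAt_u m hm').pow 2)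
    simpa [hum] using h2
  rcases le_total 0 (trigDefect a b m) with hD | hD
  · exact hsol.sq_mul_le_left ha hb hz haz hm' hD hM0 rfl hdu hmax' hc hDc
  · have := hsol.reflect.sq_mul_le_left hb ha hz hbz (m := Real.pi / 2 - m)
      (M := u m ^ 2) (c := Real.pi / 2 - c)
      ⟨by linarith [hm'.2], by linarith [hm'.1]⟩ (by rw [trigDefect_reflect]; linarith) hM0
      (by simp) (by simp [hdu])
      (fun t ht => hmax' _ ⟨by linarith [ht.2], by linarith [ht.1]⟩)
      ⟨by linarith [hc.2], by linarith [hc.1]⟩ (by rw [trigDefect_reflect, hDc, neg_zero])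
    simpa [add_comm b a] using this

/-- A pointwise bound for the solution by its mass, given an interval on which the coefficient is
comparable to its maximum. -/
theorem sq_mul_le_integral (hsol : IsTrigSolution a b L u du E) (ha : 0 < a) (hb : 0 < b)
    (hab : a + b < L) {z : ℝ} (hz : 1 ≤ z) (haz : a ≤ z ^ 3) (hbz : b ≤ z ^ 3)
    {t₁ t₂ η : ℝ} (hη0 : 0 ≤ η) (h₁ : 0 < t₁) (h₁₂ : t₁ ≤ t₂) (h₂ : t₂ < Real.pi / 2)
    (hη : ∀ t ∈ Set.Icc t₁ t₂, η * (L ^ 2 - (a + b) ^ 2) ≤ trigCoeff a b L t) {t : ℝ}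
    (ht : t ∈ Set.Icc 0 (Real.pi / 2)) :
    η * (t₂ - t₁) * u t ^ 2 ≤
      182 / 25 * z * ∫ t in (0 : ℝ)..(Real.pi / 2), u t ^ 2 := by
  obtain ⟨c, hc, hDc⟩ := exists_trigDefect_eq_zero ha hb
  have hFm0 : 0 < L ^ 2 - (a + b) ^ 2 := by nlinarith
  have h1 := hsol.E_le_integral ha.le hb.le hab hc hDc h₁ h₁₂ h₂ hη
  have h2 := hsol.sq_mul_le ha hb hz haz hbz hc hDc ht
  have h3 : 0 ≤ η * (t₂ - t₁) := mul_nonneg hη0 (by linarith)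
  have h4 := mul_le_mul_of_nonneg_left h2 h3
  have h5 := mul_le_mul_of_nonneg_left h1 (show 0 ≤ 91 / 25 * z by positivity)
  refine le_of_mul_le_mul_right ?_ hFm0
  linarith

end IsTrigSolution

/-! ### Pointwise bounds for orthonormal Jacobi polynomials -/

/-- The weighted Jacobi polynomial `(sin t)^{A+1/2} (cos t)^{B+1/2} P_n(cos 2t)`. -/
noncomputable def jacobiWave (A B : ℝ) (n : ℕ) (t : ℝ) : ℝ :=
  Real.sin t ^ (A - 1 / 2 + 1) * Real.cos t ^ (B - 1 / 2 + 1) *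
    (jacobiPoly A B n).eval (1 - 2 * Real.sin t ^ 2)

/-- The factor of the derivative of `jacobiWave` beside `(sin t)^{A-1/2} (cos t)^{B-1/2}`. -/
noncomputable def jacobiWaveFactor (A B : ℝ) (n : ℕ) (t : ℝ) : ℝ :=
  ((A + 1 / 2) * Real.cos t ^ 2 - (B + 1 / 2) * Real.sin t ^ 2) *
      (jacobiPoly A B n).eval (1 - 2 * Real.sin t ^ 2) -
    4 * Real.sin t ^ 2 * Real.cos t ^ 2 *
      (Polynomial.derivative (jacobiPoly A B n)).eval (1 - 2 * Real.sin t ^ 2)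

theorem continuous_jacobiWaveFactor (A B : ℝ) (n : ℕ) : Continuous (jacobiWaveFactor A B n) := by
  have h1 := continuous_eval_one_sub_two_mul_sin_sq (jacobiPoly A B n)
  have h2 := continuous_eval_one_sub_two_mul_sin_sq (Polynomial.derivative (jacobiPoly A B n))
  unfold jacobiWaveFactor
  fun_prop

/-- The weighted Jacobi polynomial solves a trigonometric Schrödinger equation. -/
theorem isTrigSolution_jacobiWave {A B : ℝ} (hA : 1 ≤ A) (hB : 1 ≤ B) (n : ℕ) :
    IsTrigSolution (Real.sqrt (A ^ 2 - 1 / 4)) (Real.sqrt (B ^ 2 - 1 / 4)) (2 * n + A + B + 1)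
      (jacobiWave A B n)
      (fun t => Real.sin t ^ (A - 1 / 2) * Real.cos t ^ (B - 1 / 2) * jacobiWaveFactor A B n t)
      (fun t => (Real.sin t ^ (A - 1 / 2) * Real.cos t ^ (B - 1 / 2)) ^ 2 *
        (jacobiWaveFactor A B n t ^ 2 +
          ((2 * n + A + B + 1) ^ 2 * Real.sin t ^ 2 * Real.cos t ^ 2 -
            (A ^ 2 - 1 / 4) * Real.cos t ^ 2 - (B ^ 2 - 1 / 4) * Real.sin t ^ 2) *
          (jacobiPoly A B n).eval (1 - 2 * Real.sin t ^ 2) ^ 2)) := by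
  have hP := continuous_eval_one_sub_two_mul_sin_sq (jacobiPoly A B n)
  have hR := continuous_jacobiWaveFactor A B n
  have hv : Continuous fun t => Real.sin t ^ (A - 1 / 2) * Real.cos t ^ (B - 1 / 2) :=
    continuous_sin_rpow_mul_cos_rpow (by linarith) (by linarith)
  have hW : Continuous fun t => Real.sin t ^ (A - 1 / 2 + 1) * Real.cos t ^ (B - 1 / 2 + 1) :=
    continuous_sin_rpow_mul_cos_rpow (by linarith) (by linarith)
  have ha : Real.sqrt (A ^ 2 - 1 / 4) ^ 2 = A ^ 2 - 1 / 4 := Real.sq_sqrt (by nlinarith)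
  have hb : Real.sqrt (B ^ 2 - 1 / 4) ^ 2 = B ^ 2 - 1 / 4 := Real.sq_sqrt (by nlinarith)
  have hWv : ∀ t ∈ Set.Ioo 0 (Real.pi / 2),
      Real.sin t ^ (A - 1 / 2 + 1) * Real.cos t ^ (B - 1 / 2 + 1) =
        Real.sin t ^ (A - 1 / 2) * Real.cos t ^ (B - 1 / 2) * (Real.sin t * Real.cos t) := by
    intro t ht
    rw [Real.rpow_add_one (sin_pos_of_mem ht).ne', Real.rpow_add_one (cos_pos_of_mem ht).ne']
    ring
  refine ⟨hW.mul hP, hv.mul hR, by fun_prop, ?_, ?_, ?_, ?_, ?_, ?_, ?_⟩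
  · rw [jacobiWave, Real.sin_zero, Real.zero_rpow (by linarith)]
    ring
  · rw [jacobiWave, Real.cos_pi_div_two, Real.zero_rpow (by linarith)]
    ring
  · simp only [Real.sin_zero]
    rw [Real.zero_rpow (by linarith)]
    ring
  · simp only [Real.cos_pi_div_two]
    rw [Real.zero_rpow (x := B - 1 / 2) (by linarith)]
    ring
  · intro t ht
    refine ((hasDerivAt_sin_rpow_mul_cos_rpow (A - 1 / 2) (B - 1 / 2) ht).mul
      (hasDerivAt_eval_one_sub_two_mul_sin_sq (jacobiPoly A B n) t)).congr_deriv ?_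
    rw [hWv t ht, jacobiWaveFactor]
    ring
  · intro t ht
    have hs := sin_pos_of_mem ht
    have hc := cos_pos_of_mem ht
    have h1 := hasDerivAt_sin_rpow_mul_cos_rpow (A - 1 / 2 - 1) (B - 1 / 2 - 1) ht
    rw [Real.rpow_sub_one hs.ne', Real.rpow_sub_one hc.ne'] at h1
    simp only [sub_add_cancel] at h1
    have h2 := hasDerivAt_eval_one_sub_two_mul_sin_sq (jacobiPoly A B n) t
    have h3 := hasDerivAt_eval_one_sub_two_mul_sin_sq (Polynomial.derivative (jacobiPoly A B n)) t
    have hss := (Real.hasDerivAt_sin t).pow 2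
    have hcc := (Real.hasDerivAt_cos t).pow 2
    have h4 := (((hcc.const_mul (A + 1 / 2)).sub (hss.const_mul (B + 1 / 2))).mul h2).sub
      (((hss.const_mul 4).mul hcc).mul h3)
    refine (h1.mul h4).congr_deriv ?_
    have hode := jacobiPoly_ode A B n (1 - 2 * Real.sin t ^ 2)
    have hcs : Real.sin t ^ 2 + Real.cos t ^ 2 = 1 := Real.sin_sq_add_cos_sq t
    rw [trigCoeff, ha, hb, jacobiWave, hWv t ht]
    simp only [Pi.pow_apply, Pi.mul_apply, Pi.sub_apply, Nat.reduceSub, Nat.cast_ofNat, pow_one]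
    generalize Real.sin t ^ (A - 1 / 2) = v1
    generalize Real.cos t ^ (B - 1 / 2) = v2
    generalize Real.sin t = s at *
    generalize Real.cos t = c at *
    generalize Polynomial.eval _ (jacobiPoly A B n) = y at *
    generalize Polynomial.eval _ (Polynomial.derivative (jacobiPoly A B n)) = y' at *
    generalize Polynomial.eval _ (Polynomial.derivative (Polynomial.derivative (jacobiPoly A B n))) =
      y'' at *
    field_simp
    grind
  · intro t ht
    have hs := sin_pos_of_mem ht
    have hc := cos_pos_of_mem ht
    rw [trigCoeff, ha, hb, jacobiWave, hWv t ht]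
    field_simp

theorem sqrt_sq_sub_le {A : ℝ} (hA : 0 ≤ A) : Real.sqrt (A ^ 2 - 1 / 4) ≤ A :=
  Real.sqrt_le_iff.mpr ⟨hA, by linarith⟩

/-- The general pointwise bound: given an interval of length `t₂ - t₁` on which the coefficient of
the trigonometric equation is at least `η` times its maximum, the weighted square of the orthonormal
Jacobi polynomial is bounded by a constant multiple of `A^{1/3} / (η (t₂ - t₁))`. -/
theorem jacobiP_sq_le {A B : ℝ} (hA : 1 ≤ A) (hB : 1 ≤ B) (hBA : B ≤ A) (n : ℕ)
    {t₁ t₂ η : ℝ} (hη0 : 0 ≤ η) (h₁ : 0 < t₁) (h₁₂ : t₁ ≤ t₂) (h₂ : t₂ < Real.pi / 2)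
    (hη : ∀ t ∈ Set.Icc t₁ t₂, η * ((2 * n + A + B + 1) ^ 2 -
        (Real.sqrt (A ^ 2 - 1 / 4) + Real.sqrt (B ^ 2 - 1 / 4)) ^ 2) ≤
      trigCoeff (Real.sqrt (A ^ 2 - 1 / 4)) (Real.sqrt (B ^ 2 - 1 / 4)) (2 * n + A + B + 1) t)
    {x : ℝ} (hx : x ∈ Set.Icc (-1 : ℝ) 1) :
    η * (t₂ - t₁) *
        ((1 - x) ^ (A + 1 / 2) * (1 + x) ^ (B + 1 / 2) * (jacobiP A B n).eval x ^ 2) ≤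
      91 / 25 * A ^ (1 / 3 : ℝ) := by
  have hpi := Real.pi_pos
  have hn : (0 : ℝ) ≤ n := n.cast_nonneg
  set t := Real.arccos x / 2 with ht
  have ht0 : 0 ≤ t := div_nonneg (Real.arccos_nonneg x) two_pos.le
  have ht1 : t ≤ Real.pi / 2 := by
    have := Real.arccos_le_pi x
    linarith
  have hxt : x = 1 - 2 * Real.sin t ^ 2 := by
    have h1 : Real.cos (2 * t) = x := by
      rw [ht, mul_div_cancel₀ _ two_ne_zero, Real.cos_arccos hx.1 hx.2]
    rw [← h1, Real.cos_two_mul, Real.cos_sq']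
    ring
  have hs : 0 ≤ Real.sin t := Real.sin_nonneg_of_nonneg_of_le_pi ht0 (by linarith)
  have hc : 0 ≤ Real.cos t := Real.cos_nonneg_of_mem_Icc ⟨by linarith, ht1⟩
  have e1 : 1 - x = 2 * Real.sin t ^ 2 := by rw [hxt]; ring
  have e2 : 1 + x = 2 * Real.cos t ^ 2 := by rw [hxt, Real.cos_sq']; ring
  have hpow : ∀ {y d : ℝ}, 0 ≤ y →
      (2 * y ^ 2) ^ (d + 1 / 2) = 2 ^ (d + 1 / 2) * (y ^ (d - 1 / 2 + 1)) ^ 2 := by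
    intro y d hy
    rw [Real.mul_rpow two_pos.le (by positivity), ← Real.rpow_natCast y, ← Real.rpow_mul hy,
      ← Real.rpow_natCast (y ^ _), ← Real.rpow_mul hy]
    congr 2
    push_cast
    ring
  have hN := jacobiNormSq_pos (show 0 ≤ A by linarith) (show 0 ≤ B by linarith) n
  have e3 : (1 - x) ^ (A + 1 / 2) * (1 + x) ^ (B + 1 / 2) * (jacobiP A B n).eval x ^ 2 =
      2 ^ (A + B + 1) * jacobiNormSq A B n * jacobiWave A B n t ^ 2 := by
    rw [e1, e2, hpow hs, hpow hc, jacobiP_eq, Polynomial.eval_C_mul, mul_pow,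
      Real.sq_sqrt hN.le, jacobiWave, ← hxt,
      show A + B + 1 = (A + 1 / 2) + (B + 1 / 2) by ring,
      Real.rpow_add two_pos (A + 1 / 2)]
    ring
  have hI : ∫ t in (0 : ℝ)..(Real.pi / 2), jacobiWave A B n t ^ 2 = jacobiSqIntegral A B n := by
    refine intervalIntegral.integral_congr fun t ht => ?_
    rw [Set.uIcc_of_le (by positivity)] at ht
    have hs : 0 ≤ Real.sin t := Real.sin_nonneg_of_nonneg_of_le_pi ht.1 (by linarith [ht.2])
    have hc : 0 ≤ Real.cos t := Real.cos_nonneg_of_mem_Icc ⟨by linarith [ht.1], ht.2⟩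
    simp only [jacobiWave, mul_pow]
    rw [← Real.rpow_natCast (Real.sin t ^ _), ← Real.rpow_natCast (Real.cos t ^ _),
      ← Real.rpow_mul hs, ← Real.rpow_mul hc]
    congr 4 <;> push_cast <;> ring
  have hnorm := jacobiNormSq_mul_jacobiSqIntegral (show 0 ≤ A by linarith)
    (show 0 ≤ B by linarith) n
  rw [show A + B + 2 = A + B + 1 + 1 by ring, Real.rpow_add_one two_ne_zero] at hnorm
  set z := A ^ (1 / 3 : ℝ) with hz
  have hz1 : 1 ≤ z := Real.one_le_rpow hA (by norm_num)
  have hz3 : z ^ 3 = A := by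
    rw [hz, ← Real.rpow_natCast, ← Real.rpow_mul (by linarith)]
    norm_num
  have ha := sqrt_sq_sub_le (show 0 ≤ A by linarith)
  have hb := sqrt_sq_sub_le (show 0 ≤ B by linarith)
  have hmain := (isTrigSolution_jacobiWave hA hB n).sq_mul_le_integral
    (Real.sqrt_pos.mpr (by nlinarith)) (Real.sqrt_pos.mpr (by nlinarith)) (by linarith) hz1
    (by rw [hz3]; exact ha) (by rw [hz3]; linarith) hη0 h₁ h₁₂ h₂ hη (t := t) ⟨ht0, ht1⟩
  rw [hI] at hmain
  rw [e3]
  have hk : 0 ≤ 2 ^ (A + B + 1) * jacobiNormSq A B n := by positivity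
  have := mul_le_mul_of_nonneg_left hmain hk
  calc _ = 2 ^ (A + B + 1) * jacobiNormSq A B n *
        (η * (t₂ - t₁) * jacobiWave A B n t ^ 2) := by ring
    _ ≤ _ := this
    _ = 91 / 25 * z * (2 ^ (A + B + 1) * 2 *
        (jacobiNormSq A B n * jacobiSqIntegral A B n)) := by ring
    _ = _ := by rw [hnorm, mul_one]

/-- The pointwise bound in the range where the degree is large compared with the parameters. -/
theorem jacobiP_sq_le_of_large {A B : ℝ} (hA : 1 ≤ A) (hB : 1 ≤ B) (hBA : B ≤ A) {n : ℕ}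
    (hn : 15 * A ≤ n) {x : ℝ} (hx : x ∈ Set.Icc (-1 : ℝ) 1) :
    (1 - x) ^ (A + 1 / 2) * (1 + x) ^ (B + 1 / 2) * (jacobiP A B n).eval x ^ 2 ≤
      4 * A ^ (1 / 3 : ℝ) := by
  have hpi := Real.pi_gt_d2
  have hpi' := Real.pi_lt_d2
  have h := jacobiP_sq_le hA hB hBA n (t₁ := 1 / 4) (t₂ := 13 / 10) (η := 9 / 10) (by norm_num)
    (by norm_num) (by norm_num) (by linarith) ?_ hx
  -- The window is chosen such that `(91 / 25) / (9 / 10 * (13 / 10 - 1 / 4)) ≤ 4`.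
  · have : 0 ≤ A ^ (1 / 3 : ℝ) := by positivity
    linarith
  intro t ht
  have ha : Real.sqrt (A ^ 2 - 1 / 4) ^ 2 = A ^ 2 - 1 / 4 := Real.sq_sqrt (by nlinarith)
  have hb : Real.sqrt (B ^ 2 - 1 / 4) ^ 2 = B ^ 2 - 1 / 4 := Real.sq_sqrt (by nlinarith)
  have hpos : (0 : ℝ) < 2 / Real.pi := by positivity
  have h2pi : 2 / Real.pi ≤ 16 / 25 := by
    rw [div_le_div_iff₀ (by positivity) (by norm_num)]
    linarith
  have h2pi' : 3 / 5 ≤ 2 / Real.pi := by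
    rw [div_le_div_iff₀ (by norm_num) (by positivity)]
    linarith
  have hs : 3 / 20 ≤ Real.sin t := by
    have h1 := Real.mul_le_sin (x := t) (by linarith [ht.1]) (by linarith [ht.2])
    nlinarith [ht.1]
  have hc : 3 / 20 ≤ Real.cos t := by
    have h1 := Real.one_sub_mul_le_cos (x := t) (by linarith [ht.1]) (by linarith [ht.2])
    nlinarith [ht.2, ht.1]
  have key : ∀ {y d : ℝ}, 3 / 20 ≤ y → 0 ≤ d → d ≤ A ^ 2 → d / y ^ 2 ≤ 45 * A ^ 2 := by
    intro y d hy hd0 hd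
    rw [div_le_iff₀ (by positivity)]
    have : 9 / 400 ≤ y ^ 2 := by nlinarith
    nlinarith [sq_nonneg A]
  have k1 := key hs (sq_nonneg (Real.sqrt (A ^ 2 - 1 / 4))) (by rw [ha]; linarith)
  have k2 := key hc (sq_nonneg (Real.sqrt (B ^ 2 - 1 / 4))) (by rw [hb]; nlinarith)
  have hL : 900 * A ^ 2 ≤ (2 * n + A + B + 1) ^ 2 := by nlinarith
  rw [trigCoeff]
  nlinarith [sq_nonneg (Real.sqrt (A ^ 2 - 1 / 4) + Real.sqrt (B ^ 2 - 1 / 4))]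

/-- The pointwise bound for degrees that are at most of the order of the parameters. -/
theorem jacobiP_sq_le_of_small {A B : ℝ} (hA : 1 ≤ A) (hB : 1 ≤ B) (hBA : B ≤ A) {n : ℕ}
    (hn1 : 1 ≤ n) (hn : n ≤ 15 * A) {x : ℝ} (hx : x ∈ Set.Icc (-1 : ℝ) 1) :
    (1 - x) ^ (A + 1 / 2) * (1 + x) ^ (B + 1 / 2) * (jacobiP A B n).eval x ^ 2 ≤
      256 * Real.sqrt (A / n) * A ^ (1 / 3 : ℝ) := by
  have hpi := Real.pi_gt_d2
  have hn0 : (0 : ℝ) < n := by exact_mod_cast hn1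
  set a := Real.sqrt (A ^ 2 - 1 / 4) with ha
  set b := Real.sqrt (B ^ 2 - 1 / 4) with hb
  have ha0 : 0 < a := Real.sqrt_pos.mpr (by nlinarith)
  have hb0 : 0 < b := Real.sqrt_pos.mpr (by nlinarith)
  have haA : a ≤ A := sqrt_sq_sub_le (by linarith)
  have hbB : b ≤ B := sqrt_sq_sub_le (by linarith)
  have hba : b ≤ a := Real.sqrt_le_sqrt (by nlinarith)
  obtain ⟨c, hc, hDc⟩ := exists_trigDefect_eq_zero ha0 hb0
  have h4 : Real.pi / 4 ∈ Set.Ioo 0 (Real.pi / 2) := ⟨by linarith, by linarith⟩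
  -- the maximum of the coefficient lies in the half where the larger parameter has its pole
  have hc4 : Real.pi / 4 ≤ c := by
    by_contra hlt
    have h1 := trigDefect_strictAntiOn ha0 hb0.le hc h4 (not_le.mp hlt)
    rw [hDc, trigDefect, Real.sin_pi_div_four, Real.cos_pi_div_four,
      mul_div_assoc, mul_div_assoc, div_self (by positivity)] at h1
    linarith
  set q := Real.sqrt (n / A) with hq
  have hq0 : 0 < q := Real.sqrt_pos.mpr (by positivity)
  have hqq : q ^ 2 = n / A := Real.sq_sqrt (by positivity)
  have hq4 : q ≤ 4 := by
    refine Real.sqrt_le_iff.mpr ⟨by norm_num, ?_⟩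
    rw [div_le_iff₀ (by linarith)]
    linarith
  -- In the window `[c - q / 32, c]` the slope of the defect is at most `32 A`, so that the square of
  -- the defect stays below `A n`, half of a lower bound for the maximum of the coefficient.
  have h := jacobiP_sq_le hA hB hBA n (t₁ := c - q / 32) (t₂ := c) (η := 1 / 2) (by norm_num)
    (by linarith) (by linarith) hc.2 ?_ hx
  · set y := (1 - x) ^ (A + 1 / 2) * (1 + x) ^ (B + 1 / 2) * (jacobiP A B n).eval x ^ 2 with hy
    have e : Real.sqrt (A / n) = q⁻¹ := by rw [hq, ← Real.sqrt_inv, inv_div]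
    rw [e]
    have hz : 0 ≤ A ^ (1 / 3 : ℝ) := by positivity
    have : y * q ≤ 256 * A ^ (1 / 3 : ℝ) := by linarith
    calc y = y * q * q⁻¹ := by field_simp
      _ ≤ 256 * A ^ (1 / 3 : ℝ) * q⁻¹ := by gcongr
      _ = _ := by ring
  intro t ht
  have hmem : ∀ y ∈ Set.Icc t c, y ∈ Set.Ioo 0 (Real.pi / 2) := fun y hy =>
    ⟨by linarith [ht.1, hy.1], hy.2.trans_lt hc.2⟩
  have htt := hmem t ⟨le_rfl, ht.2⟩
  have hD0 : ∀ y ∈ Set.Icc t c, 0 ≤ trigDefect a b y := fun y hy => by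
    rw [← hDc]
    exact trigDefect_antitoneOn ha0.le hb0.le (hmem y hy) hc hy.2
  have hmono : MonotoneOn (fun y => trigDefect a b y + 32 * A * y) (Set.Icc t c) := by
    refine monotoneOn_of_hasDerivWithinAt_nonneg (convex_Icc _ _)
      (f' := fun y => -(a / Real.sin y ^ 2 + b / Real.cos y ^ 2) + 32 * A) ?_ ?_ ?_
    · intro y hy
      have := (hasDerivAt_trigDefect (a := a) (b := b) (hmem y hy)).continuousAt
      exact (this.add (by fun_prop)).continuousWithinAt
    · intro y hy
      have h1 := hasDerivAt_trigDefect (a := a) (b := b) (hmem y (interior_subset hy))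
      refine ((h1.add ((hasDerivAt_id y).const_mul (32 * A))).congr_deriv ?_).hasDerivWithinAt
      ring
    · intro y hy
      have hy := interior_subset hy
      have hs := sin_pos_of_mem (hmem y hy)
      have hco := cos_pos_of_mem (hmem y hy)
      have h1 := hD0 y hy
      rw [trigDefect, sub_nonneg, div_le_div_iff₀ hco hs] at h1
      have h2 : b / Real.cos y ^ 2 ≤ a / Real.sin y ^ 2 := by
        rw [div_le_div_iff₀ (by positivity) (by positivity)]
        linarith
      have hs4 : 1 / 4 ≤ Real.sin y := by
        have h3 := Real.mul_le_sin (hmem y hy).1.le (hmem y hy).2.le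
        have h4 : 2 / Real.pi * (Real.pi / 8) ≤ 2 / Real.pi * y := by
          gcongr
          linarith [hy.1, ht.1]
        have h5 : 2 / Real.pi * (Real.pi / 8) = 1 / 4 := by
          field_simp
          norm_num
        linarith
      have h3 : a / Real.sin y ^ 2 ≤ 16 * A := by
        rw [div_le_iff₀ (by positivity)]
        have : 1 / 16 ≤ Real.sin y ^ 2 := by nlinarith
        nlinarith
      linarith
  have h1 := hmono ⟨le_rfl, ht.2⟩ ⟨ht.2, le_rfl⟩ ht.2
  simp only [hDc] at h1
  have h2 := hD0 t ⟨le_rfl, ht.2⟩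
  have h3 : trigDefect a b t ≤ A * q := by nlinarith [ht.1]
  have h5 : trigDefect a b t ^ 2 ≤ A * n := by
    calc _ ≤ (A * q) ^ 2 := pow_le_pow_left₀ h2 h3 2
      _ = A * n := by rw [mul_pow, hqq]; field_simp
  rw [trigCoeff_eq htt]
  have h6 : 2 * (A * n) ≤ (2 * n + A + B + 1) ^ 2 - (a + b) ^ 2 := by
    have e1 : (a + b) ^ 2 ≤ (A + B) ^ 2 := by gcongr
    nlinarith
  linarith

/-! ### The maximum of a Jacobi polynomial -/

theorem descPochhammer_eval_mono {y y' : ℝ} {n : ℕ} (h0 : (n : ℝ) - 1 ≤ y) (h : y ≤ y') :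
    0 ≤ (descPochhammer ℝ n).eval y ∧
      (descPochhammer ℝ n).eval y ≤ (descPochhammer ℝ n).eval y' := by
  rw [descPochhammer_eval_eq_prod_range, descPochhammer_eval_eq_prod_range]
  have hk : ∀ k ∈ Finset.range n, 0 ≤ y - k := by
    intro k hk
    have : (k : ℝ) + 1 ≤ n := by exact_mod_cast Finset.mem_range.mp hk
    linarith
  exact ⟨Finset.prod_nonneg hk, Finset.prod_le_prod hk fun k _ => by linarith⟩

theorem jacobiPoly_eval_one_pos {A : ℝ} (hA : 0 ≤ A) (B : ℝ) (n : ℕ) :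
    0 < (jacobiPoly A B n).eval 1 := by
  rw [jacobiPoly_eval_one]
  have : 0 < (descPochhammer ℝ n).eval (n + A) := descPochhammer_pos (by linarith)
  positivity

/-- The Jacobi polynomial is largest in absolute value at the end with the larger parameter. -/
theorem abs_jacobiPoly_eval_le {A B : ℝ} (hB : 0 ≤ B) (hBA : B ≤ A) (n : ℕ) {x : ℝ}
    (hx : x ∈ Set.Icc (-1 : ℝ) 1) :
    |(jacobiPoly A B n).eval x| ≤ (jacobiPoly A B n).eval 1 := by
  rcases n.eq_zero_or_pos with rfl | hn
  · simp [jacobiPoly, jacobiCoeff, endpointMonomial]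
  have hA : 0 ≤ A := hB.trans hBA
  have hn0 : (0 : ℝ) < n := by exact_mod_cast hn
  set P := jacobiPoly A B n with hP
  set l : ℝ := n * (n + A + B + 1) with hl
  have hl0 : 0 < l := by positivity
  have hP1 := jacobiPoly_eval_one_pos hA B n
  rw [← hP] at hP1
  -- Sonin's function, which decreases up to `(B - A) / (A + B + 1)` and increases from there
  set S : ℝ → ℝ := fun y => l * P.eval y ^ 2 + (1 - y ^ 2) * P.derivative.eval y ^ 2 with hS
  have hSd : ∀ y, HasDerivAt S
      (2 * P.derivative.eval y ^ 2 * ((A - B) + (A + B + 1) * y)) y := by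
    intro y
    have h1 := P.hasDerivAt y
    have h2 := P.derivative.hasDerivAt y
    have h3 := ((h1.pow 2).const_mul l).add
      ((((hasDerivAt_id y).pow 2).const_sub 1).mul (h2.pow 2))
    refine h3.congr_deriv ?_
    have hode := jacobiPoly_ode A B n y
    rw [← hP] at hode
    simp only [Pi.pow_apply, id_eq, Nat.reduceSub, Nat.cast_ofNat]
    linear_combination (2 * P.derivative.eval y) * hode
  have hSc : Continuous S := continuous_iff_continuousAt.mpr fun y => (hSd y).continuousAt
  have hends : P.eval (-1) ^ 2 ≤ P.eval 1 ^ 2 := by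
    rw [hP, jacobiPoly_eval_neg_one, jacobiPoly_eval_one, mul_pow, ← pow_mul, mul_comm n 2,
      pow_mul, neg_one_sq, one_pow, one_mul]
    obtain ⟨h0, h1⟩ := descPochhammer_eval_mono (n := n) (y := n + B) (y' := n + A)
      (by linarith) (by linarith)
    gcongr
  have hS1 : S 1 = l * P.eval 1 ^ 2 := by simp [hS]
  have hSm1 : S (-1) = l * P.eval (-1) ^ 2 := by simp [hS]
  have hSx : S x ≤ S 1 := by
    rcases le_total 0 ((A - B) + (A + B + 1) * x) with hc | hc
    · have hmono : MonotoneOn S (Set.Icc x 1) := by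
        refine monotoneOn_of_hasDerivWithinAt_nonneg (convex_Icc _ _) hSc.continuousOn
          (fun y hy => (hSd y).hasDerivWithinAt) ?_
        intro y hy
        have hy := interior_subset hy
        have : (A + B + 1) * x ≤ (A + B + 1) * y := by gcongr; exact hy.1
        exact mul_nonneg (by positivity) (by linarith)
      exact hmono ⟨le_rfl, hx.2⟩ ⟨hx.2, le_rfl⟩ hx.2
    · have hanti : AntitoneOn S (Set.Icc (-1) x) := by
        refine antitoneOn_of_hasDerivWithinAt_nonpos (convex_Icc _ _) hSc.continuousOn
          (fun y hy => (hSd y).hasDerivWithinAt) ?_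
        intro y hy
        have hy := interior_subset hy
        have : (A + B + 1) * y ≤ (A + B + 1) * x := by gcongr; exact hy.2
        exact mul_nonpos_of_nonneg_of_nonpos (by positivity) (by linarith)
      refine (hanti ⟨le_rfl, hx.1⟩ ⟨hx.1, le_rfl⟩ hx.1).trans ?_
      rw [hS1, hSm1]
      gcongr
  have h1 : l * P.eval x ^ 2 ≤ l * P.eval 1 ^ 2 := by
    rw [← hS1]
    refine le_trans ?_ hSx
    have : 0 ≤ (1 - x ^ 2) * P.derivative.eval x ^ 2 :=
      mul_nonneg (by nlinarith [hx.1, hx.2]) (sq_nonneg _)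
    simp only [hS]
    linarith
  exact abs_le_of_sq_le_sq (le_of_mul_le_mul_left h1 hl0) hP1.le

theorem jacobiP_eval_one_pos {A B : ℝ} (hA : 0 ≤ A) (hB : 0 ≤ B) (n : ℕ) :
    0 < (jacobiP A B n).eval 1 := by
  rw [jacobiP_eq, Polynomial.eval_C_mul]
  exact mul_pos (Real.sqrt_pos.mpr (jacobiNormSq_pos hA hB n)) (jacobiPoly_eval_one_pos hA B n)

theorem abs_jacobiP_div_le_one {A B : ℝ} (hB : 0 ≤ B) (hBA : B ≤ A) (n : ℕ) {x : ℝ}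
    (hx : x ∈ Set.Icc (-1 : ℝ) 1) :
    |(jacobiP A B n).eval x / (jacobiP A B n).eval 1| ≤ 1 := by
  have h1 := jacobiP_eval_one_pos (hB.trans hBA) hB n
  rw [abs_div, abs_of_pos h1, div_le_one h1, jacobiP_eq, Polynomial.eval_C_mul,
    Polynomial.eval_C_mul, abs_mul, abs_of_nonneg (Real.sqrt_nonneg _)]
  exact mul_le_mul_of_nonneg_left (abs_jacobiPoly_eval_le hB hBA n hx) (Real.sqrt_nonneg _)

/-! ### Weighted integrals of powers -/

/-- A function dominated by two powers on `(0, 2]`, one integrable at `0` and the other at infinity: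
the integral is bounded by splitting at the point where both contributions agree. -/
theorem integral_le_of_le_rpow {W : ℝ → ℝ} (hW : ContinuousOn W (Set.Icc 0 2)) {a q Q : ℝ}
    (ha : 0 ≤ a) (hq : a + 1 < q) (hQ : 0 < Q) (h₁ : ∀ t ∈ Set.Icc (0 : ℝ) 2, W t ≤ t ^ a)
    (h₂ : ∀ t ∈ Set.Ioc (0 : ℝ) 2, W t ≤ Q * t ^ (a - q)) :
    ∫ t in (0 : ℝ)..2, W t ≤
      2 / (a + 1) * (Q * ((a + 1) / (q - a - 1))) ^ ((a + 1) / q) := by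
  have hq0 : 0 < q := by linarith
  have ha1 : 0 < a + 1 := by linarith
  have hqa : 0 < q - a - 1 := by linarith
  set D := (Q * ((a + 1) / (q - a - 1))) ^ (1 / q) with hD
  have hD0 : 0 < D := by positivity
  have hDa : (Q * ((a + 1) / (q - a - 1))) ^ ((a + 1) / q) = D ^ (a + 1) := by
    rw [hD, ← Real.rpow_mul (by positivity)]
    congr 1
    ring
  have hDq : D ^ q = Q * ((a + 1) / (q - a - 1)) := by
    rw [hD, ← Real.rpow_mul (by positivity), one_div_mul_cancel hq0.ne', Real.rpow_one]
  rw [hDa]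
  have hnear : ∀ d ∈ Set.Icc (0 : ℝ) 2, ∫ t in (0 : ℝ)..d, W t ≤ d ^ (a + 1) / (a + 1) := by
    intro d hd
    have : ∫ t in (0 : ℝ)..d, t ^ a = d ^ (a + 1) / (a + 1) := by
      rw [integral_rpow (Or.inl (by linarith)), Real.zero_rpow ha1.ne', sub_zero]
    rw [← this]
    refine intervalIntegral.integral_mono_on hd.1 ?_ ?_ ?_
    · refine ContinuousOn.intervalIntegrable ?_
      rw [Set.uIcc_of_le hd.1]
      exact hW.mono (Set.Icc_subset_Icc_right hd.2)
    · exact (Real.continuous_rpow_const ha).intervalIntegrable _ _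
    · exact fun t ht => h₁ t ⟨ht.1, ht.2.trans hd.2⟩
  rcases le_or_gt 2 D with h2D | hD2
  · have h1 := hnear 2 ⟨by norm_num, le_rfl⟩
    have h2 : (2 : ℝ) ^ (a + 1) ≤ D ^ (a + 1) := Real.rpow_le_rpow two_pos.le h2D ha1.le
    have h3 : (2 : ℝ) ^ (a + 1) / (a + 1) ≤ D ^ (a + 1) / (a + 1) := by gcongr
    have h4 : 0 ≤ D ^ (a + 1) / (a + 1) := by positivity
    calc _ ≤ _ := h1
      _ ≤ D ^ (a + 1) / (a + 1) + D ^ (a + 1) / (a + 1) := by linarith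
      _ = _ := by ring
  · have hint : ∀ u v : ℝ, u ∈ Set.Icc (0 : ℝ) 2 → v ∈ Set.Icc (0 : ℝ) 2 →
        IntervalIntegrable W MeasureTheory.volume u v := fun u v hu hv =>
      (hW.mono (Set.uIcc_subset_Icc hu hv)).intervalIntegrable
    have hDm : D ∈ Set.Icc (0 : ℝ) 2 := ⟨hD0.le, hD2.le⟩
    rw [← intervalIntegral.integral_add_adjacent_intervals
      (hint 0 D ⟨le_rfl, two_pos.le⟩ hDm) (hint D 2 hDm ⟨two_pos.le, le_rfl⟩)]
    have h0 : (0 : ℝ) ∉ Set.uIcc D 2 := by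
      rw [Set.uIcc_of_le hD2.le]
      exact fun h => absurd h.1 (not_le.mpr hD0)
    have hfar : ∫ t in D..2, W t ≤ Q * (D ^ (a + 1 - q) / (q - a - 1)) := by
      have h1 : ∫ t in D..2, Q * t ^ (a - q) =
          Q * ((2 ^ (a - q + 1) - D ^ (a - q + 1)) / (a - q + 1)) := by
        rw [intervalIntegral.integral_const_mul, integral_rpow (Or.inr ⟨by linarith, h0⟩)]
      have h2 : ∫ t in D..2, W t ≤ ∫ t in D..2, Q * t ^ (a - q) := by
        refine intervalIntegral.integral_mono_on hD2.le (hint D 2 hDm ⟨two_pos.le, le_rfl⟩) ?_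
          (fun t ht => h₂ t ⟨hD0.trans_le ht.1, ht.2⟩)
        exact ((intervalIntegral.intervalIntegrable_rpow (Or.inr h0))).const_mul Q
      refine h2.trans (h1.le.trans ?_)
      have h3 : (2 ^ (a - q + 1) - D ^ (a - q + 1)) / (a - q + 1) =
          (D ^ (a + 1 - q) - 2 ^ (a + 1 - q)) / (q - a - 1) := by
        rw [show a - q + 1 = a + 1 - q by ring, show q - a - 1 = -(a + 1 - q) by ring, div_neg,
          ← neg_div, neg_sub]
      rw [h3]
      have : (0 : ℝ) ≤ 2 ^ (a + 1 - q) := by positivity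
      gcongr
      linarith
    have h1 := hnear D hDm
    have h2 : Q * (D ^ (a + 1 - q) / (q - a - 1)) = D ^ (a + 1) / (a + 1) := by
      rw [Real.rpow_sub hD0, hDq]
      field_simp
    calc _ ≤ D ^ (a + 1) / (a + 1) + D ^ (a + 1) / (a + 1) := by linarith
      _ = _ := by ring

/-- The weighted `L^p` bound for a Jacobi polynomial normalized at `1`, in terms of a pointwise bound
with constant `4 A^{1/3} τ²`. The powers of two in the conclusion absorb exactly the constant `4`;
what exceeds it is raised to the power `(a + 1) / (A + 1/2)`, which is unbounded for large `p`. -/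
theorem integral_jacobiP_rpow_le {A B : ℝ} (hB : 1 ≤ B) (hBA : B ≤ A) {n : ℕ}
    {τ : ℝ} (hτ0 : 0 < τ)
    (hτ : ∀ x ∈ Set.Icc (-1 : ℝ) 1,
      (1 - x) ^ (A + 1 / 2) * (1 + x) ^ (B + 1 / 2) * (jacobiP A B n).eval x ^ 2 ≤
        4 * A ^ (1 / 3 : ℝ) * τ ^ 2)
    {a b p : ℝ} (hp : 0 < p) (ha : 0 ≤ a) (hb : p * B + p / 2 ≤ 2 * b)
    (hap : 2 * a + 2 < p * A + p / 2) :
    (∫ x in (-1 : ℝ)..1,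
        |(jacobiP A B n).eval x / (jacobiP A B n).eval 1| ^ p * (1 - x) ^ a * (1 + x) ^ b) ≤
      8 * τ ^ ((2 * a + 2) / (A + 1 / 2)) * ((2 : ℝ) ^ (a + b) / (2 * a + 2) *
        (A ^ (1 / 6 : ℝ) / ((2 : ℝ) ^ ((A + B - 1) / 2) * (jacobiP A B n).eval 1)) ^
          ((2 * a + 2) / (A + 1 / 2)) *
        ((2 * a + 2) / (p * (A + 1 / 2) - 2 * a - 2)) ^
          ((2 * a + 2) / (p * (A + 1 / 2)))) := by
  have hA : 1 ≤ A := hB.trans hBA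
  set P := (jacobiP A B n).eval 1 with hP
  have hP0 : 0 < P := jacobiP_eval_one_pos (by linarith) (by linarith) n
  set q := p * (A + 1 / 2) / 2 with hq
  set e := p * (B + 1 / 2) / 2 with he
  have hq0 : 0 < q := by positivity
  have he0 : 0 < e := by positivity
  have hqa : a + 1 < q := by rw [hq]; linarith
  have heb : e ≤ b := by rw [he]; linarith
  have hb0 : 0 < b := he0.trans_le heb
  set κ := 2 * A ^ (1 / 6 : ℝ) * τ / P with hκ
  have hκ0 : 0 < κ := by positivity
  set y : ℝ → ℝ := fun x => |(jacobiP A B n).eval x / P| with hy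
  have hy0 : ∀ x, 0 ≤ y x := fun x => abs_nonneg _
  have hyc : Continuous y := ((jacobiP A B n).continuous.div_const P).abs
  have hy1 : ∀ x ∈ Set.Icc (-1 : ℝ) 1, y x ≤ 1 := fun x hx =>
    abs_jacobiP_div_le_one (by linarith) hBA n hx
  have hA3 : (A ^ (1 / 6 : ℝ)) ^ 2 = A ^ (1 / 3 : ℝ) := by
    rw [← Real.rpow_natCast, ← Real.rpow_mul (by linarith)]
    norm_num
  have hyκ : ∀ x ∈ Set.Icc (-1 : ℝ) 1, y x ^ p * (1 - x) ^ q * (1 + x) ^ e ≤ κ ^ p := by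
    intro x hx
    have hu : 0 ≤ 1 - x := by linarith [hx.2]
    have hv : 0 ≤ 1 + x := by linarith [hx.1]
    have hsq : ∀ {z d : ℝ}, 0 ≤ z → (z ^ (d / 2)) ^ 2 = z ^ d := by
      intro z d hz
      rw [← Real.rpow_natCast, ← Real.rpow_mul hz]
      congr 1
      push_cast
      ring
    have h1 : (y x * (1 - x) ^ ((A + 1 / 2) / 2) * (1 + x) ^ ((B + 1 / 2) / 2)) ^ 2 ≤ κ ^ 2 := by
      rw [mul_pow, mul_pow, hsq hu, hsq hv, hκ, div_pow, mul_pow, mul_pow, hA3, hy, sq_abs,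
        div_pow, le_div_iff₀ (by positivity)]
      have := hτ x hx
      calc _ = (1 - x) ^ (A + 1 / 2) * (1 + x) ^ (B + 1 / 2) * (jacobiP A B n).eval x ^ 2 := by
            field_simp
        _ ≤ _ := this
        _ = _ := by ring
    have h2 := (pow_le_pow_iff_left₀
      (mul_nonneg (mul_nonneg (hy0 x) (by positivity)) (by positivity)) hκ0.le two_ne_zero).mp h1
    have h3 := Real.rpow_le_rpow
      (mul_nonneg (mul_nonneg (hy0 x) (by positivity)) (by positivity)) h2 hp.le
    rw [Real.mul_rpow (mul_nonneg (hy0 x) (by positivity)) (by positivity),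
      Real.mul_rpow (hy0 x) (by positivity), ← Real.rpow_mul hu, ← Real.rpow_mul hv,
      show (A + 1 / 2) / 2 * p = q by rw [hq]; ring,
      show (B + 1 / 2) / 2 * p = e by rw [he]; ring] at h3
    exact h3
  set Q := κ ^ p * 2 ^ (-e) with hQ
  have hQ0 : 0 < Q := by positivity
  set W : ℝ → ℝ := fun t => 2 ^ (-b) * (y (1 - t) ^ p * t ^ a * (2 - t) ^ b) with hW
  have hWc : Continuous W := by
    have h1 : Continuous fun t => y (1 - t) ^ p :=
      (hyc.comp (by fun_prop)).rpow_const fun _ => Or.inr hp.le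
    have h2 : Continuous fun t : ℝ => t ^ a := Real.continuous_rpow_const ha
    have h3 : Continuous fun t : ℝ => (2 - t) ^ b :=
      Continuous.rpow_const (by fun_prop) fun _ => Or.inr hb0.le
    fun_prop
  have h2b : (2 : ℝ) ^ (-b) * 2 ^ b = 1 := by
    rw [← Real.rpow_add two_pos, neg_add_cancel, Real.rpow_zero]
  have hW1 : ∀ t ∈ Set.Icc (0 : ℝ) 2, W t ≤ t ^ a := by
    intro t ht
    have h1 : y (1 - t) ^ p ≤ 1 := Real.rpow_le_one (hy0 _)
      (hy1 _ ⟨by linarith [ht.2], by linarith [ht.1]⟩) hp.le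
    have h2 : (2 - t) ^ b ≤ 2 ^ b :=
      Real.rpow_le_rpow (by linarith [ht.2]) (by linarith [ht.1]) hb0.le
    have h3 : 0 ≤ t ^ a := Real.rpow_nonneg ht.1 a
    have h4 : 0 ≤ (2 - t) ^ b := Real.rpow_nonneg (by linarith [ht.2]) b
    calc W t ≤ 2 ^ (-b) * (1 * t ^ a * 2 ^ b) := by
          simp only [hW]
          gcongr
      _ = 2 ^ (-b) * 2 ^ b * t ^ a := by ring
      _ = t ^ a := by rw [h2b, one_mul]
  have hW2 : ∀ t ∈ Set.Ioc (0 : ℝ) 2, W t ≤ Q * t ^ (a - q) := by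
    intro t ht
    have h1 := hyκ (1 - t) ⟨by linarith [ht.2], by linarith [ht.1]⟩
    rw [show 1 - (1 - t) = t by ring, show 1 + (1 - t) = 2 - t by ring] at h1
    have hv : 0 ≤ 2 - t := by linarith [ht.2]
    have h2 : (2 - t) ^ b = (2 - t) ^ e * (2 - t) ^ (b - e) := by
      rw [← Real.rpow_add_of_nonneg hv he0.le (by linarith), add_sub_cancel]
    have h3 : t ^ a = t ^ q * t ^ (a - q) := by
      rw [← Real.rpow_add ht.1, add_sub_cancel]
    have h4 : (2 - t) ^ (b - e) ≤ 2 ^ (b - e) :=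
      Real.rpow_le_rpow hv (by linarith [ht.1]) (by linarith)
    have h5 : 0 ≤ t ^ (a - q) := Real.rpow_nonneg ht.1.le _
    have h6 : 0 ≤ (2 - t) ^ (b - e) := Real.rpow_nonneg hv _
    have h7 : (2 : ℝ) ^ (-b) * 2 ^ (b - e) = 2 ^ (-e) := by
      rw [← Real.rpow_add two_pos]
      congr 1
      ring
    calc W t = 2 ^ (-b) * ((y (1 - t) ^ p * t ^ q * (2 - t) ^ e) * t ^ (a - q) *
          (2 - t) ^ (b - e)) := by
          simp only [hW]
          rw [h2, h3]
          ring
      _ ≤ 2 ^ (-b) * (κ ^ p * t ^ (a - q) * 2 ^ (b - e)) := by gcongr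
      _ = κ ^ p * (2 ^ (-b) * 2 ^ (b - e)) * t ^ (a - q) := by ring
      _ = Q * t ^ (a - q) := by rw [h7]
  have hmain := integral_le_of_le_rpow hWc.continuousOn ha hqa hQ0 hW1 hW2
  have hint : (∫ x in (-1 : ℝ)..1, y x ^ p * (1 - x) ^ a * (1 + x) ^ b) =
      2 ^ b * ∫ t in (0 : ℝ)..2, W t := by
    have h1 := intervalIntegral.integral_comp_sub_left (a := 0) (b := 2)
      (fun x => y x ^ p * (1 - x) ^ a * (1 + x) ^ b) (1 : ℝ)
    rw [show (1 : ℝ) - 2 = -1 by norm_num, show (1 : ℝ) - 0 = 1 by norm_num] at h1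
    rw [← h1, ← intervalIntegral.integral_const_mul]
    refine intervalIntegral.integral_congr fun t _ => ?_
    simp only [hW]
    rw [← mul_assoc (2 ^ b), mul_comm (2 ^ b), h2b, one_mul, show 1 - (1 - t) = t by ring,
      show 1 + (1 - t) = 2 - t by ring]
  have hR : (a + 1) / (q - a - 1) = (2 * a + 2) / (p * (A + 1 / 2) - 2 * a - 2) := by
    have h1 : 0 < q - a - 1 := by linarith
    have h2 : p * (A + 1 / 2) - 2 * a - 2 = 2 * (q - a - 1) := by rw [hq]; ring
    rw [h2]
    field_simp
  have hσ : (a + 1) / q = (2 * a + 2) / (p * (A + 1 / 2)) := by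
    rw [hq]
    field_simp
  rw [hR, hσ] at hmain
  set R := (2 * a + 2) / (p * (A + 1 / 2) - 2 * a - 2) with hRdef
  have hR0 : 0 < R := div_pos (by linarith) (by linarith)
  set σ := (2 * a + 2) / (p * (A + 1 / 2)) with hσdef
  set q' := (2 * a + 2) / (A + 1 / 2) with hq'
  have hpσ : p * σ = q' := by rw [hσdef, hq']; field_simp
  set X := A ^ (1 / 6 : ℝ) / ((2 : ℝ) ^ ((A + B - 1) / 2) * P) with hX
  have hX0 : 0 < X := by positivity
  have hQX : Q = (2 ^ ((A + 1 / 2) / 2) * (τ * X)) ^ p := by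
    have h1 : (2 : ℝ) ^ (-e) = (2 ^ (-((B + 1 / 2) / 2))) ^ p := by
      rw [← Real.rpow_mul two_pos.le]
      congr 1
      rw [he]
      ring
    rw [hQ, h1, ← Real.mul_rpow hκ0.le (by positivity)]
    congr 1
    have h2 : (2 : ℝ) * 2 ^ (-((B + 1 / 2) / 2)) * 2 ^ ((A + B - 1) / 2) =
        2 ^ ((A + 1 / 2) / 2) := by
      nth_rewrite 1 [← Real.rpow_one 2]
      rw [← Real.rpow_add two_pos, ← Real.rpow_add two_pos]
      congr 1
      ring
    rw [← h2, hκ, hX]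
    field_simp
  have hQσ : Q ^ σ = 2 ^ (a + 1) * (τ ^ q' * X ^ q') := by
    rw [hQX, ← Real.rpow_mul (by positivity), hpσ, Real.mul_rpow (by positivity) (by positivity),
      Real.mul_rpow hτ0.le hX0.le, ← Real.rpow_mul two_pos.le]
    congr 2
    rw [hq']
    field_simp
  rw [Real.mul_rpow hQ0.le hR0.le, hQσ] at hmain
  rw [hint]
  calc _ ≤ 2 ^ b * (2 / (a + 1) * (2 ^ (a + 1) * (τ ^ q' * X ^ q') * R ^ σ)) := by gcongr
    _ = 8 * τ ^ q' * (2 ^ (a + b) / (2 * a + 2) * X ^ q' * R ^ σ) := by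
      rw [Real.rpow_add_one two_ne_zero a, Real.rpow_add two_pos a b]
      have : a + 1 ≠ 0 := by positivity
      have : 2 * a + 2 = 2 * (a + 1) := by ring
      rw [this]
      field_simp
      norm_num

/-! ### Estimates for the Gamma function -/

theorem log_Gamma_add_one {y : ℝ} (hy : 0 < y) :
    Real.log (Real.Gamma (y + 1)) = Real.log y + Real.log (Real.Gamma y) := by
  rw [Real.Gamma_add_one hy.ne', Real.log_mul hy.ne' (Real.Gamma_pos_of_pos hy).ne']

/-- A consequence of the log-convexity of `Γ`, compared on `[y, y + 1]` and `[y, y + h]`. -/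
theorem rpow_mul_Gamma_le_of_one_le {y h : ℝ} (hy : 0 < y) (hh : 1 ≤ h) :
    y ^ h * Real.Gamma y ≤ Real.Gamma (y + h) := by
  have hG := Real.Gamma_pos_of_pos hy
  have hG' := Real.Gamma_pos_of_pos (show 0 < y + h by linarith)
  have h1 := Real.convexOn_log_Gamma.secant_mono (a := y) (x := y + 1) (y := y + h) hy
    (by simp only [Set.mem_Ioi]; linarith) (by simp only [Set.mem_Ioi]; linarith)
    (by linarith) (by linarith) (by linarith)
  simp only [Function.comp_apply, add_sub_cancel_left, div_one] at h1
  rw [log_Gamma_add_one hy, le_div_iff₀ (by linarith)] at h1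
  rw [← Real.log_le_log_iff (by positivity) hG', Real.log_mul (by positivity) hG.ne',
    Real.log_rpow hy]
  linarith

theorem Gamma_add_le_rpow_mul {y h : ℝ} (hy : 0 < y) (hh : 0 < h) :
    Real.Gamma (y + h) ≤ (y + h) ^ h * Real.Gamma y := by
  have hyh : 0 < y + h := by linarith
  have hG := Real.Gamma_pos_of_pos hy
  have hG' := Real.Gamma_pos_of_pos hyh
  have h1 := Real.convexOn_log_Gamma.secant_mono (a := y + h) (x := y) (y := y + h + 1) hyh
    hy (by simp only [Set.mem_Ioi]; linarith) (by linarith) (by linarith) (by linarith)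
  simp only [Function.comp_apply, add_sub_cancel_left, div_one] at h1
  rw [log_Gamma_add_one hyh, show y - (y + h) = -h by ring, div_neg, ← neg_div, neg_sub,
    div_le_iff₀ hh] at h1
  rw [← Real.log_le_log_iff hG' (by positivity), Real.log_mul (by positivity) hG.ne',
    Real.log_rpow hyh]
  linarith

theorem rpow_mul_Gamma_add_one_le {y h : ℝ} (hy : 0 < y) (hh : 0 ≤ h) :
    y ^ h * Real.Gamma (y + 1) ≤ Real.Gamma (y + 1 + h) := by
  rcases hh.eq_or_lt with rfl | hh
  · simp
  have hG := Real.Gamma_pos_of_pos (show 0 < y + 1 by linarith)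
  have hG' := Real.Gamma_pos_of_pos (show 0 < y + 1 + h by linarith)
  have h1 := Real.convexOn_log_Gamma.secant_mono (a := y + 1) (x := y) (y := y + 1 + h)
    (by simp only [Set.mem_Ioi]; linarith) hy (by simp only [Set.mem_Ioi]; linarith)
    (by linarith) (by linarith) (by linarith)
  simp only [Function.comp_apply, add_sub_cancel_left] at h1
  rw [show y - (y + 1) = -1 by ring, div_neg, div_one, neg_sub, le_div_iff₀ hh] at h1
  have h2 := log_Gamma_add_one hy
  rw [← Real.log_le_log_iff (by positivity) hG', Real.log_mul (by positivity) hG.ne',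
    Real.log_rpow hy]
  nlinarith

theorem one_add_rpow_le_exp {x w : ℝ} (hx : 0 ≤ x) (hw : 0 ≤ w) :
    (1 + x) ^ w ≤ Real.exp (x * w) := by
  rw [Real.exp_mul]
  exact Real.rpow_le_rpow (by linarith) (by linarith [Real.add_one_le_exp x]) hw

/-- A lower bound of Stirling type for the Gamma function, with the correct power but not the sharp
constant. -/
theorem le_Gamma_add_one {x : ℝ} (hx : 1 ≤ x) :
    Real.exp (-(5 / 2)) * (x ^ (x + 1 / 2) * Real.exp (-x)) ≤ Real.Gamma (x + 1) := by
  obtain ⟨k, hk⟩ : ∃ k : ℕ, k = ⌊x⌋₊ := ⟨_, rfl⟩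
  have hkx : (k : ℝ) ≤ x := hk ▸ Nat.floor_le (by linarith)
  have hxk : x < k + 1 := hk ▸ Nat.lt_floor_add_one x
  have hk1 : (1 : ℝ) ≤ k := by
    have : 1 ≤ k := by
      rw [hk]
      exact Nat.le_floor (by simpa using hx)
    exact_mod_cast this
  have hk0 : (0 : ℝ) < k := by linarith
  have h1 := rpow_mul_Gamma_add_one_le hk0 (show 0 ≤ x - k by linarith)
  rw [show (k : ℝ) + 1 + (x - k) = x + 1 by ring, Real.Gamma_nat_eq_factorial] at h1
  have h2 := Stirling.le_factorial_stirling k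
  have h3 : (k : ℝ) ^ (1 / 2 : ℝ) ≤ Real.sqrt (2 * Real.pi * k) := by
    rw [← Real.sqrt_eq_rpow]
    apply Real.sqrt_le_sqrt
    nlinarith [Real.pi_gt_three]
  have h4 : ((k : ℝ) / Real.exp 1) ^ k = (k : ℝ) ^ (k : ℝ) * Real.exp (-k) := by
    rw [div_pow, ← Real.exp_nat_mul, mul_one, Real.exp_neg, Real.rpow_natCast]
    rfl
  rw [h4] at h2
  have h5 : x ^ (x + 1 / 2) ≤ Real.exp (5 / 2) * (k : ℝ) ^ (x + 1 / 2) := by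
    have e1 : x ≤ (1 + 1 / (k : ℝ)) * k := by
      rw [add_mul, one_mul, one_div_mul_cancel hk0.ne']
      linarith
    calc x ^ (x + 1 / 2) ≤ ((1 + 1 / (k : ℝ)) * k) ^ (x + 1 / 2) :=
          Real.rpow_le_rpow (by linarith) e1 (by linarith)
      _ = (1 + 1 / (k : ℝ)) ^ (x + 1 / 2) * k ^ (x + 1 / 2) :=
          Real.mul_rpow (by positivity) hk0.le
      _ ≤ Real.exp (5 / 2) * k ^ (x + 1 / 2) := by
          gcongr
          refine (one_add_rpow_le_exp (by positivity) (by linarith)).trans ?_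
          apply Real.exp_le_exp.mpr
          rw [one_div_mul_eq_div, div_le_iff₀ hk0]
          linarith
  have h6 : Real.exp (-x) ≤ Real.exp (-k) := Real.exp_le_exp.mpr (by linarith)
  have h7 : (k : ℝ) ^ (x + 1 / 2) =
      (k : ℝ) ^ (x - k) * ((k : ℝ) ^ (1 / 2 : ℝ) * (k : ℝ) ^ (k : ℝ)) := by
    rw [← Real.rpow_add hk0, ← Real.rpow_add hk0]
    congr 1
    ring
  calc _ ≤ Real.exp (-(5 / 2)) * (Real.exp (5 / 2) * (k : ℝ) ^ (x + 1 / 2) * Real.exp (-k)) := by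
        gcongr
    _ = (k : ℝ) ^ (x + 1 / 2) * Real.exp (-k) := by
        have : Real.exp (-(5 / 2)) * Real.exp (5 / 2) = 1 := by
          rw [← Real.exp_add, neg_add_cancel, Real.exp_zero]
        linear_combination ((k : ℝ) ^ (x + 1 / 2) * Real.exp (-k)) * this
    _ = (k : ℝ) ^ (x - k) * ((k : ℝ) ^ (1 / 2 : ℝ) * ((k : ℝ) ^ (k : ℝ) * Real.exp (-k))) := by
        rw [h7]
        ring
    _ ≤ (k : ℝ) ^ (x - k) * (Real.sqrt (2 * Real.pi * k) *
          ((k : ℝ) ^ (k : ℝ) * Real.exp (-k))) := by gcongr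
    _ ≤ (k : ℝ) ^ (x - k) * (k.factorial : ℝ) := by gcongr
    _ ≤ _ := h1

/-! ### Values at the endpoint and the Christoffel function -/

theorem descPochhammer_eval_natCast_add_mul_Gamma {A : ℝ} (hA : 0 ≤ A) (n : ℕ) :
    (descPochhammer ℝ n).eval (n + A) * Real.Gamma (A + 1) = Real.Gamma (n + A + 1) := by
  induction n with
  | zero => simp
  | succ n ih =>
    rw [descPochhammer_succ_left, Polynomial.eval_mul, Polynomial.eval_X, Polynomial.eval_comp]
    simp only [Polynomial.eval_sub, Polynomial.eval_X, Polynomial.eval_one]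
    push_cast
    rw [show (n : ℝ) + 1 + A - 1 = n + A by ring, mul_assoc, ih,
      show (n : ℝ) + 1 + A + 1 = n + A + 1 + 1 by ring,
      Real.Gamma_add_one (show (n : ℝ) + A + 1 ≠ 0 by positivity)]
    ring

theorem jacobiP_eval_one_sq {A B : ℝ} (hA : 0 ≤ A) (hB : 0 ≤ B) (n : ℕ) :
    (jacobiP A B n).eval 1 ^ 2 = (2 * n + A + B + 1) / 2 ^ (A + B + 1) *
      (Real.Gamma (n + A + B + 1) * Real.Gamma (n + A + 1) /
        (Real.Gamma (n + 1) * Real.Gamma (n + B + 1) * Real.Gamma (A + 1) ^ 2)) := by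
  have h1 := Real.Gamma_pos_of_pos (show (0 : ℝ) < n + 1 by positivity)
  have h3 := Real.Gamma_pos_of_pos (show (0 : ℝ) < n + A + 1 by positivity)
  have h4 := Real.Gamma_pos_of_pos (show (0 : ℝ) < n + B + 1 by positivity)
  have h5 := Real.Gamma_pos_of_pos (show (0 : ℝ) < A + 1 by positivity)
  rw [jacobiP_eq, Polynomial.eval_C_mul, mul_pow, Real.sq_sqrt (jacobiNormSq_pos hA hB n).le,
    jacobiPoly_eval_one, jacobiNormSq, ← Real.Gamma_nat_eq_factorial]
  have h := descPochhammer_eval_natCast_add_mul_Gamma hA n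
  rw [← eq_div_iff h5.ne'] at h
  rw [h]
  have : (2 : ℝ) ^ (A + B + 1) ≠ 0 := by positivity
  field_simp

/-- A lower bound for the value at `1` of the orthonormal Jacobi polynomial. -/
theorem le_jacobiP_eval_one {A B : ℝ} (hA : 1 ≤ A) (hB : 0 ≤ B) {n : ℕ} (hn : 1 ≤ n) :
    (n : ℝ) ^ (A + 1 / 2) / (2 ^ ((A + B) / 2) * Real.Gamma (A + 1)) ≤
      (jacobiP A B n).eval 1 := by
  have hn0 : (0 : ℝ) < n := by exact_mod_cast hn
  have h1 := Real.Gamma_pos_of_pos (show (0 : ℝ) < n + 1 by positivity)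
  have h3 := Real.Gamma_pos_of_pos (show (0 : ℝ) < n + A + 1 by positivity)
  have h4 := Real.Gamma_pos_of_pos (show (0 : ℝ) < n + B + 1 by positivity)
  have h5 := Real.Gamma_pos_of_pos (show (0 : ℝ) < A + 1 by positivity)
  refine (pow_le_pow_iff_left₀ (by positivity)
    (jacobiP_eval_one_pos (by linarith) hB n).le two_ne_zero).mp ?_
  have k : ∀ {y : ℝ}, (n : ℝ) ≤ y → (n : ℝ) ^ A * Real.Gamma y ≤ Real.Gamma (y + A) := by
    intro y hy
    have hG := Real.Gamma_pos_of_pos (hn0.trans_le hy)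
    refine le_trans ?_ (rpow_mul_Gamma_le_of_one_le (hn0.trans_le hy) hA)
    gcongr
  have k1 := k (show (n : ℝ) ≤ n + 1 by linarith)
  have k2 := k (show (n : ℝ) ≤ n + B + 1 by linarith)
  rw [show (n : ℝ) + 1 + A = n + A + 1 by ring] at k1
  rw [show (n : ℝ) + B + 1 + A = n + A + B + 1 by ring] at k2
  rw [jacobiP_eval_one_sq (by linarith) hB, div_pow, mul_pow]
  have e1 : ((n : ℝ) ^ (A + 1 / 2)) ^ 2 = n * ((n : ℝ) ^ A * (n : ℝ) ^ A) := by
    rw [← Real.rpow_natCast, ← Real.rpow_mul hn0.le, ← Real.rpow_add hn0]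
    nth_rewrite 2 [← Real.rpow_one (n : ℝ)]
    rw [← Real.rpow_add hn0]
    congr 1
    push_cast
    ring
  have e2 : ((2 : ℝ) ^ ((A + B) / 2)) ^ 2 = 2 ^ (A + B) := by
    rw [← Real.rpow_natCast, ← Real.rpow_mul two_pos.le]
    congr 1
    push_cast
    ring
  rw [e1, e2, Real.rpow_add_one two_ne_zero (A + B)]
  calc (n : ℝ) * ((n : ℝ) ^ A * (n : ℝ) ^ A) / (2 ^ (A + B) * Real.Gamma (A + 1) ^ 2) =
        2 * n / (2 ^ (A + B) * 2) * (((n : ℝ) ^ A * Real.Gamma (n + B + 1)) *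
          ((n : ℝ) ^ A * Real.Gamma (n + 1)) /
          (Real.Gamma (n + 1) * Real.Gamma (n + B + 1) * Real.Gamma (A + 1) ^ 2)) := by
        field_simp
    _ ≤ _ := by
        gcongr
        linarith

/-- The closed form of the Jacobi kernel on the diagonal at `1`. -/
theorem jacobiK_one {α β : ℝ} (hα : 0 ≤ α) (hβ : 0 ≤ β) (m : ℕ) :
    jacobiK α β m 1 = m * (m + β) / 2 ^ (α + β + 1) *
      (Real.Gamma (m + α + β + 1) * Real.Gamma (m + α + 1) /
        (Real.Gamma (m + 1) * Real.Gamma (m + β + 1) *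
          (Real.Gamma (α + 1) * Real.Gamma (α + 2)))) := by
  induction m with
  | zero => simp [jacobiK]
  | succ m ih =>
    rw [jacobiK, Finset.sum_range_succ, ← jacobiK, ih, ← sq, jacobiP_eval_one_sq hα hβ]
    have h1 := Real.Gamma_pos_of_pos (show (0 : ℝ) < m + 1 by positivity)
    have h4 := Real.Gamma_pos_of_pos (show (0 : ℝ) < m + β + 1 by positivity)
    have h5 := Real.Gamma_pos_of_pos (show (0 : ℝ) < α + 1 by positivity)
    have g1 := Real.Gamma_add_one (show (m : ℝ) + 1 ≠ 0 by positivity)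
    have g2 := Real.Gamma_add_one (show (m : ℝ) + β + 1 ≠ 0 by positivity)
    have g3 := Real.Gamma_add_one (show (m : ℝ) + α + 1 ≠ 0 by positivity)
    have g4 := Real.Gamma_add_one (show (m : ℝ) + α + β + 1 ≠ 0 by positivity)
    have g5 := Real.Gamma_add_one (show α + 1 ≠ 0 by positivity)
    rw [show α + 1 + 1 = α + 2 by ring] at g5
    push_cast
    rw [show (m : ℝ) + 1 + α + β + 1 = m + α + β + 1 + 1 by ring,
      show (m : ℝ) + 1 + α + 1 = m + α + 1 + 1 by ring,
      show (m : ℝ) + 1 + β + 1 = m + β + 1 + 1 by ring, g1, g2, g3, g4, g5]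
    have : (2 : ℝ) ^ (α + β + 1) ≠ 0 := by positivity
    have : (m : ℝ) + 1 ≠ 0 := by positivity
    have : (m : ℝ) + β + 1 ≠ 0 := by positivity
    field_simp
    ring

/-- An upper bound for the kernel: for `m ≥ (α + β)²` the ratios of Gamma functions in `jacobiK_one`
exceed the powers of `m` by a bounded factor only. -/
theorem jacobiK_one_le {α β : ℝ} (hβ : 2 ≤ β) (hβα : β ≤ α) {m : ℕ} (hm : (α + β) ^ 2 ≤ m) :
    jacobiK α β m 1 ≤ Real.exp 2 * ((m : ℝ) ^ (2 * α + 2) /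
      (2 ^ (α + β + 1) * (Real.Gamma (α + 1) * Real.Gamma (α + 2)))) := by
  have hm0 : (0 : ℝ) < m := by nlinarith
  have h4 := Real.Gamma_pos_of_pos (show (0 : ℝ) < m + β by positivity)
  have h1 := Real.Gamma_pos_of_pos hm0
  have h5 := Real.Gamma_pos_of_pos (show (0 : ℝ) < α + 1 by linarith)
  have h6 := Real.Gamma_pos_of_pos (show (0 : ℝ) < α + 2 by linarith)
  have g1 := Real.Gamma_add_one hm0.ne'
  have g2 := Real.Gamma_add_one (show (m : ℝ) + β ≠ 0 by positivity)
  have k1 := Gamma_add_le_rpow_mul (y := m) (h := α + 1) hm0 (by linarith)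
  have k2 := Gamma_add_le_rpow_mul (y := m + β) (h := α + 1) (by linarith) (by linarith)
  rw [show (m : ℝ) + (α + 1) = m + α + 1 by ring] at k1
  rw [show (m : ℝ) + β + (α + 1) = m + α + β + 1 by ring] at k2
  have k3 : ∀ {y : ℝ}, 0 ≤ y → y ≤ m + α + β + 1 →
      y ^ (α + 1) ≤ (m : ℝ) ^ (α + 1) * Real.exp 1 := by
    intro y hy0 hy
    have e1 : y ≤ m * (1 + (α + β + 1) / m) := by
      rw [mul_add, mul_one, mul_div_cancel₀ _ hm0.ne']
      linarith
    have e0 : 0 ≤ (α + β + 1) / m := div_nonneg (by linarith) hm0.le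
    calc y ^ (α + 1) ≤ (m * (1 + (α + β + 1) / m)) ^ (α + 1) :=
          Real.rpow_le_rpow hy0 e1 (by linarith)
      _ = (m : ℝ) ^ (α + 1) * (1 + (α + β + 1) / m) ^ (α + 1) :=
          Real.mul_rpow hm0.le (by linarith)
      _ ≤ (m : ℝ) ^ (α + 1) * Real.exp 1 := by
          gcongr
          refine (one_add_rpow_le_exp e0 (by linarith)).trans (Real.exp_le_exp.mpr ?_)
          rw [div_mul_eq_mul_div, div_le_one hm0]
          nlinarith
  have k4 := k3 (show (0 : ℝ) ≤ m + α + 1 by linarith) (by linarith)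
  have k5 := k3 (show (0 : ℝ) ≤ m + α + β + 1 by linarith) le_rfl
  have e2 : (m : ℝ) ^ (2 * α + 2) = (m : ℝ) ^ (α + 1) * (m : ℝ) ^ (α + 1) := by
    rw [← Real.rpow_add hm0]
    congr 1
    ring
  have e3 : Real.exp 2 = Real.exp 1 * Real.exp 1 := by
    rw [← Real.exp_add]
    norm_num
  rw [jacobiK_one (by linarith) (by linarith), g1, show (m : ℝ) + β + 1 = m + β + 1 from rfl, g2,
    e2, e3]
  have hmul : Real.Gamma (m + α + β + 1) * Real.Gamma (m + α + 1) ≤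
      ((m : ℝ) ^ (α + 1) * Real.exp 1 * Real.Gamma (m + β)) *
        ((m : ℝ) ^ (α + 1) * Real.exp 1 * Real.Gamma m) := by
    have h7 := Real.Gamma_pos_of_pos (show (0 : ℝ) < m + α + 1 by linarith)
    refine mul_le_mul (k2.trans ?_) (k1.trans ?_) h7.le (by positivity) <;> gcongr
  calc _ ≤ m * (m + β) / 2 ^ (α + β + 1) *
        (((m : ℝ) ^ (α + 1) * Real.exp 1 * Real.Gamma (m + β)) *
          ((m : ℝ) ^ (α + 1) * Real.exp 1 * Real.Gamma m) /
        (m * Real.Gamma m * ((m + β) * Real.Gamma (m + β)) *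
          (Real.Gamma (α + 1) * Real.Gamma (α + 2)))) := by
        gcongr
    _ = _ := by
        have : (m : ℝ) + β ≠ 0 := by positivity
        field_simp

/-! ### The three integral estimates -/

/-- The weighted `L^p` bound with an absolute constant, for degrees large compared with the
parameters. -/
theorem integral_jacobiP_rpow_le_of_le {a b A B p : ℝ} {n : ℕ} (hab : b ≤ a) (hb0 : 0 ≤ b)
    (hBA : B ≤ A) (hB : 1 ≤ B) (hp : 0 < p) (hb : p * B + p / 2 ≤ 2 * b)
    (hap : 2 * a + 2 < p * A + p / 2)
    (hn : 4096 * (A * ((2 * a + 2) / (p * (A + 1 / 2) - 2 * a - 2)) ^ (1 / p)) ≤ n) :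
    (∫ x in (-1 : ℝ)..1,
        |(jacobiP A B n).eval x / (jacobiP A B n).eval 1| ^ p * (1 - x) ^ a * (1 + x) ^ b) ≤
      24 * ((2 : ℝ) ^ (a + b) / (2 * a + 2) *
        (A ^ (1 / 6 : ℝ) / ((2 : ℝ) ^ ((A + B - 1) / 2) * (jacobiP A B n).eval 1)) ^
          ((2 * a + 2) / (A + 1 / 2)) *
        ((2 * a + 2) / (p * (A + 1 / 2) - 2 * a - 2)) ^
          ((2 * a + 2) / (p * (A + 1 / 2)))) := by
  have hA : 1 ≤ A := hB.trans hBA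
  have ha : 0 ≤ a := hb0.trans hab
  have hd : 0 < p * (A + 1 / 2) - 2 * a - 2 := by linarith
  set R := (2 * a + 2) / (p * (A + 1 / 2) - 2 * a - 2) with hR
  have hR0 : 0 < R := by positivity
  have hP0 := jacobiP_eval_one_pos (A := A) (B := B) (by linarith) (by linarith) n
  have hn0 : (0 : ℝ) < n := lt_of_lt_of_le (by positivity) hn
  suffices h : ∃ τ : ℝ, 0 < τ ∧ τ ^ ((2 * a + 2) / (A + 1 / 2)) ≤ 3 ∧
      ∀ x ∈ Set.Icc (-1 : ℝ) 1,
        (1 - x) ^ (A + 1 / 2) * (1 + x) ^ (B + 1 / 2) * (jacobiP A B n).eval x ^ 2 ≤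
          4 * A ^ (1 / 3 : ℝ) * τ ^ 2 by
    obtain ⟨τ, hτ0, hτ3, hτ⟩ := h
    refine (integral_jacobiP_rpow_le hB hBA hτ0 hτ hp ha hb hap).trans ?_
    gcongr
    linarith
  rcases le_total (15 * A) n with h15 | h15
  · refine ⟨1, one_pos, by rw [Real.one_rpow]; norm_num, fun x hx => ?_⟩
    rw [one_pow, mul_one]
    exact jacobiP_sq_le_of_large hA hB hBA h15 hx
  -- The hypothesis on `n` forces `R < 1` here and bounds `√(A / n)` by a power of `1 / R`.
  · set ρ := R ^ (1 / p) with hρ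
    have hρ0 : 0 < ρ := by positivity
    have hρ1 : ρ < 1 := by nlinarith
    have hR1 : R < 1 := by
      by_contra! h
      exact absurd (Real.one_le_rpow h (by positivity : 0 ≤ 1 / p)) (not_le.mpr hρ1)
    refine ⟨R ^ (-(1 / (4 * p))), by positivity, ?_, fun x hx => ?_⟩
    · -- The exponent of `1 / R` is `R / (4 (1 + R))`, and `R log (1 / R) ≤ 1`.
      rw [← Real.rpow_mul hR0.le, Real.rpow_def_of_pos hR0]
      refine (Real.exp_le_exp.mpr (?_ : _ ≤ (1 : ℝ))).trans (by
        have := Real.exp_one_lt_d9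
        linarith)
      have e1 : Real.log R * (-(1 / (4 * p)) * ((2 * a + 2) / (A + 1 / 2))) =
          -Real.log R * R / (4 * (1 + R)) := by
        have h1 : 2 * a + 2 = R * (p * (A + 1 / 2) - 2 * a - 2) := by
          rw [hR, div_mul_cancel₀ _ hd.ne']
        have h2 : p * (A + 1 / 2) * R = (2 * a + 2) * (1 + R) := by linarith
        have h3 : (2 * a + 2) / (A + 1 / 2) = p * R / (1 + R) := by
          rw [div_eq_div_iff (by positivity) (by positivity)]
          linarith
        rw [h3]
        field_simp
      have e2 : -Real.log R ≤ R⁻¹ := by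
        rw [← Real.log_inv]
        have := Real.log_le_sub_one_of_pos (inv_pos.mpr hR0)
        linarith
      have e3 : -Real.log R * R ≤ 1 := by
        calc -Real.log R * R ≤ R⁻¹ * R := by gcongr
          _ = 1 := inv_mul_cancel₀ hR0.ne'
      rw [e1, div_le_one (by positivity)]
      linarith
    · refine (jacobiP_sq_le_of_small hA hB hBA (by exact_mod_cast hn0) h15 hx).trans ?_
      have e1 : (R ^ (-(1 / (4 * p)))) ^ 2 = Real.sqrt ρ⁻¹ := by
        rw [hρ, Real.sqrt_eq_rpow, ← Real.rpow_neg hR0.le, ← Real.rpow_mul hR0.le,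
          ← Real.rpow_natCast, ← Real.rpow_mul hR0.le]
        congr 1
        push_cast
        field_simp
        norm_num
      have e2 : Real.sqrt (A / n) ≤ Real.sqrt ρ⁻¹ / 64 := by
        have : Real.sqrt ρ⁻¹ / 64 = Real.sqrt (ρ⁻¹ / 4096) := by
          rw [Real.sqrt_div' _ (by norm_num), show (4096 : ℝ) = 64 ^ 2 by norm_num,
            Real.sqrt_sq (by norm_num)]
        rw [this]
        apply Real.sqrt_le_sqrt
        rw [div_le_iff₀ hn0, inv_div_left, ← div_eq_inv_mul, le_div_iff₀ (by positivity)]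
        linarith
      rw [e1]
      calc 256 * Real.sqrt (A / n) * A ^ (1 / 3 : ℝ) ≤
            256 * (Real.sqrt ρ⁻¹ / 64) * A ^ (1 / 3 : ℝ) := by gcongr
        _ = _ := by ring

/-- The weighted `L²` bound in terms of the degree; the value of the polynomial at `1` is bounded
below by `le_jacobiP_eval_one`. -/
theorem integral_jacobiP_sq_le {α β r s : ℝ} {n : ℕ} (hβα : β ≤ α) (hβ : 2 ≤ β) (hsr : s ≤ r)
    (hs : -1 < s) (hn : (2 * α + r + 1) ^ 2 ≤ n) :
    (∫ x in (-1 : ℝ)..1,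
        |(jacobiP (α + r + 1) (β - 1) n).eval x / (jacobiP (α + r + 1) (β - 1) n).eval 1| ^ 2 *
          (1 - x) ^ (s + α) * (1 + x) ^ β) ≤
      1024 * ((2 : ℝ) ^ (α + β + s) * (α + r + 1) ^ (1 / 3 : ℝ) *
        Real.Gamma (α + r + 2) ^ ((4 * α + 4 * s + 4) / (2 * α + 2 * r + 3)) *
        (n : ℝ) ^ (-2 * α - 2 * s - 2)) := by
  obtain ⟨A, hAdef⟩ : ∃ A, A = α + r + 1 := ⟨_, rfl⟩
  obtain ⟨B, hBdef⟩ : ∃ B, B = β - 1 := ⟨_, rfl⟩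
  rw [← hAdef, ← hBdef, show α + r + 2 = A + 1 by rw [hAdef]; ring]
  have hB : 1 ≤ B := by linarith
  have hBA : B ≤ A := by linarith
  have hA : 1 ≤ A := by linarith
  have hAn : A ≤ n := by nlinarith
  have hn0 : (0 : ℝ) < n := by linarith
  have hn1 : 1 ≤ n := by exact_mod_cast hn0
  have hτ : ∀ x ∈ Set.Icc (-1 : ℝ) 1,
      (1 - x) ^ (A + 1 / 2) * (1 + x) ^ (B + 1 / 2) * (jacobiP A B n).eval x ^ 2 ≤
        4 * A ^ (1 / 3 : ℝ) * 8 ^ 2 := by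
    intro x hx
    have hA3 : (0 : ℝ) ≤ A ^ (1 / 3 : ℝ) := by positivity
    rcases le_total (15 * A) n with h | h
    · refine (jacobiP_sq_le_of_large hA hB hBA h hx).trans ?_
      linarith
    · refine (jacobiP_sq_le_of_small hA hB hBA hn1 h hx).trans ?_
      have : Real.sqrt (A / n) ≤ 1 := Real.sqrt_le_one.mpr ((div_le_one hn0).mpr hAn)
      nlinarith
  have key := integral_jacobiP_rpow_le hB hBA (by norm_num : (0 : ℝ) < 8) hτ (a := s + α) (b := β)
    (p := 2) two_pos (by linarith) (by linarith) (by linarith)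
  simp only [Real.rpow_two] at key
  refine key.trans ?_
  obtain ⟨q, hq⟩ : ∃ q, q = (2 * (s + α) + 2) / (A + 1 / 2) := ⟨_, rfl⟩
  have hA2 : 0 < A + 1 / 2 := by linarith
  have hqA : q * (A + 1 / 2) = 2 * (s + α) + 2 := by rw [hq, div_mul_cancel₀ _ hA2.ne']
  have hq0 : 0 ≤ q := by rw [hq]; exact div_nonneg (by linarith) hA2.le
  have hq2 : q ≤ 2 := by rw [hq, div_le_iff₀ hA2]; linarith
  have hG := Real.Gamma_pos_of_pos (show (0 : ℝ) < A + 1 by linarith)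
  have hP0 := jacobiP_eval_one_pos (A := A) (B := B) (by linarith) (by linarith) n
  rw [show (4 * α + 4 * s + 4) / (2 * α + 2 * r + 3) = q by
      rw [hq, div_eq_div_iff (by linarith) hA2.ne', hAdef]; ring,
    show (2 * (s + α) + 2) / (2 * (A + 1 / 2)) = q / 2 by rw [hq]; field_simp, ← hq]
  have hd1 : 1 ≤ 2 * (A + 1 / 2) - 2 * (s + α) - 2 := by linarith
  have h8 : (8 : ℝ) ^ q ≤ 64 := by
    calc (8 : ℝ) ^ q ≤ 8 ^ (2 : ℝ) := Real.rpow_le_rpow_of_exponent_le (by norm_num) hq2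
      _ = 64 := by norm_num
  have hR : ((2 * (s + α) + 2) / (2 * (A + 1 / 2) - 2 * (s + α) - 2)) ^ (q / 2) ≤
      2 * (s + α) + 2 := by
    have h1 : 1 ≤ 2 * (s + α) + 2 := by linarith
    calc _ ≤ (2 * (s + α) + 2) ^ (q / 2) := by
          refine Real.rpow_le_rpow (div_nonneg (by linarith) (by linarith)) ?_ (by linarith)
          exact div_le_self (by linarith) hd1
      _ ≤ (2 * (s + α) + 2) ^ (1 : ℝ) := Real.rpow_le_rpow_of_exponent_le h1 (by linarith)
      _ = _ := Real.rpow_one _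
  have hX : (A ^ (1 / 6 : ℝ) / ((2 : ℝ) ^ ((A + B - 1) / 2) * (jacobiP A B n).eval 1)) ^ q ≤
      2 * (A ^ (1 / 3 : ℝ) * Real.Gamma (A + 1) ^ q * (n : ℝ) ^ (-2 * α - 2 * s - 2)) := by
    have h1 : A ^ (1 / 6 : ℝ) / ((2 : ℝ) ^ ((A + B - 1) / 2) * (jacobiP A B n).eval 1) ≤
        (2 : ℝ) ^ (1 / 2 : ℝ) * A ^ (1 / 6 : ℝ) * Real.Gamma (A + 1) *
          (n : ℝ) ^ (-(A + 1 / 2)) := by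
      have e1 : (2 : ℝ) ^ ((A + B) / 2) = 2 ^ ((A + B - 1) / 2) * 2 ^ (1 / 2 : ℝ) := by
        rw [← Real.rpow_add two_pos]
        congr 1
        ring
      have h2 := le_jacobiP_eval_one hA (by linarith : 0 ≤ B) hn1
      rw [e1, div_le_iff₀ (by positivity)] at h2
      rw [Real.rpow_neg hn0.le, div_le_iff₀ (by positivity)]
      have h3 : 0 < (n : ℝ) ^ (A + 1 / 2) := by positivity
      calc A ^ (1 / 6 : ℝ) = A ^ (1 / 6 : ℝ) * ((n : ℝ) ^ (A + 1 / 2))⁻¹ *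
            (n : ℝ) ^ (A + 1 / 2) := by field_simp
        _ ≤ A ^ (1 / 6 : ℝ) * ((n : ℝ) ^ (A + 1 / 2))⁻¹ * ((jacobiP A B n).eval 1 *
            (2 ^ ((A + B - 1) / 2) * 2 ^ (1 / 2 : ℝ) * Real.Gamma (A + 1))) := by gcongr
        _ = _ := by ring
    calc _ ≤ ((2 : ℝ) ^ (1 / 2 : ℝ) * A ^ (1 / 6 : ℝ) * Real.Gamma (A + 1) *
          (n : ℝ) ^ (-(A + 1 / 2))) ^ q := Real.rpow_le_rpow (by positivity) h1 hq0
      _ = (2 : ℝ) ^ (1 / 2 * q) * A ^ (1 / 6 * q) * Real.Gamma (A + 1) ^ q *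
          (n : ℝ) ^ (-2 * α - 2 * s - 2) := by
        rw [Real.mul_rpow (by positivity) (by positivity),
          Real.mul_rpow (by positivity) hG.le, Real.mul_rpow (by positivity) (by positivity),
          ← Real.rpow_mul two_pos.le, ← Real.rpow_mul (by linarith), ← Real.rpow_mul hn0.le,
          show -(A + 1 / 2) * q = -2 * α - 2 * s - 2 by linarith]
      _ ≤ (2 : ℝ) ^ (1 : ℝ) * A ^ (1 / 3 : ℝ) * Real.Gamma (A + 1) ^ q *
          (n : ℝ) ^ (-2 * α - 2 * s - 2) := by
        gcongr
        · norm_num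
        · linarith
        · linarith
      _ = _ := by rw [Real.rpow_one]; ring
  have ha0 : 0 < 2 * (s + α) + 2 := by linarith
  calc _ ≤ 8 * 64 * ((2 : ℝ) ^ (s + α + β) / (2 * (s + α) + 2) *
        (2 * (A ^ (1 / 3 : ℝ) * Real.Gamma (A + 1) ^ q * (n : ℝ) ^ (-2 * α - 2 * s - 2))) *
        (2 * (s + α) + 2)) := by
        have : 0 ≤ 2 * (A + 1 / 2) - 2 * (s + α) - 2 := by linarith
        gcongr
    _ = _ := by
        rw [show s + α + β = α + β + s by ring]
        generalize 2 * (s + α) + 2 = c at ha0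
        field_simp
        ring

/-- Stirling's lower bound for `Γ (A + 1)` in the form needed to trade the exponent
`2 - (2 t + 1) / (A + 1 / 2)` of `Γ (A + 1)` for `2`. -/
theorem rpow_mul_Gamma_rpow_le {A t : ℝ} (hA : 1 ≤ A) (ht : 0 ≤ t) (htA : t ≤ A) :
    A ^ (1 / 3 : ℝ) * Real.Gamma (A + 1) ^ (2 - (2 * t + 1) / (A + 1 / 2)) ≤
      Real.exp 9 * (Real.exp (2 * t) * Real.Gamma (A + 1) ^ 2 * (A + 1) ^ (-2 * t - 2 / 3)) := by
  have hA0 : 0 < A := by linarith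
  have hG := Real.Gamma_pos_of_pos (show (0 : ℝ) < A + 1 by linarith)
  have hA2 : 0 < A + 1 / 2 := by linarith
  obtain ⟨v, hv⟩ : ∃ v, v = (2 * t + 1) / (A + 1 / 2) := ⟨_, rfl⟩
  have hvA : (A + 1 / 2) * v = 2 * t + 1 := by rw [hv, mul_div_cancel₀ _ hA2.ne']
  have hv0 : 0 ≤ v := by rw [hv]; positivity
  have hv2 : v ≤ 2 := by rw [hv, div_le_iff₀ hA2]; linarith
  rw [← hv]
  have h1 : Real.exp (-(2 * t + 6)) * A ^ (2 * t + 1) ≤ Real.Gamma (A + 1) ^ v := by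
    calc Real.exp (-(2 * t + 6)) * A ^ (2 * t + 1) ≤
          Real.exp (-(5 / 2) * v) * (A ^ (2 * t + 1) * Real.exp (-A * v)) := by
          rw [mul_left_comm, ← Real.exp_add, mul_comm]
          gcongr
          nlinarith
      _ = (Real.exp (-(5 / 2)) * (A ^ (A + 1 / 2) * Real.exp (-A))) ^ v := by
          rw [Real.mul_rpow (Real.exp_pos _).le (by positivity),
            Real.mul_rpow (by positivity) (Real.exp_pos _).le, ← Real.rpow_mul hA0.le, hvA,
            ← Real.exp_mul, ← Real.exp_mul]
      _ ≤ _ := Real.rpow_le_rpow (by positivity) (le_Gamma_add_one hA) hv0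
  have h2 : A ^ (1 / 3 : ℝ) * (A + 1) ^ (2 * t + 2 / 3) ≤ A ^ (2 * t + 1) * Real.exp 3 := by
    have e1 : A + 1 = A * (1 + 1 / A) := by field_simp
    calc A ^ (1 / 3 : ℝ) * (A + 1) ^ (2 * t + 2 / 3) =
          A ^ (2 * t + 1) * (1 + 1 / A) ^ (2 * t + 2 / 3) := by
          rw [e1, Real.mul_rpow hA0.le (by positivity), ← mul_assoc, ← Real.rpow_add hA0]
          congr 2
          ring
      _ ≤ _ := by
          gcongr
          refine (one_add_rpow_le_exp (by positivity) (by positivity)).trans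
            (Real.exp_le_exp.mpr ?_)
          rw [one_div, inv_mul_le_iff₀ hA0]
          linarith
  have h3 : A ^ (1 / 3 : ℝ) * (A + 1) ^ (2 * t + 2 / 3) ≤
      Real.exp (2 * t + 9) * Real.Gamma (A + 1) ^ v := by
    calc _ ≤ A ^ (2 * t + 1) * Real.exp 3 := h2
      _ = Real.exp (2 * t + 9) * (Real.exp (-(2 * t + 6)) * A ^ (2 * t + 1)) := by
          rw [← mul_assoc, ← Real.exp_add, mul_comm]
          congr 2
          ring
      _ ≤ _ := by gcongr
  rw [Real.rpow_sub hG, Real.rpow_two, show -2 * t - 2 / 3 = -(2 * t + 2 / 3) by ring,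
    Real.rpow_neg (by linarith : 0 ≤ A + 1), ← mul_assoc, ← mul_assoc, ← Real.exp_add,
    add_comm 9, ← div_eq_mul_inv, ← mul_div_assoc,
    div_le_div_iff₀ (by positivity) (by positivity)]
  calc A ^ (1 / 3 : ℝ) * Real.Gamma (A + 1) ^ 2 * (A + 1) ^ (2 * t + 2 / 3) =
        (A ^ (1 / 3 : ℝ) * (A + 1) ^ (2 * t + 2 / 3)) * Real.Gamma (A + 1) ^ 2 := by ring
    _ ≤ (Real.exp (2 * t + 9) * Real.Gamma (A + 1) ^ v) * Real.Gamma (A + 1) ^ 2 := by gcongr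
    _ = _ := by ring

/-- The weighted `L²` bound multiplied by the kernel at `1`, with the power of `Γ (α + r + 2)` turned
into its square by `rpow_mul_Gamma_rpow_le`. -/
theorem jacobiK_one_mul_integral_jacobiP_sq_le {α β r s : ℝ} {m n : ℕ} (hβα : β ≤ α)
    (hβ : 2 ≤ β) (hsr : s ≤ r) (hs : -1 < s) (hn : (2 * α + r + 1) ^ 2 ≤ n)
    (hm : (α + β) ^ 2 ≤ m) :
    jacobiK α β m 1 *
        (∫ x in (-1 : ℝ)..1,
          |(jacobiP (α + r + 1) (β - 1) n).eval x / (jacobiP (α + r + 1) (β - 1) n).eval 1| ^ 2 *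
            (1 - x) ^ (s + α) * (1 + x) ^ β) ≤
      512 * Real.exp 11 * (Real.exp (2 * r - 2 * s) * (2 : ℝ) ^ s *
        ((m : ℝ) / n) ^ (2 * α + 2 * s + 2) * (m : ℝ) ^ (-2 * s) *
        (Real.Gamma (α + r + 2) ^ 2 / (Real.Gamma (α + 1) * Real.Gamma (α + 2))) *
        (α + r + 2) ^ (2 * s - 2 * r - 2 / 3)) := by
  have hm0 : (0 : ℝ) < m := by nlinarith
  have hn0 : (0 : ℝ) < n := by nlinarith
  have h1 := Real.Gamma_pos_of_pos (show (0 : ℝ) < α + 1 by linarith)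
  have h2 := Real.Gamma_pos_of_pos (show (0 : ℝ) < α + 2 by linarith)
  have h3 := Real.Gamma_pos_of_pos (show (0 : ℝ) < α + r + 2 by linarith)
  have hA0 : (0 : ℝ) < α + r + 1 := by linarith
  have hK0 : 0 ≤ jacobiK α β m 1 := Finset.sum_nonneg fun _ _ => mul_self_nonneg _
  have hG := rpow_mul_Gamma_rpow_le (A := α + r + 1) (t := r - s) (by linarith) (by linarith)
    (by linarith)
  rw [show α + r + 1 + 1 = α + r + 2 by ring,
    show 2 - (2 * (r - s) + 1) / (α + r + 1 + 1 / 2) =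
      (4 * α + 4 * s + 4) / (2 * α + 2 * r + 3) by
        have h4 : 2 * α + 2 * r + 3 ≠ 0 := by linarith
        rw [show α + r + 1 + 1 / 2 = (2 * α + 2 * r + 3) / 2 by ring, eq_div_iff h4,
          div_div_eq_mul_div, sub_mul, div_mul_cancel₀ _ h4]
        ring,
    show 2 * (r - s) = 2 * r - 2 * s by ring,
    show -2 * (r - s) - 2 / 3 = 2 * s - 2 * r - 2 / 3 by ring] at hG
  have e1 : (2 : ℝ) ^ (α + β + s) = 2 ^ (α + β + 1) * 2 ^ s / 2 := by
    rw [← Real.rpow_add two_pos, eq_div_iff two_ne_zero, ← Real.rpow_add_one two_ne_zero]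
    congr 1
    ring
  have e2 : ((m : ℝ) / n) ^ (2 * α + 2 * s + 2) * (m : ℝ) ^ (-2 * s) =
      (m : ℝ) ^ (2 * α + 2) * (n : ℝ) ^ (-2 * α - 2 * s - 2) := by
    rw [Real.div_rpow hm0.le hn0.le, div_eq_mul_inv, ← Real.rpow_neg hn0.le, mul_right_comm,
      ← Real.rpow_add hm0]
    congr 2 <;> ring
  have e3 : Real.exp 11 = Real.exp 2 * Real.exp 9 := by
    rw [← Real.exp_add]
    norm_num
  calc _ ≤ jacobiK α β m 1 * (1024 * ((2 : ℝ) ^ (α + β + s) * (α + r + 1) ^ (1 / 3 : ℝ) *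
        Real.Gamma (α + r + 2) ^ ((4 * α + 4 * s + 4) / (2 * α + 2 * r + 3)) *
        (n : ℝ) ^ (-2 * α - 2 * s - 2))) :=
        mul_le_mul_of_nonneg_left (integral_jacobiP_sq_le hβα hβ hsr hs hn) hK0
    _ ≤ Real.exp 2 * ((m : ℝ) ^ (2 * α + 2) /
          (2 ^ (α + β + 1) * (Real.Gamma (α + 1) * Real.Gamma (α + 2)))) *
        (1024 * ((2 : ℝ) ^ (α + β + s) * (α + r + 1) ^ (1 / 3 : ℝ) *
        Real.Gamma (α + r + 2) ^ ((4 * α + 4 * s + 4) / (2 * α + 2 * r + 3)) *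
        (n : ℝ) ^ (-2 * α - 2 * s - 2))) := by
        gcongr
        exact jacobiK_one_le hβ hβα hm
    _ = 512 * Real.exp 2 * (2 : ℝ) ^ s * ((m : ℝ) ^ (2 * α + 2) *
          (n : ℝ) ^ (-2 * α - 2 * s - 2)) / (Real.Gamma (α + 1) * Real.Gamma (α + 2)) *
        ((α + r + 1) ^ (1 / 3 : ℝ) *
          Real.Gamma (α + r + 2) ^ ((4 * α + 4 * s + 4) / (2 * α + 2 * r + 3))) := by
        rw [e1]
        field_simp
        ring
    _ ≤ 512 * Real.exp 2 * (2 : ℝ) ^ s * ((m : ℝ) ^ (2 * α + 2) *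
          (n : ℝ) ^ (-2 * α - 2 * s - 2)) / (Real.Gamma (α + 1) * Real.Gamma (α + 2)) *
        (Real.exp 9 * (Real.exp (2 * r - 2 * s) * Real.Gamma (α + r + 2) ^ 2 *
          (α + r + 2) ^ (2 * s - 2 * r - 2 / 3))) := by
        gcongr
    _ = _ := by
        rw [← e2, e3]
        ring

theorem theorem7p1 :
    -- (a)
    (∃ c₀ > (0 : ℝ), ∃ C > (0 : ℝ), ∀ (a b A B p : ℝ) (n : ℕ),
      b ≤ a → 0 ≤ b → B ≤ A → 1 ≤ B → 0 < p →
      p * B + p / 2 ≤ 2 * b → 2 * a + 2 < p * A + p / 2 →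
      c₀ * (A * ((2 * a + 2) / (p * (A + 1 / 2) - 2 * a - 2)) ^ (1 / p)) ≤ n →
      (∫ x in (-1 : ℝ)..1,
          |(jacobiP A B n).eval x / (jacobiP A B n).eval 1| ^ p * (1 - x) ^ a * (1 + x) ^ b)
        ≤ C * ((2 : ℝ) ^ (a + b) / (2 * a + 2) *
            (A ^ (1 / 6 : ℝ) / ((2 : ℝ) ^ ((A + B - 1) / 2) * (jacobiP A B n).eval 1)) ^
              ((2 * a + 2) / (A + 1 / 2)) *
            ((2 * a + 2) / (p * (A + 1 / 2) - 2 * a - 2)) ^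
              ((2 * a + 2) / (p * (A + 1 / 2))))) ∧
    -- (b)
    (∃ C > (0 : ℝ), ∀ (α β r s : ℝ) (n : ℕ),
      β ≤ α → 2 ≤ β → s ≤ r → -1 < s → (2 * α + r + 1) ^ 2 ≤ n →
      (∫ x in (-1 : ℝ)..1,
          |(jacobiP (α + r + 1) (β - 1) n).eval x / (jacobiP (α + r + 1) (β - 1) n).eval 1| ^ 2 *
            (1 - x) ^ (s + α) * (1 + x) ^ β)
        ≤ C * ((2 : ℝ) ^ (α + β + s) * (α + r + 1) ^ (1 / 3 : ℝ) *
            Real.Gamma (α + r + 2) ^ ((4 * α + 4 * s + 4) / (2 * α + 2 * r + 3)) *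
            (n : ℝ) ^ (-2 * α - 2 * s - 2))) ∧
    -- (c)
    (∃ C > (0 : ℝ), ∀ (α β r s : ℝ) (m n : ℕ),
      β ≤ α → 2 ≤ β → s ≤ r → -1 < s → (2 * α + r + 1) ^ 2 ≤ n → (α + β) ^ 2 ≤ m →
      jacobiK α β m 1 *
          (∫ x in (-1 : ℝ)..1,
            |(jacobiP (α + r + 1) (β - 1) n).eval x / (jacobiP (α + r + 1) (β - 1) n).eval 1| ^ 2 *
              (1 - x) ^ (s + α) * (1 + x) ^ β)
        ≤ C * (Real.exp (2 * r - 2 * s) * (2 : ℝ) ^ s *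
            ((m : ℝ) / n) ^ (2 * α + 2 * s + 2) * (m : ℝ) ^ (-2 * s) *
            (Real.Gamma (α + r + 2) ^ 2 / (Real.Gamma (α + 1) * Real.Gamma (α + 2))) *
            (α + r + 2) ^ (2 * s - 2 * r - 2 / 3))) := by
  refine ⟨⟨4096, by norm_num, 24, by norm_num, ?_⟩, ⟨1024, by norm_num, ?_⟩,
    ⟨512 * Real.exp 11, by positivity, ?_⟩⟩
  · intro a b A B p n hab hb0 hBA hB hp hb hap hn
    exact integral_jacobiP_rpow_le_of_le hab hb0 hBA hB hp hb hap hn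
  · intro α β r s n hβα hβ hsr hs hn
    exact integral_jacobiP_sq_le hβα hβ hsr hs hn
  · intro α β r s m n hβα hβ hsr hs hn hm
    exact jacobiK_one_mul_integral_jacobiP_sq_le hβα hβ hsr hs hn hm
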